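/- Let $M$ be a real analytic manifold, let $T>0$, and let $W\subseteq M$ be open. Let $\mathbb C TM=TM\otimes_{\mathbb R}\mathbb C$. For a complex vector field $Z$ and a complex tensor field $\alpha$ of type $(p,q)$ (a section of $(TM)^{\otimes p}\otimes(T^*M)^{\otimes q}\otimes\mathbb C$), the complex Lie derivative $\mathscr L_Z\alpha$ is the $\mathbb C$-bilinear extension of the usual Lie derivative, i.e. $\mathscr L_Z\alpha=\mathscr L_{\mathrm{Re} Z}\alpha+i\,\mathscr L_{\mathrm{Im} Z}\alpha$. A path $t\mapsto A_t$, $t\in[0,T]$, of (complex) vector fields or tensor fields on an open set $U$ is called piecewise real analytic if there is a partition $0=s_0<s_1<\dots<s_N=T$ such that on each $[s_i,s_{i+1})\times U$ the map $(t,x)\mapsto A_t(x)$ coincides with one that is jointly real analytic in $(t,x)$ on $[s_i,s_{i+1}]\times U$, including the end points of the time interval (jumps at the $s_i$ are allowed). A $C^1$ transport of $\alpha$ through $Z_\bullet$ on $[0,\tau]\times U$ is a path of tensors $\beta_t$, $t\in[0,\tau]$, on $U$ that is jointly $C^1$ in $(t,x)\in[0,\tau]\times U$ and satisfies $$\dot\beta_t=\mathscr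 L_{Z_t}\beta_t\quad (t\in[0,\tau]),\qquad \beta_0=\alpha\qquad\text{on }U .$$ Let $(Z_t)_{t\in[0,T]}$ be a piecewise real analytic path of complex vector fields on $W$ and let $\alpha$ be a real analytic complex tensor of type $(p,q)$ on $W$. (1) For every $p_0\in W$ there are an open neighborhood $U\subseteq W$ of $p_0$, a time $T_0\in(0,T]$ and a $C^1$ transport $(\alpha_t)_{t\in[0,T_0]}$ of $\alpha$ through $Z_\bullet$ on $[0,T_0]\times U$. The path $t\mapsto\alpha_t$ is piecewise real analytic and each $\alpha_t$ is a real analytic tensor on $U$. It is unique in the following senses: (a) every $C^1$ transport of $\alpha$ on $[0,T_0]\times U$ that is piecewise real analytic equals $\alpha_t$ on all of $[0,T_0]\times U$; (b) for every open neighborhood $U'\subseteq W$ of $p_0$ and every $T'\in(0,T]$ there are an open neighborhood $V\subseteq U\cap U'$ of $p_0$ and $T''\in(0,\min(T_0,T')]$ such that every $C^1$ transport of $\alpha$ on $[0,T']\times U'$ coincides with $\alpha_t$ on $[0,T'']\times V$. (2) If $M$ is compact and $W=M$, there are $T_0\in(0,T]$ and a $C^1$ transport $(\alpha_t)_{t\in[0,T_0]}$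 of $\alpha$ through $Z_\bullet$ on $[0,T_0]\times M$, which is piecewise real analytic in $t$ and such that each $\alpha_t$ is a real analytic tensor; and for every $T'\in(0,T_0]$ every $C^1$ transport of $\alpha$ on $[0,T']\times M$ coincides with $\alpha_t$ for all $t\in[0,T']$. -/

import Mathlib

open Set
open scoped Manifold ContDiff TensorProduct

noncomputable section

/-- The complex tensors of type `(p, q)` on a finite-dimensional real vector space `V`, that is
`(V^{⊗ p} ⊗ (V^*)^{⊗ q}) ⊗_ℝ ℂ`, realised as the real-multilinear maps
`(ω₁, …, ω_p, v₁, …, v_q) ↦ α(ω₁, …, ω_p)(v₁, …, v_q) ∈ ℂ` of `p` covectors and `q` vectors. -/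
abbrev CTensor (p q : ℕ) (V : Type*) [AddCommGroup V] [Module ℝ V] [TopologicalSpace V]
    [IsTopologicalAddGroup V] [ContinuousSMul ℝ V] : Type _ :=
  ContinuousMultilinearMap ℝ (fun _ : Fin p => V →L[ℝ] ℝ)
    (ContinuousMultilinearMap ℝ (fun _ : Fin q => V) ℂ)

namespace CTensor

/-- The pull-back of a tensor under an invertible linear map `B : V → V'`:
`(B^* α)(ω₁, …, ω_p, v₁, …, v_q) = α(ω₁ ∘ B⁻¹, …, ω_p ∘ B⁻¹, B v₁, …, B v_q)`. -/
def pullback {p q : ℕ}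
    {V : Type*} [AddCommGroup V] [Module ℝ V] [TopologicalSpace V]
    [IsTopologicalAddGroup V] [ContinuousSMul ℝ V]
    {V' : Type*} [AddCommGroup V'] [Module ℝ V'] [TopologicalSpace V']
    [IsTopologicalAddGroup V'] [ContinuousSMul ℝ V']
    (B : V →L[ℝ] V') (α : CTensor p q V') : CTensor p q V :=
  ((ContinuousMultilinearMap.compContinuousLinearMapL (fun _ : Fin q => B)
      ).compContinuousMultilinearMap α).compContinuousLinearMap
    (fun _ => ContinuousLinearMap.precomp ℝ B.inverse)

variable {p q : ℕ} {E : Type*} [NormedAddCommGroup E] [NormedSpace ℝ E]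

/-- The tensor `(ω, v) ↦ α(ω₁, …, ω_i ∘ L, …, ω_p, v₁, …, v_q)`. -/
def actCovector (L : E →L[ℝ] E) (i : Fin p) (α : CTensor p q E) : CTensor p q E :=
  α.compContinuousLinearMap
    (Function.update (fun _ => ContinuousLinearMap.id ℝ (E →L[ℝ] ℝ)) i
      (ContinuousLinearMap.precomp ℝ L))

/-- The tensor `(ω, v) ↦ α(ω₁, …, ω_p, v₁, …, L v_j, …, v_q)`. -/
def actVector (L : E →L[ℝ] E) (j : Fin q) (α : CTensor p q E) : CTensor p q E :=
  (ContinuousMultilinearMap.compContinuousLinearMapL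
    (Function.update (fun _ => ContinuousLinearMap.id ℝ E) j L)
    ).compContinuousMultilinearMap α

/-- The Lie derivative of a complex tensor field `A` along a real vector field `X` in linear
coordinates:
`(𝓛_X A)(ω, v) = (∂_X A)(ω, v) - ∑ i, A(…, ω_i ∘ DX, …, v) + ∑ j, A(ω, …, DX v_j, …)`. -/
def lieFlat (X : E → E) (A : E → CTensor p q E) (y : E) : CTensor p q E :=
  fderiv ℝ A y (X y)
    - ∑ i : Fin p, actCovector (fderiv ℝ X y) i (A y)
    + ∑ j : Fin q, actVector (fderiv ℝ X y) j (A y)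

end CTensor

/-- The real part of an element of the complexification `ℂ ⊗ V`, for `V` a real vector space. -/
def complexifiedRe {V : Type*} [AddCommGroup V] [Module ℝ V] (z : ℂ ⊗[ℝ] V) : V :=
  TensorProduct.lid ℝ V (LinearMap.rTensor V Complex.reLm z)

/-- The imaginary part of an element of the complexification `ℂ ⊗ V`. -/
def complexifiedIm {V : Type*} [AddCommGroup V] [Module ℝ V] (z : ℂ ⊗[ℝ] V) : V :=
  TensorProduct.lid ℝ V (LinearMap.rTensor V Complex.imLm z)

section Manifold

variable {p q : ℕ} {E : Type*} [NormedAddCommGroup E] [NormedSpace ℝ E]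
  {M : Type*} [TopologicalSpace M] [ChartedSpace E M]

/-- The part of the coordinate domain of the chart at `c` that corresponds to `U ⊆ M`. -/
def chartPart (E : Type*) [NormedAddCommGroup E] [NormedSpace ℝ E]
    {M : Type*} [TopologicalSpace M] [ChartedSpace E M] (c : M) (U : Set M) : Set E :=
  (extChartAt 𝓘(ℝ, E) c).target ∩ (extChartAt 𝓘(ℝ, E) c).symm ⁻¹' U

/-- The expression of a real vector field in the chart at `c`. -/
def vectorInChart (c : M) (X : (x : M) → TangentSpace 𝓘(ℝ, E) x) : E → E :=
  VectorField.mpullback 𝓘(ℝ, E) 𝓘(ℝ, E) (extChartAt 𝓘(ℝ, E) c).symm X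

/-- The expression of a complex vector field in the chart at `c`, as the pair of its
real and imaginary parts. -/
def complexVectorInChart (c : M) (Z : (x : M) → ℂ ⊗[ℝ] TangentSpace 𝓘(ℝ, E) x) : E → E × E :=
  fun y => (vectorInChart c (fun x => complexifiedRe (Z x)) y,
    vectorInChart c (fun x => complexifiedIm (Z x)) y)

/-- The expression of a complex tensor field in the chart at `c`. -/
def tensorInChart (c : M) (α : (x : M) → CTensor p q (TangentSpace 𝓘(ℝ, E) x)) :
    E → CTensor p q E :=
  fun y => CTensor.pullback
    (mfderiv 𝓘(ℝ, E) 𝓘(ℝ, E) (extChartAt 𝓘(ℝ, E) c).symm y :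
      E →L[ℝ] TangentSpace 𝓘(ℝ, E) ((extChartAt 𝓘(ℝ, E) c).symm y))
    (α ((extChartAt 𝓘(ℝ, E) c).symm y))

/-- The Lie derivative of a complex tensor field along a real vector field, computed at each
point `x` in the chart at `x`. -/
def realLieDerivative (X : (x : M) → TangentSpace 𝓘(ℝ, E) x)
    (α : (x : M) → CTensor p q (TangentSpace 𝓘(ℝ, E) x)) (x : M) :
    CTensor p q (TangentSpace 𝓘(ℝ, E) x) :=
  CTensor.pullback (mfderiv 𝓘(ℝ, E) 𝓘(ℝ, E) (extChartAt 𝓘(ℝ, E) x) x)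
    (CTensor.lieFlat (E := E) (vectorInChart x X) (tensorInChart x α) (extChartAt 𝓘(ℝ, E) x x))

/-- The complex Lie derivative: the `ℂ`-bilinear extension
`𝓛_Z α = 𝓛_{Re Z} α + i 𝓛_{Im Z} α` of the Lie derivative. -/
def complexLieDerivative (Z : (x : M) → ℂ ⊗[ℝ] TangentSpace 𝓘(ℝ, E) x)
    (α : (x : M) → CTensor p q (TangentSpace 𝓘(ℝ, E) x)) (x : M) :
    CTensor p q (TangentSpace 𝓘(ℝ, E) x) :=
  realLieDerivative (fun x => complexifiedRe (Z x)) α x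
    + Complex.I • realLieDerivative (fun x => complexifiedIm (Z x)) α x

/-- A complex tensor field is real analytic on `U`. -/
def IsAnalyticTensorOn (α : (x : M) → CTensor p q (TangentSpace 𝓘(ℝ, E) x)) (U : Set M) : Prop :=
  ∀ c : M, AnalyticOn ℝ (tensorInChart c α) (chartPart E c U)

/-- Piecewise analyticity of a time-dependent object on `[0, T] × U` whose expression at time `t` in
the chart at `c` is `f c t`: there is a partition `0 = s 0 < ⋯ < s N = T` such that on each
`[s i, s (i + 1)) × U` the object coincides with one that is jointly real analytic in `(t, x)` on
`[s i, s (i + 1)] × U`, up to and including the end points (jumps are allowed at the `s i`). -/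
def IsPiecewiseAnalyticOn {F : Type*} [NormedAddCommGroup F] [NormedSpace ℝ F]
    (f : M → ℝ → E → F) (T : ℝ) (U : Set M) : Prop :=
  ∃ (N : ℕ) (s : Fin (N + 1) → ℝ), StrictMono s ∧ s 0 = 0 ∧ s (Fin.last N) = T ∧
    ∀ (i : Fin N) (c : M), ∃ g : ℝ × E → F,
      AnalyticOn ℝ g (Icc (s i.castSucc) (s i.succ) ×ˢ chartPart E c U) ∧
      ∀ t ∈ Ico (s i.castSucc) (s i.succ), ∀ y ∈ chartPart E c U, f c t y = g (t, y)

/-- `β` is, on `[0, T] × U`, a transport of `α` through the path `Z` of complex vector fields: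
a `C¹` solution of `∂β_t/∂t = 𝓛_{Z_t} β_t`, `β_0 = α`. -/
structure IsTransportOn (Z : ℝ → (x : M) → ℂ ⊗[ℝ] TangentSpace 𝓘(ℝ, E) x)
    (α : (x : M) → CTensor p q (TangentSpace 𝓘(ℝ, E) x)) (U : Set M) (T : ℝ)
    (β : ℝ → (x : M) → CTensor p q (TangentSpace 𝓘(ℝ, E) x)) : Prop where
  contDiffOn : ∀ c : M, ContDiffOn ℝ 1 (fun z : ℝ × E => tensorInChart c (β z.1) z.2)
    (Icc 0 T ×ˢ chartPart E c U)
  initial : ∀ x ∈ U, β 0 x = α x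
  equation : ∀ t ∈ Icc 0 T, ∀ x ∈ U,
    HasDerivWithinAt (fun s => β s x) (complexLieDerivative (Z t) (β t) x) (Icc 0 T) t

end Manifold

end

/-! In a chart the transport equation is a linear first order system `∂_t β = P(∂_x β) + B β` with
analytic coefficients. Since `P` contains `i ∂_{Im Z}`, there is in general no real flow to pull
back along and no hyperbolicity; existence and uniqueness both rest on analyticity.

Existence is Cauchy–Kovalevskaya, obtained by summing `∑ t^k L^k f / k!` for `L f = P(Df) + B f`. If
`f` is majorized by `c g` with `g = 1/(1 - R X)`, then `L^k f` is majorized by `c (2KR)^k k!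
g^(2k+1)` (`isMajorizedOn_iterate_firstOrderOp`); the factorials cancel and the series converges for
a time that depends on `K` and `R` but not on `c`. Time-dependent coefficients are reduced to this
case by counting time among the space variables (`exists_solvesEvolutionAt`).

Uniqueness among `C¹` solutions is Holmgren's theorem (`exists_forall_eq_zero_of_isNullSolutionOn`).
A solution with zero initial value is extended by zero to the past, and time is sheared by a
paraboloid so that the solution acquires compact support in space. Its pairing with a solution of
the adjoint equation is constant in time, hence zero. The adjoint equation is solvable for all
entire data on one common time interval, because the existence time ignores `c`; entire data are
dense, so the solution vanishes.

`CTensor.lieFlat_pullback`, the naturality of the Lie derivative, moves the equation from the chart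
at each point to one fixed chart. Holmgren's theorem is only local, with a time that depends on the
point. For solutions piecewise analytic in time the identity theorem at each fixed point carries the
agreement to the end of the current time interval, uniformly in the point
(`IsLieEvolutionOn.eqOn_of_isPiecewiseAnalyticOn`). On a compact manifold a finite cover gives a
uniform time instead, and local solutions agree on overlaps, hence glue. All existence times lie
within the first interval of the partition for `Z`, where `Z` is analytic. -/

noncomputable section

/-! ### Majorants of Taylor coefficients and Cauchy estimates. -/

section Majorants

open scoped Nat PowerSeries

variable {G : Type*} [NormedAddCommGroup G] [NormedSpace ℝ G]
  {G' : Type*} [NormedAddCommGroup G'] [NormedSpace ℝ G']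
  {F : Type*} [NormedAddCommGroup F] [NormedSpace ℝ F]
  {F₁ : Type*} [NormedAddCommGroup F₁] [NormedSpace ℝ F₁]
  {F₂ : Type*} [NormedAddCommGroup F₂] [NormedSpace ℝ F₂]

/-- The geometric power series `1 / (1 - R X)`. -/
def geomPowerSeries (R : ℝ) : ℝ⟦X⟧ := PowerSeries.mk fun m => R ^ m

theorem coeff_geomPowerSeries (R : ℝ) (m : ℕ) :
    PowerSeries.coeff m (geomPowerSeries R) = R ^ m := by
  simp [geomPowerSeries]

theorem derivative_geomPowerSeries (R : ℝ) :
    PowerSeries.derivative ℝ (geomPowerSeries R) = PowerSeries.C R * geomPowerSeries R ^ 2 := by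
  ext m
  rw [PowerSeries.coeff_derivative, PowerSeries.coeff_C_mul, pow_two, PowerSeries.coeff_mul]
  simp only [coeff_geomPowerSeries]
  rw [Finset.sum_congr rfl (fun x hx => by
    rw [← pow_add, Finset.HasAntidiagonal.mem_antidiagonal.1 hx])]
  simp [Finset.Nat.card_antidiagonal]
  ring

/-- Differentiation raises the exponent by one, so the powers of a single geometric series suffice
to majorize all iterates of a first order operator. -/
theorem derivative_geomPowerSeries_pow (R : ℝ) (a : ℕ) :
    PowerSeries.derivative ℝ (geomPowerSeries R ^ a)
      = PowerSeries.C (a * R) * geomPowerSeries R ^ (a + 1) := by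
  rw [Derivation.leibniz_pow, derivative_geomPowerSeries]
  rcases a with _ | a
  · simp
  · simp only [add_tsub_cancel_right, nsmul_eq_mul, smul_eq_mul, map_mul, map_natCast]
    ring

theorem coeff_geomPowerSeries_pow_nonneg {R : ℝ} (hR : 0 ≤ R) (a m : ℕ) :
    0 ≤ PowerSeries.coeff m (geomPowerSeries R ^ a) := by
  induction a generalizing m with
  | zero => rw [pow_zero, PowerSeries.coeff_one]; split_ifs <;> norm_num
  | succ a ih =>
    rw [pow_succ, PowerSeries.coeff_mul]
    refine Finset.sum_nonneg fun x _ => mul_nonneg (ih _) ?_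
    rw [coeff_geomPowerSeries]; positivity

theorem coeff_geomPowerSeries_pow_le_succ {R : ℝ} (hR : 0 ≤ R) (a m : ℕ) :
    PowerSeries.coeff m (geomPowerSeries R ^ a)
      ≤ PowerSeries.coeff m (geomPowerSeries R ^ (a + 1)) := by
  rw [pow_succ, PowerSeries.coeff_mul]
  have h := Finset.single_le_sum (s := Finset.HasAntidiagonal.antidiagonal m)
    (f := fun x => PowerSeries.coeff x.1 (geomPowerSeries R ^ a)
      * PowerSeries.coeff x.2 (geomPowerSeries R)) (fun x _ =>
      mul_nonneg (coeff_geomPowerSeries_pow_nonneg hR _ _) (by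
        rw [coeff_geomPowerSeries]; positivity)) (a := (m, 0)) (by simp [Finset.HasAntidiagonal.mem_antidiagonal])
  simpa [coeff_geomPowerSeries] using h

/-- Doubling `R` once pays for all powers: each further factor costs a geometric sum `∑_{i ≤ m} 2^i
< 2^(m+1)`, that is, a constant `2`. -/
theorem coeff_geomPowerSeries_pow_le {R : ℝ} (hR : 0 ≤ R) (a m : ℕ) :
    PowerSeries.coeff m (geomPowerSeries R ^ a) ≤ 2 ^ a * (2 * R) ^ m := by
  induction a generalizing m with
  | zero =>
    rw [pow_zero, PowerSeries.coeff_one]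
    split_ifs with h
    · simp [h]
    · positivity
  | succ a ih =>
    rw [pow_succ, PowerSeries.coeff_mul, Finset.Nat.sum_antidiagonal_eq_sum_range_succ_mk]
    calc _ ≤ ∑ i ∈ Finset.range m.succ, 2 ^ a * R ^ m * 2 ^ i := by
          refine Finset.sum_le_sum fun i hi => ?_
          rw [coeff_geomPowerSeries]
          have hi' : i + (m - i) = m := by
            have := Finset.mem_range.1 hi; omega
          calc _ ≤ 2 ^ a * (2 * R) ^ i * R ^ (m - i) := by gcongr; exact ih i
            _ = 2 ^ a * R ^ (i + (m - i)) * 2 ^ i := by rw [mul_pow, pow_add]; ring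
            _ = _ := by rw [hi']
      _ = 2 ^ a * R ^ m * (2 ^ (m + 1) - 1) := by
          rw [← Finset.mul_sum]
          congr 1
          have := geom_sum_eq (x := (2 : ℝ)) (by norm_num) (m + 1)
          rw [Nat.succ_eq_add_one, this]; norm_num
      _ ≤ 2 ^ a * R ^ m * 2 ^ (m + 1) := by gcongr; linarith
      _ = _ := by rw [mul_pow]; ring

/-- On `S`, the function `f` is real analytic and its Taylor coefficients at every point are
bounded by the coefficients of the power series `a`. -/
def IsMajorizedOn (S : Set G) (f : G → F) (a : ℝ⟦X⟧) : Prop :=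
  AnalyticOnNhd ℝ f S ∧
    ∀ x ∈ S, ∀ m : ℕ, ‖iteratedFDeriv ℝ m f x‖ ≤ m ! * PowerSeries.coeff m a

namespace IsMajorizedOn

variable {S S' : Set G} {f g : G → F} {a b : ℝ⟦X⟧}

theorem mono_set (h : IsMajorizedOn S f a) (hS : S' ⊆ S) : IsMajorizedOn S' f a :=
  ⟨h.1.mono hS, fun x hx => h.2 x (hS hx)⟩

theorem mono (h : IsMajorizedOn S f a)
    (ha : ∀ m, PowerSeries.coeff m a ≤ PowerSeries.coeff m b) : IsMajorizedOn S f b :=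
  ⟨h.1, fun x hx m => (h.2 x hx m).trans (by gcongr; exact ha m)⟩

theorem coeff_nonneg (h : IsMajorizedOn S f a) {x : G} (hx : x ∈ S) (m : ℕ) :
    0 ≤ PowerSeries.coeff m a := by
  have h1 := (norm_nonneg _).trans (h.2 x hx m)
  exact nonneg_of_mul_nonneg_right h1 (by positivity)

theorem add [CompleteSpace F] (hf : IsMajorizedOn S f a) (hg : IsMajorizedOn S g b) :
    IsMajorizedOn S (fun x => f x + g x) (a + b) := by
  refine ⟨hf.1.add hg.1, fun x hx m => ?_⟩
  have h1 : iteratedFDeriv ℝ m (fun x => f x + g x) x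
      = iteratedFDeriv ℝ m f x + iteratedFDeriv ℝ m g x :=
    iteratedFDeriv_add_apply (hf.1 x hx).contDiffAt (hg.1 x hx).contDiffAt
  rw [h1, map_add, mul_add]
  exact (norm_add_le _ _).trans (add_le_add (hf.2 x hx m) (hg.2 x hx m))

theorem clm_comp [CompleteSpace F] (L : F →L[ℝ] F₁) (hf : IsMajorizedOn S f a) :
    IsMajorizedOn S (fun x => L (f x)) (PowerSeries.C ‖L‖ * a) := by
  refine ⟨L.comp_analyticOnNhd hf.1, fun x hx m => ?_⟩
  rw [PowerSeries.coeff_C_mul]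
  calc _ ≤ ‖L‖ * ‖iteratedFDeriv ℝ m f x‖ :=
        L.norm_iteratedFDeriv_comp_left (hf.1 x hx).contDiffAt le_top
    _ ≤ ‖L‖ * (m ! * PowerSeries.coeff m a) := by gcongr; exact hf.2 x hx m
    _ = _ := by ring

theorem comp_clm (hS : IsOpen S) (L : G' →L[ℝ] G) (hL : ‖L‖ ≤ 1) (hf : IsMajorizedOn S f a) :
    IsMajorizedOn (L ⁻¹' S) (fun x => f (L x)) a := by
  refine ⟨fun x hx => (hf.1 _ hx).comp (L.analyticAt x), fun x hx m => ?_⟩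
  have hS' : IsOpen (L ⁻¹' S) := hS.preimage L.continuous
  have h1 := L.iteratedFDerivWithin_comp_right (n := ω) (i := m) (hf.1.contDiffOn hS.uniqueDiffOn) hS.uniqueDiffOn
    hS'.uniqueDiffOn hx le_top
  rw [iteratedFDerivWithin_of_isOpen _ hS hx, iteratedFDerivWithin_of_isOpen _ hS' hx] at h1
  change ‖iteratedFDeriv ℝ m (f ∘ L) x‖ ≤ _
  rw [h1]
  refine (ContinuousMultilinearMap.norm_compContinuousLinearMap_le _ _).trans ?_
  refine le_trans ?_ (hf.2 _ hx m)
  refine mul_le_of_le_one_right (norm_nonneg _) ?_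
  simpa using pow_le_one₀ (norm_nonneg _) hL

theorem bilinear [CompleteSpace F] (hS : IsOpen S) (B : F →L[ℝ] F₁ →L[ℝ] F₂) (hB : ‖B‖ ≤ 1) {g : G → F₁}
    (hf : IsMajorizedOn S f a) (hg : IsMajorizedOn S g b) :
    IsMajorizedOn S (fun x => B (f x) (g x)) (a * b) := by
  refine ⟨fun x hx => ?_, fun x hx m => ?_⟩
  · exact (B.analyticAt_bilinear _).comp₂ (hf.1 x hx) (hg.1 x hx)
  have h := B.norm_iteratedFDerivWithin_le_of_bilinear_of_le_one (N := ω) (n := m)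
    (hf.1.contDiffOn hS.uniqueDiffOn) (hg.1.contDiffOn hS.uniqueDiffOn)
    hS.uniqueDiffOn hx le_top hB
  simp only [iteratedFDerivWithin_of_isOpen _ hS hx] at h
  refine h.trans ?_
  rw [PowerSeries.coeff_mul, Finset.Nat.sum_antidiagonal_eq_sum_range_succ_mk, Finset.mul_sum]
  refine Finset.sum_le_sum fun i hi => ?_
  have him : i ≤ m := Nat.lt_succ_iff.1 (Finset.mem_range.1 hi)
  -- With derivatives normalized by `m!`, the binomial coefficients of the Leibniz rule disappear
  -- and leave the Cauchy product of the majorants.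
  have h1 : ((m.choose i : ℝ)) * i ! * (m - i)! = m ! := by
    exact_mod_cast Nat.choose_mul_factorial_mul_factorial him
  calc _ ≤ (m.choose i : ℝ) * (i ! * PowerSeries.coeff i a)
        * ((m - i)! * PowerSeries.coeff (m - i) b) := by
        have := hf.coeff_nonneg hx i
        gcongr
        · exact hf.2 x hx i
        · exact hg.2 x hx _
    _ = (m.choose i : ℝ) * i ! * (m - i)! * (PowerSeries.coeff i a * PowerSeries.coeff (m - i) b) := by
        ring
    _ = _ := by rw [h1]

theorem fderiv [CompleteSpace F] (hf : IsMajorizedOn S f a) :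
    IsMajorizedOn S (fderiv ℝ f) (PowerSeries.derivative ℝ a) := by
  refine ⟨hf.1.fderiv, fun x hx m => ?_⟩
  rw [norm_iteratedFDeriv_fderiv, PowerSeries.coeff_derivative]
  refine (hf.2 x hx (m + 1)).trans (le_of_eq ?_)
  rw [Nat.factorial_succ]; push_cast; ring

end IsMajorizedOn

/-- The `m`-th derivative is the sum of the `m`-th coefficient over the `m!` permutations of its
arguments. -/
theorem HasFPowerSeriesOnBall.norm_iteratedFDeriv_le [CompleteSpace F] {f : G → F}
    {p : FormalMultilinearSeries ℝ G F} {x : G} {r : ENNReal} (h : HasFPowerSeriesOnBall f p x r)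
    (m : ℕ) : ‖iteratedFDeriv ℝ m f x‖ ≤ m ! * ‖p m‖ := by
  refine ContinuousMultilinearMap.opNorm_le_bound (by positivity) fun v => ?_
  rw [h.iteratedFDeriv_eq_sum_of_completeSpace]
  calc _ ≤ ∑ σ : Equiv.Perm (Fin m), ‖p m‖ * ∏ i, ‖v i‖ := by
        refine norm_sum_le_of_le _ fun σ _ => ?_
        refine ((p m).le_opNorm _).trans (le_of_eq ?_)
        rw [Equiv.prod_comp σ fun i => ‖v i‖]
    _ = _ := by
        rw [Finset.sum_const, Finset.card_univ, Fintype.card_perm, Fintype.card_fin, nsmul_eq_mul]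
        ring

/-- The series of all coefficients of all re-expansions is summable when `2r` is below the radius of
convergence. Its total bounds every term, which makes `C` uniform in both the new centre and the
order. -/
theorem FormalMultilinearSeries.exists_norm_changeOrigin_le [CompleteSpace F]
    (p : FormalMultilinearSeries ℝ G F) {r : NNReal} (hr : (r + r : ENNReal) < p.radius) :
    ∃ C : ℝ, ∀ y : G, ‖y‖₊ ≤ r → ∀ m, ‖p.changeOrigin y m‖ * r ^ m ≤ C := by
  have hsum := p.changeOriginSeries_summable_aux₁ hr
  refine ⟨((∑' s : Σ k l : ℕ, { s : Finset (Fin (k + l)) // s.card = l },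
    ‖p (s.1 + s.2.1)‖₊ * r ^ s.2.1 * r ^ s.1 : NNReal) : ℝ), fun y hy m => ?_⟩
  have hyr : (‖y‖₊ : ENNReal) < p.radius := by
    refine lt_of_le_of_lt ?_ hr
    exact (ENNReal.coe_le_coe.2 hy).trans le_self_add
  have h1 := p.nnnorm_changeOrigin_le m hyr
  have hf := (NNReal.summable_sigma.1 hsum).1 m
  have h2 : (∑' s : Σ l : ℕ, { s : Finset (Fin (m + l)) // s.card = l },
      ‖p (m + s.1)‖₊ * ‖y‖₊ ^ s.1) * r ^ m
      ≤ ∑' s : Σ l : ℕ, { s : Finset (Fin (m + l)) // s.card = l },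
        ‖p (m + s.1)‖₊ * r ^ s.1 * r ^ m := by
    rw [← NNReal.tsum_mul_right]
    refine Summable.tsum_le_tsum (fun s => by gcongr) ?_ hf
    exact NNReal.summable_of_le (fun s => by gcongr) hf
  have h3 : ∑' s : Σ l : ℕ, { s : Finset (Fin (m + l)) // s.card = l },
        ‖p (m + s.1)‖₊ * r ^ s.1 * r ^ m ≤
      ∑' s : Σ k l : ℕ, { s : Finset (Fin (k + l)) // s.card = l },
        ‖p (s.1 + s.2.1)‖₊ * r ^ s.2.1 * r ^ s.1 := by
    rw [hsum.tsum_sigma' (NNReal.summable_sigma.1 hsum).1]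
    exact (NNReal.summable_sigma.1 hsum).2.le_tsum m (fun _ _ => zero_le)
  have h4 : ‖p.changeOrigin y m‖₊ * r ^ m ≤ _ := le_trans (by gcongr) (h2.trans h3)
  exact_mod_cast h4

theorem AnalyticAt.exists_isMajorizedOn [CompleteSpace F] {f : G → F} {x : G}
    (hf : AnalyticAt ℝ f x) :
    ∃ r > 0, ∃ R > 0, ∃ K > 0,
      IsMajorizedOn (Metric.ball x r) f (PowerSeries.C K * geomPowerSeries R) := by
  obtain ⟨p, ρ, hp⟩ := hf
  obtain ⟨r, hr0, hr⟩ : ∃ r : NNReal, 0 < r ∧ (r + r : ENNReal) < ρ := by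
    obtain ⟨s, hs0, hs⟩ := ENNReal.lt_iff_exists_nnreal_btwn.1 hp.r_pos
    refine ⟨s / 2, by simpa using hs0, ?_⟩
    rw [← ENNReal.coe_add, add_halves]; exact hs
  obtain ⟨C, hC⟩ := p.exists_norm_changeOrigin_le (hr.trans_le hp.r_le)
  have hr0' : (0 : ℝ) < r := hr0
  refine ⟨r, hr0', (r : ℝ)⁻¹, by positivity, max C 1, by positivity, ?_, ?_⟩
  · refine hp.analyticOnNhd.mono fun y hy => ?_
    rw [Metric.mem_eball, edist_nndist]
    refine lt_trans ?_ (lt_of_le_of_lt le_self_add hr)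
    rw [Metric.mem_ball, dist_nndist] at hy
    exact_mod_cast hy
  · intro y hy m
    have hyr : ‖y - x‖₊ < r := by
      rw [mem_ball_iff_norm] at hy; exact_mod_cast hy
    have h1 : (‖y - x‖₊ : ENNReal) < ρ :=
      lt_trans (ENNReal.coe_lt_coe.2 hyr) (lt_of_le_of_lt le_self_add hr)
    have h2 := (hp.changeOrigin h1).norm_iteratedFDeriv_le m
    rw [add_sub_cancel] at h2
    refine h2.trans ?_
    rw [PowerSeries.coeff_C_mul, coeff_geomPowerSeries]
    gcongr
    rw [inv_pow, ← div_eq_mul_inv, le_div_iff₀ (by positivity)]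
    exact (hC _ hyr.le m).trans (le_max_left _ _)

/-- A function whose derivatives on a ball are bounded by `m! C R ^ m` is the sum of its Taylor
series. -/
theorem AnalyticOnNhd.hasFPowerSeriesOnBall_of_bound [CompleteSpace F] {f : G → F} {x : G} {r : ℝ}
    (hr : 0 < r) (hf : AnalyticOnNhd ℝ f (Metric.ball x r)) {C R : ℝ} (hR : 0 < R)
    (hrR : r ≤ R⁻¹) (hb : ∀ m, ‖iteratedFDeriv ℝ m f x‖ ≤ m ! * (C * R ^ m)) :
    HasFPowerSeriesOnBall f (fun m => (m ! : ℝ)⁻¹ • iteratedFDeriv ℝ m f x) x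
      (ENNReal.ofReal r) := by
  set q : FormalMultilinearSeries ℝ G F := fun m => (m ! : ℝ)⁻¹ • iteratedFDeriv ℝ m f x with hq
  have hqm : ∀ m, ‖q m‖ ≤ C * R ^ m := fun m => by
    have hm : (0 : ℝ) < m ! := by positivity
    rw [hq, norm_smul, norm_inv, Real.norm_of_nonneg hm.le, inv_mul_le_iff₀ hm]
    exact hb m
  have hrad : ENNReal.ofReal r ≤ q.radius := by
    have h1 := q.le_radius_of_bound C (r := r.toNNReal) fun m => by
      rw [Real.coe_toNNReal _ hr.le]
      calc ‖q m‖ * r ^ m ≤ C * R ^ m * r ^ m := by gcongr; exact hqm m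
        _ = C * (R * r) ^ m := by rw [mul_pow]; ring
        _ ≤ C * 1 := by
            have hC : 0 ≤ C := by simpa using (norm_nonneg _).trans (hqm 0)
            gcongr
            refine pow_le_one₀ (by positivity) ?_
            calc R * r ≤ R * R⁻¹ := by gcongr
              _ = 1 := mul_inv_cancel₀ hR.ne'
        _ = C := mul_one C
    exact h1
  have hr' : 0 < ENNReal.ofReal r := ENNReal.ofReal_pos.2 hr
  have hqs : HasFPowerSeriesOnBall (fun y => q.sum (y - x)) q x (ENNReal.ofReal r) := by
    have := ((q.hasFPowerSeriesOnBall (hr'.trans_le hrad)).mono hr' hrad).comp_sub x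
    simpa using this
  have hball : Metric.eball x (ENNReal.ofReal r) = Metric.ball x r := Metric.eball_ofReal
  have hev : (fun y => q.sum (y - x)) =ᶠ[nhds x] f := by
    obtain ⟨p, ρ, hp⟩ := hf x (Metric.mem_ball_self hr)
    have hmem : ∀ᶠ y in nhds x, y ∈ Metric.eball x ρ ∧ y ∈ Metric.eball x (ENNReal.ofReal r) :=
      Filter.Eventually.and (Metric.eball_mem_nhds x hp.r_pos) (Metric.eball_mem_nhds x hr')
    filter_upwards [hmem] with y hy
    have h1 := hp.hasSum_iteratedFDeriv (y := y - x) (by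
      simpa [Metric.mem_eball, edist_eq_enorm_sub] using hy.1)
    have h2 := hqs.hasSum_sub hy.2
    rw [add_sub_cancel] at h1
    exact h2.unique h1
  -- The Taylor series is known to represent `f` only near `x`; the identity theorem extends this to
  -- the whole ball.
  have heq : EqOn (fun y => q.sum (y - x)) f (Metric.ball x r) :=
    AnalyticOnNhd.eqOn_of_preconnected_of_eventuallyEq (hball ▸ hqs.analyticOnNhd) hf
      (convex_ball x r).isPreconnected (Metric.mem_ball_self hr) hev
  exact hqs.congr (hball ▸ heq)

end Majorants

/-! ### Majorants for the iterates of a first order operator. -/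

section CauchyKovalevskaya

open scoped Nat PowerSeries

variable {G : Type*} [NormedAddCommGroup G] [NormedSpace ℝ G]
  {F : Type*} [NormedAddCommGroup F] [NormedSpace ℝ F]

namespace IsMajorizedOn

variable {S : Set G} {f : G → F} {a : ℝ⟦X⟧}

theorem const (c : F) : IsMajorizedOn S (fun _ => c) (PowerSeries.C ‖c‖) := by
  refine ⟨fun _ _ => analyticAt_const, fun x _ m => ?_⟩
  rcases m with _ | m
  · simp
  · rw [iteratedFDeriv_const_of_ne (Nat.succ_ne_zero m)]
    simp

theorem clm (L : G →L[ℝ] F) {c d : ℝ} (hc : ∀ x ∈ S, ‖L x‖ ≤ c) (hd : ‖L‖ ≤ d) :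
    IsMajorizedOn S L (PowerSeries.C c + PowerSeries.C d * PowerSeries.X) := by
  refine ⟨fun x _ => L.analyticAt x, fun x hx m => ?_⟩
  rcases m with _ | m
  · simpa using hc x hx
  · rw [← norm_iteratedFDeriv_fderiv]
    have : _root_.fderiv ℝ L = fun _ => L := by ext1 y; exact L.fderiv
    rw [this]
    rcases m with _ | m
    · simpa using hd
    · rw [iteratedFDeriv_const_of_ne (Nat.succ_ne_zero m)]
      simp

theorem const_smul [CompleteSpace F] (c : ℝ) (hf : IsMajorizedOn S f a) :
    IsMajorizedOn S (fun x => c • f x) (PowerSeries.C |c| * a) := by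
  refine ⟨fun x hx => (hf.1 x hx).const_smul, fun x hx m => ?_⟩
  have h1 : iteratedFDeriv ℝ m (fun x => c • f x) x = c • iteratedFDeriv ℝ m f x :=
    iteratedFDeriv_const_smul_apply (hf.1 x hx).contDiffAt
  rw [h1, norm_smul, PowerSeries.coeff_C_mul, Real.norm_eq_abs]
  calc _ ≤ |c| * (m ! * PowerSeries.coeff m a) := by gcongr; exact hf.2 x hx m
    _ = _ := by ring

theorem pow (hS : IsOpen S) {f : G → ℝ} (hf : IsMajorizedOn S f a) (k : ℕ) :
    IsMajorizedOn S (fun x => f x ^ k) (a ^ k) := by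
  induction k with
  | zero =>
    simp only [pow_zero]
    simpa using const (S := S) (G := G) (1 : ℝ)
  | succ k ih =>
    simp only [pow_succ]
    exact bilinear hS (ContinuousLinearMap.mul ℝ ℝ) (ContinuousLinearMap.opNorm_mul_le ℝ ℝ) ih hf

theorem clm_apply {F₁ F₂ : Type*} [NormedAddCommGroup F₁] [NormedSpace ℝ F₁]
    [NormedAddCommGroup F₂] [NormedSpace ℝ F₂] [CompleteSpace F₂] (hS : IsOpen S)
    {f : G → F₁ →L[ℝ] F₂} {g : G → F₁} {b : ℝ⟦X⟧} (hf : IsMajorizedOn S f a)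
    (hg : IsMajorizedOn S g b) : IsMajorizedOn S (fun x => f x (g x)) (a * b) := by
  simpa only [ContinuousLinearMap.coe_id', id_eq] using
    bilinear hS (ContinuousLinearMap.id ℝ (F₁ →L[ℝ] F₂)) ContinuousLinearMap.norm_id_le hf hg

end IsMajorizedOn

variable [CompleteSpace F]

/-- The first order differential operator `f ↦ P(Df) + B f`. -/
def firstOrderOp (P : G → (G →L[ℝ] F) →L[ℝ] F) (B : G → F →L[ℝ] F) (f : G → F) : G → F :=
  fun y => P y (fderiv ℝ f y) + B y (f y)

variable {P : G → (G →L[ℝ] F) →L[ℝ] F} {B : G → F →L[ℝ] F} {S : Set G} {K R : ℝ}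

/-- The derivative and the multiplication by a coefficient each cost one power of the geometric
series. The zeroth order term costs only one power and, as `R ≥ 1`, is absorbed by turning `a` into
`a + 1`. -/
theorem coeff_firstOrderOp_majorant_le {K R c : ℝ} (hK : 0 ≤ K) (hR : 1 ≤ R) (hc : 0 ≤ c)
    (a m : ℕ) :
    PowerSeries.coeff m (PowerSeries.C K * geomPowerSeries R *
        PowerSeries.derivative ℝ (PowerSeries.C c * geomPowerSeries R ^ a)
      + PowerSeries.C K * geomPowerSeries R * (PowerSeries.C c * geomPowerSeries R ^ a))
      ≤ PowerSeries.coeff m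
        (PowerSeries.C (c * (K * R * (a + 1))) * geomPowerSeries R ^ (a + 2)) := by
  have hR0 : 0 ≤ R := zero_le_one.trans hR
  have e1 : PowerSeries.derivative ℝ (PowerSeries.C c * geomPowerSeries R ^ a)
      = PowerSeries.C c * (PowerSeries.C (a * R) * geomPowerSeries R ^ (a + 1)) := by
    rw [Derivation.leibniz, derivative_geomPowerSeries_pow, PowerSeries.derivative_C,
      smul_zero, add_zero, smul_eq_mul]
  have e2 : PowerSeries.C K * geomPowerSeries R * (PowerSeries.C c *
      (PowerSeries.C (a * R) * geomPowerSeries R ^ (a + 1)))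
      = PowerSeries.C (K * c * (a * R)) * geomPowerSeries R ^ (a + 2) := by
    rw [map_mul PowerSeries.C (K * c), map_mul PowerSeries.C K]; ring
  have e3 : PowerSeries.C K * geomPowerSeries R * (PowerSeries.C c * geomPowerSeries R ^ a)
      = PowerSeries.C (K * c) * geomPowerSeries R ^ (a + 1) := by
    rw [map_mul]; ring
  rw [e1, e2, e3, map_add, PowerSeries.coeff_C_mul, PowerSeries.coeff_C_mul,
    PowerSeries.coeff_C_mul]
  have h3 := coeff_geomPowerSeries_pow_le_succ hR0 (a + 1) m
  have h4 := coeff_geomPowerSeries_pow_nonneg hR0 (a + 2) m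
  calc _ ≤ K * c * (a * R) * PowerSeries.coeff m (geomPowerSeries R ^ (a + 2))
        + K * c * R * PowerSeries.coeff m (geomPowerSeries R ^ (a + 2)) := by
        refine add_le_add le_rfl (mul_le_mul ?_ h3 (coeff_geomPowerSeries_pow_nonneg hR0 _ _) ?_)
        · exact le_mul_of_one_le_right (by positivity) hR
        · positivity
    _ = _ := by ring

theorem isMajorizedOn_firstOrderOp (hS : IsOpen S) (hK : 0 ≤ K) (hR : 1 ≤ R)
    (hP : IsMajorizedOn S P (PowerSeries.C K * geomPowerSeries R))
    (hB : IsMajorizedOn S B (PowerSeries.C K * geomPowerSeries R)) {f : G → F} {c : ℝ}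
    (hc : 0 ≤ c) {a : ℕ} (hf : IsMajorizedOn S f (PowerSeries.C c * geomPowerSeries R ^ a)) :
    IsMajorizedOn S (firstOrderOp P B f)
      (PowerSeries.C (c * (K * R * (a + 1))) * geomPowerSeries R ^ (a + 2)) := by
  have h1 := hP.clm_apply hS hf.fderiv
  have h2 := hB.clm_apply hS hf
  exact (h1.add h2).mono fun m => coeff_firstOrderOp_majorant_le hK hR hc a m

/-- At exponent `2k + 1` one more application contributes the factor `K R (2k + 2)`; the product of
these factors produces exactly one factorial, which the exponential series cancels. -/
theorem isMajorizedOn_iterate_firstOrderOp (hS : IsOpen S) (hK : 0 ≤ K) (hR : 1 ≤ R)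
    (hP : IsMajorizedOn S P (PowerSeries.C K * geomPowerSeries R))
    (hB : IsMajorizedOn S B (PowerSeries.C K * geomPowerSeries R)) {f : G → F} {c : ℝ}
    (hc : 0 ≤ c) (hf : IsMajorizedOn S f (PowerSeries.C c * geomPowerSeries R)) (k : ℕ) :
    IsMajorizedOn S ((firstOrderOp P B)^[k] f)
      (PowerSeries.C (c * (2 * K * R) ^ k * k !) * geomPowerSeries R ^ (2 * k + 1)) := by
  induction k with
  | zero => simpa using hf
  | succ k ih =>
    rw [Function.iterate_succ_apply']
    have hR0 : 0 ≤ R := zero_le_one.trans hR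
    convert isMajorizedOn_firstOrderOp hS hK hR hP hB (c := c * (2 * K * R) ^ k * k !)
      (by positivity) ih using 3
    · rw [Nat.factorial_succ]; push_cast; ring
    · ring

/-- The double series over `(k, m)` is dominated by `u k * (r R)^m`, so the order of summation can
be exchanged. This is how analyticity passes to the sum of the exponential series. -/
theorem hasFPowerSeriesOnBall_tsum {f : ℕ → G → F} {p : ℕ → FormalMultilinearSeries ℝ G F} {x : G}
    {r R : ℝ} {u : ℕ → ℝ} (hr : 0 < r) (hrR : r * R < 1) (hR : 0 ≤ R)
    (hf : ∀ k, HasFPowerSeriesOnBall (f k) (p k) x (ENNReal.ofReal r))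
    (hu : Summable u) (hp : ∀ k m, ‖p k m‖ ≤ u k * R ^ m) :
    HasFPowerSeriesOnBall (fun y => ∑' k, f k y) (fun m => ∑' k, p k m) x (ENNReal.ofReal r) := by
  have hu0 : ∀ k, 0 ≤ u k := fun k => by simpa using (norm_nonneg _).trans (hp k 0)
  have hs : ∀ m, Summable fun k => p k m := fun m =>
    Summable.of_norm_bounded (hu.mul_right (R ^ m)) fun k => hp k m
  refine ⟨?_, ENNReal.ofReal_pos.2 hr, fun {y} hy => ?_⟩
  · refine FormalMultilinearSeries.le_radius_of_bound (r := r.toNNReal) _ (∑' k, u k) fun m => ?_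
    rw [Real.coe_toNNReal _ hr.le]
    calc _ ≤ (∑' k, u k) * R ^ m * r ^ m := by
          gcongr
          rw [← tsum_mul_right]
          exact tsum_of_norm_bounded (hu.mul_right (R ^ m)).hasSum fun k => hp k m
      _ = (∑' k, u k) * (r * R) ^ m := by rw [mul_pow]; ring
      _ ≤ (∑' k, u k) * 1 := by
          gcongr
          · exact tsum_nonneg hu0
          · exact pow_le_one₀ (by positivity) hrR.le
      _ = _ := mul_one _
  · have hy' : ‖y‖ < r := by
      rwa [Metric.eball_ofReal, mem_ball_zero_iff] at hy
    have hterm : ∀ k m, ‖p k m fun _ => y‖ ≤ u k * (r * R) ^ m := fun k m => by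
      calc _ ≤ ‖p k m‖ * ‖y‖ ^ m := by
            simpa using (p k m).le_opNorm fun _ => y
        _ ≤ u k * R ^ m * r ^ m := by
            gcongr
            · exact mul_nonneg (hu0 k) (by positivity)
            · exact hp k m
        _ = _ := by rw [mul_pow]; ring
    have hsum : Summable fun z : ℕ × ℕ => p z.1 z.2 fun _ => y := by
      refine Summable.of_norm_bounded (g := fun z : ℕ × ℕ => u z.1 * (r * R) ^ z.2) ?_
        fun z => hterm _ _
      exact hu.mul_of_nonneg (summable_geometric_of_lt_one (by positivity) hrR) hu0
        (fun m => by positivity)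
    have h1 : HasSum (fun z : ℕ × ℕ => p z.1 z.2 fun _ => y) (∑' k, f k (x + y)) := by
      have h2 := hsum.hasSum.prod_fiberwise fun k => (hf k).hasSum hy
      rw [h2.tsum_eq]
      exact hsum.hasSum
    have h3 := (Equiv.prodComm ℕ ℕ).hasSum_iff.2 h1
    refine h3.prod_fiberwise fun m => ?_
    have h4 := (hs m).hasSum
    exact (ContinuousMultilinearMap.apply ℝ (fun _ : Fin m => G) F fun _ => y).hasSum h4

end CauchyKovalevskaya

/-! ### The exponential series and the autonomous Cauchy–Kovalevskaya theorem. -/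

section CauchyKovalevskayaSeries

open scoped Nat PowerSeries

variable {G : Type*} [NormedAddCommGroup G] [NormedSpace ℝ G]
  {F : Type*} [NormedAddCommGroup F] [NormedSpace ℝ F]
  {P : G → (G →L[ℝ] F) →L[ℝ] F} {B : G → F →L[ℝ] F} {S : Set G} {K R : ℝ}

theorem coeff_geomPowerSeries_pow_mul_pow_le {R R' : ℝ} (hR : 0 ≤ R) (hRR' : R ≤ R') (a b m : ℕ) :
    PowerSeries.coeff m (geomPowerSeries R' ^ a * geomPowerSeries R ^ b)
      ≤ 2 ^ (a + b) * (4 * R') ^ m := by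
  have hR' : 0 ≤ R' := hR.trans hRR'
  rw [PowerSeries.coeff_mul, Finset.Nat.sum_antidiagonal_eq_sum_range_succ_mk]
  calc _ ≤ ∑ i ∈ Finset.range m.succ, (2 : ℝ) ^ (a + b) * (2 * R') ^ m := by
        refine Finset.sum_le_sum fun i hi => ?_
        have hi' : i + (m - i) = m := by have := Finset.mem_range.1 hi; omega
        calc _ ≤ 2 ^ a * (2 * R') ^ i * (2 ^ b * (2 * R') ^ (m - i)) := by
              refine mul_le_mul (coeff_geomPowerSeries_pow_le hR' _ _)
                ((coeff_geomPowerSeries_pow_le hR _ _).trans (by gcongr))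
                (coeff_geomPowerSeries_pow_nonneg hR _ _) (by positivity)
          _ = 2 ^ (a + b) * (2 * R') ^ (i + (m - i)) := by rw [pow_add, pow_add]; ring
          _ = _ := by rw [hi']
    _ = ((m + 1 : ℕ) : ℝ) * (2 ^ (a + b) * (2 * R') ^ m) := by simp
    _ ≤ (2 ^ m : ℕ) * (2 ^ (a + b) * (2 * R') ^ m) := by
        gcongr
        exact Nat.lt_two_pow_self
    _ = _ := by
        push_cast
        rw [show 4 * R' = 2 * (2 * R') by ring, mul_pow 2 (2 * R')]
        ring

/-- The `k`-th term of the exponential series of a first order operator. -/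
def expTerm (P : G → (G →L[ℝ] F) →L[ℝ] F) (B : G → F →L[ℝ] F) (f : G → F) (k : ℕ) (z : ℝ × G) : F :=
  z.1 ^ k • ((k ! : ℝ)⁻¹ • ((firstOrderOp P B)^[k] f) z.2)

/-- On `|t| < δ` the function `t` is majorized by `δ / (1 - X/δ)`. The `3k + 1` geometric factors of
the `k`-th term contribute `2^(3k+1) = 2 * 8^k`, whence the constant `16 = 8 * 2`. -/
theorem isMajorizedOn_expTerm [CompleteSpace F] (hS : IsOpen S) (hK : 0 ≤ K) (hR : 1 ≤ R)
    (hP : IsMajorizedOn S P (PowerSeries.C K * geomPowerSeries R))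
    (hB : IsMajorizedOn S B (PowerSeries.C K * geomPowerSeries R)) {f : G → F} {c : ℝ}
    (hc : 0 ≤ c) (hf : IsMajorizedOn S f (PowerSeries.C c * geomPowerSeries R)) {δ : ℝ}
    (hδ : 0 < δ) (hδR : R ≤ δ⁻¹) (k : ℕ) :
    IsMajorizedOn (Ioo (-δ) δ ×ˢ S) (expTerm P B f k)
      (PowerSeries.C (2 * c * (16 * K * R * δ) ^ k) * geomPowerSeries (4 * δ⁻¹)) := by
  have hR0 : 0 ≤ R := zero_le_one.trans hR
  have hopen : IsOpen (Ioo (-δ) δ ×ˢ S) := isOpen_Ioo.prod hS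
  have h1 : IsMajorizedOn (Ioo (-δ) δ ×ˢ S) (fun z : ℝ × G => z.1)
      (PowerSeries.C δ * geomPowerSeries δ⁻¹) := by
    refine (IsMajorizedOn.clm (ContinuousLinearMap.fst ℝ ℝ G) (c := δ) (d := 1) ?_
      (ContinuousLinearMap.norm_fst_le ..)).mono fun m => ?_
    · intro z hz
      rw [ContinuousLinearMap.coe_fst', Real.norm_eq_abs, abs_le]
      exact ⟨hz.1.1.le, hz.1.2.le⟩
    · rw [PowerSeries.coeff_C_mul, coeff_geomPowerSeries, map_add, PowerSeries.coeff_C_mul]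
      rcases m with _ | _ | m
      · simp
      · simp [hδ.ne']
      · simp only [PowerSeries.coeff_C, PowerSeries.coeff_X]
        simp
        positivity
  have h2 := h1.pow hopen k
  have h3 := ((isMajorizedOn_iterate_firstOrderOp hS hK hR hP hB hc hf k).const_smul
    ((k ! : ℝ)⁻¹)).comp_clm hS (ContinuousLinearMap.snd ℝ ℝ G)
    (ContinuousLinearMap.norm_snd_le ..)
  have h4 := h3.mono_set (S' := Ioo (-δ) δ ×ˢ S) fun z hz => hz.2
  have h5 := IsMajorizedOn.bilinear hopen (ContinuousLinearMap.lsmul ℝ ℝ)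
    ContinuousLinearMap.opNorm_lsmul_le h2 h4
  refine IsMajorizedOn.mono h5 fun m => ?_
  have hk : (0 : ℝ) < k ! := by positivity
  have e1 : (PowerSeries.C δ * geomPowerSeries δ⁻¹) ^ k * (PowerSeries.C |(k ! : ℝ)⁻¹| *
      (PowerSeries.C (c * (2 * K * R) ^ k * k !) * geomPowerSeries R ^ (2 * k + 1)))
      = PowerSeries.C (c * (2 * K * R * δ) ^ k) *
        (geomPowerSeries δ⁻¹ ^ k * geomPowerSeries R ^ (2 * k + 1)) := by
    have e2 : c * (2 * K * R * δ) ^ k = δ ^ k * (|(k ! : ℝ)⁻¹| * (c * (2 * K * R) ^ k * k !)) := by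
      rw [abs_of_pos (by positivity), mul_pow _ δ]
      field_simp
    rw [e2, map_mul PowerSeries.C (δ ^ k), map_mul PowerSeries.C |(k ! : ℝ)⁻¹|, map_pow, mul_pow]
    ring
  rw [e1, PowerSeries.coeff_C_mul, PowerSeries.coeff_C_mul, coeff_geomPowerSeries]
  calc _ ≤ c * (2 * K * R * δ) ^ k * (2 ^ (k + (2 * k + 1)) * (4 * δ⁻¹) ^ m) := by
        gcongr
        exact coeff_geomPowerSeries_pow_mul_pow_le hR0 hδR _ _ _
    _ = _ := by
        have e3 : (2 : ℝ) ^ (k + (2 * k + 1)) = 2 * 8 ^ k := by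
          rw [show k + (2 * k + 1) = 3 * k + 1 by ring, pow_succ, pow_mul]; norm_num; ring
        rw [e3, show 16 * K * R * δ = 8 * (2 * K * R * δ) by ring, mul_pow 8]
        ring

theorem fderiv_expTerm {f : G → F} {z : ℝ × G} {k : ℕ}
    (h : DifferentiableAt ℝ ((firstOrderOp P B)^[k] f) z.2) :
    fderiv ℝ (expTerm P B f k) z (1, 0)
        = (k * z.1 ^ (k - 1) : ℝ) • ((k ! : ℝ)⁻¹ • ((firstOrderOp P B)^[k] f) z.2) ∧
      (fderiv ℝ (expTerm P B f k) z).comp (ContinuousLinearMap.inr ℝ ℝ G)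
        = z.1 ^ k • ((k ! : ℝ)⁻¹ • fderiv ℝ ((firstOrderOp P B)^[k] f) z.2) := by
  have h1 : HasFDerivAt (fun z : ℝ × G => z.1 ^ k) _ z :=
    (ContinuousLinearMap.fst ℝ ℝ G).hasFDerivAt.pow k
  have h2 : HasFDerivAt (fun z : ℝ × G => (k ! : ℝ)⁻¹ • ((firstOrderOp P B)^[k] f) z.2) _ z :=
    (h.hasFDerivAt.comp z hasFDerivAt_snd).const_smul _
  have h3 : HasFDerivAt (expTerm P B f k) _ z := h1.smul h2
  rw [h3.fderiv]
  constructor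
  · simp
  · ext v
    simp

/-- The Cauchy–Kovalevskaya theorem for the linear autonomous equation `∂w/∂τ = P(D w) + B w`,
with a time of existence that depends only on the bounds of the coefficients. -/
theorem exists_hasFDerivAt_firstOrderOp [CompleteSpace F] (hS : IsOpen S) (hK : 0 < K) (hR : 1 ≤ R)
    (hP : IsMajorizedOn S P (PowerSeries.C K * geomPowerSeries R))
    (hB : IsMajorizedOn S B (PowerSeries.C K * geomPowerSeries R)) :
    ∃ δ > 0, ∀ (f : G → F) (c : ℝ), 0 ≤ c →
      IsMajorizedOn S f (PowerSeries.C c * geomPowerSeries R) →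
      ∃ w : ℝ × G → F, AnalyticOnNhd ℝ w (Ioo (-δ) δ ×ˢ S) ∧ (∀ y ∈ S, w (0, y) = f y) ∧
        ∀ z ∈ Ioo (-δ) δ ×ˢ S, fderiv ℝ w z (1, 0)
          = P z.2 ((fderiv ℝ w z).comp (ContinuousLinearMap.inr ℝ ℝ G)) + B z.2 (w z) := by
  have hR0 : 0 < R := zero_lt_one.trans_le hR
  -- The first bound makes `1/δ` dominate `R`; the second makes the ratio `16KRδ` of the majorizing
  -- series at most `1/2`. Neither involves the data `f` or the constant `c`.
  set δ : ℝ := min R⁻¹ (32 * K * R)⁻¹ with hδdef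
  have hδ : 0 < δ := by positivity
  have hδR : R ≤ δ⁻¹ := by
    rw [le_inv_comm₀ hR0 hδ]; exact min_le_left _ _
  have hδK : 16 * K * R * δ ≤ 1 / 2 := by
    calc 16 * K * R * δ ≤ 16 * K * R * (32 * K * R)⁻¹ := by gcongr; exact min_le_right _ _
      _ = 1 / 2 := by field_simp; norm_num
  refine ⟨δ, hδ, fun f c hc hf => ?_⟩
  have hopen : IsOpen (Ioo (-δ) δ ×ˢ S) := isOpen_Ioo.prod hS
  have hmaj := isMajorizedOn_expTerm hS hK.le hR hP hB hc hf hδ hδR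
  set u : ℕ → ℝ := fun k => 2 * c * (16 * K * R * δ) ^ k with hu
  have husum : Summable u :=
    (summable_geometric_of_lt_one (by positivity) (by linarith)).mul_left _
  have hball : ∀ z ∈ Ioo (-δ) δ ×ˢ S, ∃ r > 0, Metric.ball z r ⊆ Ioo (-δ) δ ×ˢ S ∧
      r * (4 * δ⁻¹) < 1 := by
    intro z hz
    obtain ⟨ε, hε, hεs⟩ := Metric.isOpen_iff.1 hopen z hz
    refine ⟨min ε (δ / 8), by positivity, (Metric.ball_subset_ball (min_le_left _ _)).trans hεs, ?_⟩
    calc min ε (δ / 8) * (4 * δ⁻¹) ≤ (δ / 8) * (4 * δ⁻¹) := by gcongr; exact min_le_right _ _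
      _ < 1 := by field_simp; norm_num
  have hder : ∀ z ∈ Ioo (-δ) δ ×ˢ S, ∀ k, ‖fderiv ℝ (expTerm P B f k) z‖ ≤ u k * (4 * δ⁻¹) := by
    intro z hz k
    have := (hmaj k).2 z hz 1
    rw [PowerSeries.coeff_C_mul, coeff_geomPowerSeries, norm_iteratedFDeriv_one] at this
    simpa using this
  have hval : ∀ z ∈ Ioo (-δ) δ ×ˢ S, ∀ k, ‖expTerm P B f k z‖ ≤ u k := by
    intro z hz k
    have := (hmaj k).2 z hz 0
    rw [PowerSeries.coeff_C_mul, coeff_geomPowerSeries, norm_iteratedFDeriv_zero] at this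
    simpa using this
  have hwd : ∀ z ∈ Ioo (-δ) δ ×ˢ S, HasFDerivAt (fun z => ∑' k, expTerm P B f k z)
      (∑' k, fderiv ℝ (expTerm P B f k) z) z := by
    intro z hz
    obtain ⟨r, hr, hrS, -⟩ := hball z hz
    exact hasFDerivAt_tsum_of_isPreconnected (husum.mul_right (4 * δ⁻¹)) Metric.isOpen_ball
      (convex_ball z r).isPreconnected
      (fun k x hx => ((hmaj k).1 x (hrS hx)).differentiableAt.hasFDerivAt)
      (fun k x hx => hder x (hrS hx) k) (Metric.mem_ball_self hr)
      (Summable.of_norm_bounded husum (hval z hz)) (Metric.mem_ball_self hr)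
  refine ⟨fun z => ∑' k, expTerm P B f k z, ?_, ?_, ?_⟩
  · intro z hz
    obtain ⟨r, hr, hrS, hrδ⟩ := hball z hz
    refine (hasFPowerSeriesOnBall_tsum (p := fun k m => (m ! : ℝ)⁻¹ •
      iteratedFDeriv ℝ m (expTerm P B f k) z) hr hrδ (by positivity) (fun k => ?_) husum
      (fun k m => ?_)).analyticAt
    · refine AnalyticOnNhd.hasFPowerSeriesOnBall_of_bound (C := u k) (R := 4 * δ⁻¹) hr
        ((hmaj k).1.mono hrS) (by positivity) ?_ fun m => ?_
      · rw [le_inv_comm₀ hr (by positivity), inv_eq_one_div r, le_div_iff₀ hr]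
        linarith
      · simpa only [PowerSeries.coeff_C_mul, coeff_geomPowerSeries] using (hmaj k).2 z hz m
    · have hm : (0 : ℝ) < m ! := by positivity
      rw [norm_smul, norm_inv, Real.norm_of_nonneg hm.le, inv_mul_le_iff₀ hm]
      simpa only [PowerSeries.coeff_C_mul, coeff_geomPowerSeries] using (hmaj k).2 z hz m
  · intro y _
    change ∑' k, expTerm P B f k (0, y) = f y
    rw [tsum_eq_single 0 fun k hk => by simp [expTerm, hk]]
    simp [expTerm]
  · intro z hz
    have hdiff : ∀ k, DifferentiableAt ℝ ((firstOrderOp P B)^[k] f) z.2 := fun k =>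
      ((isMajorizedOn_iterate_firstOrderOp hS hK.le hR hP hB hc hf k).1 z.2 hz.2).differentiableAt
    have hs1 : Summable fun k => fderiv ℝ (expTerm P B f k) z :=
      Summable.of_norm_bounded (husum.mul_right _) (hder z hz)
    have hs0 : Summable fun k => expTerm P B f k z := Summable.of_norm_bounded husum (hval z hz)
    rw [(hwd z hz).fderiv]
    have hL : HasSum (fun k => fderiv ℝ (expTerm P B f k) z (1, 0))
        ((∑' k, fderiv ℝ (expTerm P B f k) z) (1, 0)) :=
      (ContinuousLinearMap.apply ℝ F ((1, 0) : ℝ × G)).hasSum hs1.hasSum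
    have hM : HasSum (fun k => P z.2 ((fderiv ℝ (expTerm P B f k) z).comp
          (ContinuousLinearMap.inr ℝ ℝ G)) + B z.2 (expTerm P B f k z))
        (P z.2 ((∑' k, fderiv ℝ (expTerm P B f k) z).comp (ContinuousLinearMap.inr ℝ ℝ G))
          + B z.2 (∑' k, expTerm P B f k z)) := by
      refine HasSum.add ?_ ((B z.2).hasSum hs0.hasSum)
      exact ((P z.2).comp (ContinuousLinearMap.precomp F
        (ContinuousLinearMap.inr ℝ ℝ G))).hasSum hs1.hasSum
    refine hL.unique ?_
    -- The time derivative of the term of index `k + 1` is the operator applied to the term of index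
    -- `k`, and the term of index `0` does not depend on time.
    rw [← hasSum_nat_add_iff' 1]
    convert hM using 1
    · funext k
      rw [(fderiv_expTerm (hdiff _)).1, (fderiv_expTerm (hdiff _)).2,
        Function.iterate_succ_apply', expTerm, firstOrderOp]
      have hk : ((k + 1 : ℕ) * z.1 ^ (k + 1 - 1) : ℝ) * ((k + 1)! : ℝ)⁻¹
          = z.1 ^ k * (k ! : ℝ)⁻¹ := by
        rw [Nat.factorial_succ]
        push_cast
        field_simp
      rw [smul_smul, hk, map_smul, map_smul, map_smul, map_smul, ← smul_add, ← smul_add, smul_smul]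
    · rw [Finset.sum_range_one, (fderiv_expTerm (hdiff _)).1]
      simp

end CauchyKovalevskayaSeries

section AnalyticOperators

variable {H E F G : Type*} [NormedAddCommGroup H] [NormedSpace ℝ H]
  [NormedAddCommGroup E] [NormedSpace ℝ E] [NormedAddCommGroup F] [NormedSpace ℝ F]
  [NormedAddCommGroup G] [NormedSpace ℝ G]

theorem AnalyticAt.clm_comp {f : H → F →L[ℝ] G} {g : H → E →L[ℝ] F} {x : H}
    (hf : AnalyticAt ℝ f x) (hg : AnalyticAt ℝ g x) :
    AnalyticAt ℝ (fun y => (f y).comp (g y)) x :=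
  AnalyticAt.comp₂ (h := fun z : (F →L[ℝ] G) × (E →L[ℝ] F) => z.1.comp z.2)
    ((ContinuousLinearMap.compL ℝ E F G).analyticAt_bilinear _) hf hg

theorem AnalyticAt.clm_apply {f : H → F →L[ℝ] G} {g : H → F} {x : H}
    (hf : AnalyticAt ℝ f x) (hg : AnalyticAt ℝ g x) :
    AnalyticAt ℝ (fun y => f y (g y)) x :=
  AnalyticAt.comp₂ (h := fun z : (F →L[ℝ] G) × F => z.1 z.2)
    ((ContinuousLinearMap.id ℝ (F →L[ℝ] G)).analyticAt_bilinear _) hf hg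

end AnalyticOperators

/-! ### Cauchy–Kovalevskaya with time-dependent coefficients. -/

section EvolutionEquation

open scoped PowerSeries

variable {E : Type*} [NormedAddCommGroup E] [NormedSpace ℝ E]
  {F : Type*} [NormedAddCommGroup F] [NormedSpace ℝ F]

theorem IsMajorizedOn.mono_geom {S : Set E} {f : E → F} {K R K' R' : ℝ}
    (hf : IsMajorizedOn S f (PowerSeries.C K * geomPowerSeries R)) (hR : 0 ≤ R) (hK' : 0 ≤ K')
    (hKK' : K ≤ K') (hRR' : R ≤ R') :
    IsMajorizedOn S f (PowerSeries.C K' * geomPowerSeries R') :=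
  hf.mono fun m => by
    simp only [PowerSeries.coeff_C_mul, coeff_geomPowerSeries]
    gcongr

/-- The time derivative and the space derivatives of `w` satisfy `∂_t w = P(∂_x w) + B w` at `z`. -/
def SolvesEvolutionAt (P : ℝ × E → (E →L[ℝ] F) →L[ℝ] F) (B : ℝ × E → F →L[ℝ] F) (w : ℝ × E → F)
    (z : ℝ × E) : Prop :=
  fderiv ℝ w z (1, 0) = P z ((fderiv ℝ w z).comp (ContinuousLinearMap.inr ℝ ℝ E)) + B z (w z)

/-- The Cauchy–Kovalevskaya theorem for `∂_t u = P(∂_x u) + B u` with initial value prescribed at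
time `s`, on a domain that depends neither on `s` nor on the size of the initial value. -/
theorem exists_solvesEvolutionAt [CompleteSpace F] {P : ℝ × E → (E →L[ℝ] F) →L[ℝ] F}
    {B : ℝ × E → F →L[ℝ] F} {t₀ : ℝ} {x₀ : E} (hP : AnalyticAt ℝ P (t₀, x₀))
    (hB : AnalyticAt ℝ B (t₀, x₀)) :
    ∃ r₀ > 0, ∃ R₀ > 0, ∀ r > 0, r ≤ r₀ → ∀ R ≥ R₀, ∃ δ > 0, ∀ (f : E → F) (c : ℝ), 0 ≤ c →
      IsMajorizedOn (Metric.ball x₀ r) f (PowerSeries.C c * geomPowerSeries R) →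
      ∀ s ∈ Ioo (t₀ - δ) (t₀ + δ), ∃ u : ℝ × E → F,
        AnalyticOnNhd ℝ u (Ioo (t₀ - δ) (t₀ + δ) ×ˢ Metric.ball x₀ r) ∧
        (∀ x ∈ Metric.ball x₀ r, u (s, x) = f x) ∧
        ∀ z ∈ Ioo (t₀ - δ) (t₀ + δ) ×ˢ Metric.ball x₀ r, SolvesEvolutionAt P B u z := by
  -- Time becomes a space variable: if `∂_τ w = P(∂_x w) - ∂_t w + B w` on `ℝ × (ℝ × E)`, then `u(t,
  -- x) = w(t - s, (t, x))` satisfies `∂_t u = ∂_τ w + ∂_t w = P(∂_x u) + B u`, with its initial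
  -- value at time `s`.
  set P' : ℝ × E → ((ℝ × E) →L[ℝ] F) →L[ℝ] F := fun z =>
    (P z).comp (ContinuousLinearMap.precomp F (ContinuousLinearMap.inr ℝ ℝ E))
      - ContinuousLinearMap.apply ℝ F ((1, 0) : ℝ × E) with hP'def
  have hP' : AnalyticAt ℝ P' (t₀, x₀) := by
    refine AnalyticAt.sub ?_ analyticAt_const
    exact hP.clm_comp analyticAt_const
  obtain ⟨r₁, hr₁, R₁, hR₁, K₁, hK₁, hPm⟩ := hP'.exists_isMajorizedOn
  obtain ⟨r₂, hr₂, R₂, hR₂, K₂, hK₂, hBm⟩ := hB.exists_isMajorizedOn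
  refine ⟨min r₁ r₂, by positivity, max 1 (max R₁ R₂), by positivity, fun r hr hr0 R hR => ?_⟩
  have hR1 : 1 ≤ R := (le_max_left _ _).trans hR
  have hRR₁ : R₁ ≤ R := ((le_max_left _ _).trans (le_max_right _ _)).trans hR
  have hRR₂ : R₂ ≤ R := ((le_max_right _ _).trans (le_max_right _ _)).trans hR
  obtain ⟨δ, hδ, hsol⟩ := exists_hasFDerivAt_firstOrderOp (S := Metric.ball (t₀, x₀) r)
    (K := max K₁ K₂) Metric.isOpen_ball (by positivity) hR1
    ((hPm.mono_set (Metric.ball_subset_ball (hr0.trans (min_le_left _ _)))).mono_geom hR₁.le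
      (by positivity) (le_max_left _ _) hRR₁)
    ((hBm.mono_set (Metric.ball_subset_ball (hr0.trans (min_le_right _ _)))).mono_geom hR₂.le
      (by positivity) (le_max_right _ _) hRR₂)
  -- Half of `δ`, because `t` and `s` both range over the interval and `|t - s| < δ` is needed; at
  -- most `r`, so that `(t, x)` stays in the ball where the coefficients are majorized.
  refine ⟨min (δ / 2) r, by positivity, fun f c hc hf s hs => ?_⟩
  obtain ⟨w, hwa, hw0, hwe⟩ := hsol (fun z => f z.2) c hc
    ((hf.comp_clm Metric.isOpen_ball (ContinuousLinearMap.snd ℝ ℝ E)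
      (ContinuousLinearMap.norm_snd_le ..)).mono_set fun z hz => by
        rw [← ball_prod_same] at hz; exact hz.2)
  set m : ℝ × E → ℝ × (ℝ × E) := fun z => (z.1 - s, z) with hm
  have hmem : ∀ z ∈ Ioo (t₀ - min (δ / 2) r) (t₀ + min (δ / 2) r) ×ˢ Metric.ball x₀ r,
      m z ∈ Ioo (-δ) δ ×ˢ Metric.ball (t₀, x₀) r := by
    rintro ⟨t, x⟩ ⟨ht, hx⟩
    have h1 := min_le_left (δ / 2) r
    have h2 := min_le_right (δ / 2) r
    have ht1 := ht.1
    have ht2 := ht.2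
    have hs1 := hs.1
    have hs2 := hs.2
    simp only at ht1 ht2 hx
    refine ⟨⟨?_, ?_⟩, ?_⟩
    · simp only [hm]; linarith
    · simp only [hm]; linarith
    · rw [← ball_prod_same]
      refine ⟨?_, hx⟩
      rw [Real.ball_eq_Ioo]
      exact ⟨by simp only [hm]; linarith, by simp only [hm]; linarith⟩
  have hma : ∀ z, AnalyticAt ℝ m z := fun z =>
    (analyticAt_fst.sub analyticAt_const).prod analyticAt_id
  have hmd : ∀ z, HasFDerivAt m ((ContinuousLinearMap.fst ℝ ℝ E).prod
      (ContinuousLinearMap.id ℝ (ℝ × E))) z := fun z =>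
    (((ContinuousLinearMap.fst ℝ ℝ E).hasFDerivAt).sub_const s).prodMk (hasFDerivAt_id z)
  refine ⟨fun z => w (m z), fun z hz => (hwa _ (hmem z hz)).comp (hma z), fun x hx => ?_,
    fun z hz => ?_⟩
  · have h1 : (s, x) ∈ Metric.ball (t₀, x₀) r := by
      have := (hmem (s, x) ⟨hs, hx⟩).2
      exact this
    simpa [hm] using hw0 (s, x) h1
  · have hd : HasFDerivAt (fun z => w (m z)) _ z :=
      ((hwa _ (hmem z hz)).differentiableAt.hasFDerivAt).comp z (hmd z)
    have he := hwe _ (hmem z hz)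
    rw [SolvesEvolutionAt, hd.fderiv]
    have e1 : ((fderiv ℝ w (m z)).comp ((ContinuousLinearMap.fst ℝ ℝ E).prod
        (ContinuousLinearMap.id ℝ (ℝ × E)))) (1, 0)
        = fderiv ℝ w (m z) (1, 0) + fderiv ℝ w (m z) (0, ((1, 0) : ℝ × E)) := by
      rw [← map_add]; simp
    have e2 : ((fderiv ℝ w (m z)).comp ((ContinuousLinearMap.fst ℝ ℝ E).prod
        (ContinuousLinearMap.id ℝ (ℝ × E)))).comp (ContinuousLinearMap.inr ℝ ℝ E)
        = ((fderiv ℝ w (m z)).comp (ContinuousLinearMap.inr ℝ ℝ (ℝ × E))).comp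
          (ContinuousLinearMap.inr ℝ ℝ E) := by
      ext v; simp
    rw [e1, e2, he]
    simp only [hP'def, hm, sub_apply, ContinuousLinearMap.comp_apply,
      ContinuousLinearMap.apply_apply, ContinuousLinearMap.precomp_apply,
      ContinuousLinearMap.inr_apply]
    abel

end EvolutionEquation

/-! ### Integrals of functions supported in a fixed compact set. -/

section CompactlySupportedPairings

open MeasureTheory

variable {E : Type*} [NormedAddCommGroup E]
  {V : Type*} [NormedAddCommGroup V]

theorem ContinuousOn.continuous_of_eq_zero_off {g : E → V} {O K : Set E} (hO : IsOpen O)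
    (hK : IsClosed K) (hKO : K ⊆ O) (hg : ContinuousOn g O) (h0 : ∀ x ∉ K, g x = 0) :
    Continuous g := by
  rw [continuous_iff_continuousAt]
  intro x
  by_cases hx : x ∈ O
  · exact hg.continuousAt (hO.mem_nhds hx)
  · have : g =ᶠ[nhds x] fun _ => 0 := by
      filter_upwards [hK.isOpen_compl.mem_nhds fun h => hx (hKO h)] with y hy using h0 y hy
    exact continuousAt_const.congr this.symm

variable [MeasurableSpace E] [BorelSpace E] {μ : Measure E} [IsFiniteMeasureOnCompacts μ]

theorem ContinuousOn.integrable_of_eq_zero_off {g : E → V} {O K : Set E} (hO : IsOpen O)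
    (hK : IsCompact K) (hKO : K ⊆ O) (hg : ContinuousOn g O) (h0 : ∀ x ∉ K, g x = 0) :
    Integrable g μ :=
  (hg.continuous_of_eq_zero_off hO hK.isClosed hKO h0).integrable_of_hasCompactSupport
    (HasCompactSupport.intro hK h0)

/-- Differentiation under the integral sign for functions supported in a fixed compact set. -/
theorem hasDerivAt_integral_of_eq_zero_off [NormedSpace ℝ E] [FiniteDimensional ℝ E]
    {h h' : ℝ × E → ℝ} {O K : Set E} {a b : ℝ}
    (hO : IsOpen O) (hK : IsCompact K) (hKO : K ⊆ O)
    (hc : ContinuousOn h (Ioo a b ×ˢ O)) (hc' : ContinuousOn h' (Ioo a b ×ˢ O))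
    (h0 : ∀ s ∈ Ioo a b, ∀ x ∉ K, h (s, x) = 0) (h0' : ∀ s ∈ Ioo a b, ∀ x ∉ K, h' (s, x) = 0)
    (hd : ∀ s ∈ Ioo a b, ∀ x, HasDerivAt (fun s => h (s, x)) (h' (s, x)) s) {s : ℝ}
    (hs : s ∈ Ioo a b) :
    HasDerivAt (fun s => ∫ x, h (s, x) ∂μ) (∫ x, h' (s, x) ∂μ) s := by
  obtain ⟨ε, hε, hεs⟩ : ∃ ε > 0, Icc (s - ε) (s + ε) ⊆ Ioo a b := by
    obtain ⟨ε, hε, h⟩ := Metric.nhds_basis_closedBall.mem_iff.1 (isOpen_Ioo.mem_nhds hs)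
    exact ⟨ε, hε, by rwa [← Real.closedBall_eq_Icc]⟩
  have hslice : ∀ {g : ℝ × E → ℝ}, ContinuousOn g (Ioo a b ×ˢ O) → ∀ s' ∈ Ioo a b,
      ContinuousOn (fun x => g (s', x)) O := fun hg s' hs' =>
    hg.comp (by fun_prop) fun x hx => ⟨hs', hx⟩
  obtain ⟨C, hC⟩ := (isCompact_Icc.prod hK).exists_bound_of_continuousOn
    (hc'.mono (prod_mono hεs hKO))
  have hint : ∀ s' ∈ Ioo a b, Integrable (fun x => h (s', x)) μ := fun s' hs' =>
    (hslice hc s' hs').integrable_of_eq_zero_off hO hK hKO (h0 s' hs')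
  refine (hasDerivAt_integral_of_dominated_loc_of_deriv_le (F := fun s x => h (s, x))
    (F' := fun s x => h' (s, x)) (bound := K.indicator fun _ => C) (s := Icc (s - ε) (s + ε))
    (Icc_mem_nhds (by linarith) (by linarith)) ?_ (hint s hs) ?_ ?_ ?_ ?_).2
  · filter_upwards [isOpen_Ioo.mem_nhds hs] with s' hs' using (hint s' hs').aestronglyMeasurable
  · exact ((hslice hc' s hs).integrable_of_eq_zero_off (μ := μ) hO hK hKO
      (h0' s hs)).aestronglyMeasurable
  · refine Filter.Eventually.of_forall fun x s' hs' => ?_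
    by_cases hx : x ∈ K
    · rw [indicator_of_mem hx]; exact hC (s', x) ⟨hs', hx⟩
    · rw [indicator_of_notMem hx, h0' s' (hεs hs') x hx, norm_zero]
  · exact (integrable_indicator_iff hK.measurableSet).2
      (integrableOn_const hK.measure_lt_top.ne)
  · exact Filter.Eventually.of_forall fun x s' hs' => hd s' (hεs hs') x

end CompactlySupportedPairings

/-! ### Density of entire functions. -/

section EntireFunctions

open MeasureTheory
open scoped PowerSeries

variable {E : Type*} [NormedAddCommGroup E] [NormedSpace ℝ E]

/-- The Taylor coefficients of `q` on `S` decay faster than any geometric sequence. -/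
def IsEntireOn (S : Set E) (q : E → ℝ) : Prop :=
  ∀ R > 0, ∃ c ≥ 0, IsMajorizedOn S q (PowerSeries.C c * geomPowerSeries R)

namespace IsEntireOn

variable {S : Set E} {q q' : E → ℝ}

theorem const (c : ℝ) : IsEntireOn S fun _ => c := fun R hR =>
  ⟨‖c‖, norm_nonneg _, (IsMajorizedOn.const c).mono fun m => by
    rw [PowerSeries.coeff_C_mul, coeff_geomPowerSeries, PowerSeries.coeff_C]
    split_ifs with h
    · simp [h]
    · positivity⟩

theorem add (hq : IsEntireOn S q) (hq' : IsEntireOn S q') : IsEntireOn S fun x => q x + q' x :=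
  fun R hR => by
    obtain ⟨c, hc, h⟩ := hq R hR
    obtain ⟨c', hc', h'⟩ := hq' R hR
    refine ⟨c + c', add_nonneg hc hc', ?_⟩
    rw [map_add, add_mul]
    exact h.add h'

theorem mul (hS : IsOpen S) (hq : IsEntireOn S q) (hq' : IsEntireOn S q') :
    IsEntireOn S fun x => q x * q' x := fun R hR => by
  -- The square of the geometric series of ratio `R/2` has coefficients at most `4 R^m`, so halving
  -- the ratio of the factors gives ratio `R` for the product.
  obtain ⟨c, hc, h⟩ := hq (R / 2) (by positivity)
  obtain ⟨c', hc', h'⟩ := hq' (R / 2) (by positivity)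
  refine ⟨4 * (c * c'), by positivity, (IsMajorizedOn.bilinear hS (ContinuousLinearMap.mul ℝ ℝ)
    (ContinuousLinearMap.opNorm_mul_le ℝ ℝ) h h').mono fun m => ?_⟩
  have e : PowerSeries.C c * geomPowerSeries (R / 2) * (PowerSeries.C c' * geomPowerSeries (R / 2))
      = PowerSeries.C (c * c') * geomPowerSeries (R / 2) ^ 2 := by rw [map_mul]; ring
  rw [e, PowerSeries.coeff_C_mul, PowerSeries.coeff_C_mul, coeff_geomPowerSeries]
  calc _ ≤ c * c' * (2 ^ 2 * (2 * (R / 2)) ^ m) := by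
        gcongr
        exact coeff_geomPowerSeries_pow_le (by positivity) _ _
    _ = _ := by rw [mul_div_cancel₀ R two_ne_zero]; ring

theorem clm (hS : Bornology.IsBounded S) (L : E →L[ℝ] ℝ) : IsEntireOn S L := fun R hR => by
  obtain ⟨C, hC⟩ := hS.exists_norm_le
  refine ⟨‖L‖ * |C| + ‖L‖ * R⁻¹, by positivity, (IsMajorizedOn.clm L (c := ‖L‖ * |C|) (fun x hx =>
    (L.le_opNorm x).trans ?_) le_rfl).mono fun m => ?_⟩
  · have := hC x hx
    gcongr
    exact this.trans (le_abs_self C)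
  · rw [PowerSeries.coeff_C_mul, coeff_geomPowerSeries, map_add, PowerSeries.coeff_C_mul]
    rcases m with _ | _ | m
    · simp; positivity
    · simp only [PowerSeries.coeff_C, PowerSeries.coeff_X]
      simp
      rw [add_mul, inv_mul_cancel_right₀ hR.ne']
      have : 0 ≤ ‖L‖ * |C| * R := by positivity
      linarith
    · simp only [PowerSeries.coeff_C, PowerSeries.coeff_X]
      simp
      positivity

end IsEntireOn

variable [MeasurableSpace E] [BorelSpace E]
  {μ : Measure E} [IsFiniteMeasureOnCompacts μ] [μ.IsOpenPosMeasure]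

/-- Entire functions form an algebra that contains the constants and the linear functionals, so by
Stone–Weierstrass some `q` is within `ε` of `g` on `K`. Then `∫ g² = ∫ (g - q) g ≤ ε ∫ |g|`. -/
theorem eq_zero_of_integral_mul_entire_eq_zero {g : E → ℝ} (hg : Continuous g) {K S : Set E}
    (hK : IsCompact K) (hS : IsOpen S) (hKS : K ⊆ S) (hSb : Bornology.IsBounded S)
    (h0 : ∀ x ∉ K, g x = 0) (hint : ∀ q, IsEntireOn S q → ∫ x, q x * g x ∂μ = 0) : g = 0 := by
  have : CompactSpace K := isCompact_iff_compactSpace.1 hK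
  let A : Subalgebra ℝ C(K, ℝ) :=
    { carrier := {f | ∃ q : E → ℝ, IsEntireOn S q ∧ ∀ x : K, f x = q x}
      mul_mem' := by
        rintro f f' ⟨q, hq, hf⟩ ⟨q', hq', hf'⟩
        exact ⟨_, hq.mul hS hq', fun x => by simp [hf, hf']⟩
      add_mem' := by
        rintro f f' ⟨q, hq, hf⟩ ⟨q', hq', hf'⟩
        exact ⟨_, hq.add hq', fun x => by simp [hf, hf']⟩
      algebraMap_mem' := fun c => ⟨_, IsEntireOn.const c, fun x => rfl⟩ }
  have hA : A.SeparatesPoints := by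
    intro x y hxy
    obtain ⟨L, hL⟩ := SeparatingDual.exists_separating_of_ne (R := ℝ)
      (fun h => hxy (Subtype.ext h) : (x : E) ≠ y)
    exact ⟨fun z : K => L z, ⟨⟨fun z : K => L z, by fun_prop⟩,
      ⟨L, IsEntireOn.clm hSb L, fun _ => rfl⟩, rfl⟩, hL⟩
  have hcs : HasCompactSupport g := HasCompactSupport.intro hK h0
  have hgi : Integrable g μ := hg.integrable_of_hasCompactSupport hcs
  have hg2c : Continuous fun x => g x * g x := hg.mul hg
  have hg2s : HasCompactSupport fun x => g x * g x := hcs.mul_left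
  have hg2 : Integrable (fun x => g x * g x) μ := hg2c.integrable_of_hasCompactSupport hg2s
  have hle : ∀ ε > 0, ∫ x, g x * g x ∂μ ≤ ε * ∫ x, |g x| ∂μ := by
    intro ε hε
    obtain ⟨⟨f, q, hq, hf⟩, hfε⟩ :=
      ContinuousMap.exists_mem_subalgebra_near_continuousMap_of_separatesPoints A hA
        ⟨fun x : K => g x, by fun_prop⟩ ε hε
    have hqg : ∀ x, |(g x - q x) * g x| ≤ ε * |g x| := by
      intro x
      by_cases hx : x ∈ K
      · rw [abs_mul]
        gcongr
        have := (ContinuousMap.norm_coe_le_norm _ (⟨x, hx⟩ : K)).trans hfε.le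
        rw [ContinuousMap.sub_apply, Real.norm_eq_abs, abs_sub_comm] at this
        simpa [hf] using this
      · simp [h0 x hx]
    have hqgi : Integrable (fun x => q x * g x) μ := by
      refine ContinuousOn.integrable_of_eq_zero_off hS hK hKS ?_ fun x hx => by simp [h0 x hx]
      obtain ⟨c, _, hqm⟩ := hq 1 one_pos
      exact hqm.1.continuousOn.mul hg.continuousOn
    calc ∫ x, g x * g x ∂μ = ∫ x, (g x - q x) * g x ∂μ := by
          simp only [sub_mul]
          rw [integral_sub hg2 hqgi, hint q hq, sub_zero]
      _ ≤ ∫ x, ε * |g x| ∂μ := by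
          refine integral_mono ?_ (hgi.abs.const_mul ε) fun x => (le_abs_self _).trans (hqg x)
          simp only [sub_mul]
          exact hg2.sub hqgi
      _ = _ := integral_const_mul _ _
  have hI : ∫ x, g x * g x ∂μ = 0 := by
    refine le_antisymm ?_ (integral_nonneg fun x => mul_self_nonneg _)
    refine le_of_forall_pos_le_add fun ε hε => ?_
    set J := ∫ x, |g x| ∂μ
    have hJ : 0 ≤ J := integral_nonneg fun x => abs_nonneg _
    calc _ ≤ ε / (J + 1) * J := hle _ (by positivity)
      _ ≤ 0 + ε := by
        rw [zero_add, div_mul_eq_mul_div, div_le_iff₀ (by positivity)]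
        nlinarith
  have hae := (integral_eq_zero_iff_of_nonneg (fun x => mul_self_nonneg (g x)) hg2).1 hI
  have hz := (hg2c.ae_eq_iff_eq μ continuous_zero).1 hae
  funext x
  exact mul_self_eq_zero.1 (congrFun hz x)

end EntireFunctions

/-! ### The adjoint equation and uniqueness for compactly supported solutions. -/

section Duality

set_option maxSynthPendingDepth 3

open MeasureTheory
open scoped PowerSeries

variable {E : Type*} [NormedAddCommGroup E] [NormedSpace ℝ E]
  {F : Type*} [NormedAddCommGroup F] [NormedSpace ℝ F]

/-- The coefficient of the derivative in the direction `e` in the principal part `P`, relative to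
a basis in which `l` is the coordinate dual to `e`. -/
def principalCoeff (P : ℝ × E → (E →L[ℝ] F) →L[ℝ] F) (l : E →L[ℝ] ℝ) (z : ℝ × E) : F →L[ℝ] F :=
  (P z).comp (ContinuousLinearMap.smulRightL ℝ E F l)

theorem AnalyticAt.principalCoeff {P : ℝ × E → (E →L[ℝ] F) →L[ℝ] F} {z : ℝ × E}
    (hP : AnalyticAt ℝ P z) (l : E →L[ℝ] ℝ) : AnalyticAt ℝ (principalCoeff P l) z :=
  hP.clm_comp analyticAt_const

variable {ι : Type*} [Fintype ι]

/-- The coordinate functionals of a basis of a finite-dimensional space. -/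
def basisCoord [FiniteDimensional ℝ E] (b : Module.Basis ι ℝ E) (i : ι) : E →L[ℝ] ℝ :=
  (b.coord i).toContinuousLinearMap

theorem apply_eq_sum_principalCoeff [FiniteDimensional ℝ E] (P : ℝ × E → (E →L[ℝ] F) →L[ℝ] F)
    (b : Module.Basis ι ℝ E) (z : ℝ × E) (L : E →L[ℝ] F) :
    P z L = ∑ i, principalCoeff P (basisCoord b i) z (L (b i)) := by
  have h : L = ∑ i, ContinuousLinearMap.smulRightL ℝ E F (basisCoord b i) (L (b i)) := by
    ext v
    conv_lhs => rw [← b.sum_repr v, map_sum]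
    rw [sum_apply]
    refine Finset.sum_congr rfl fun i _ => ?_
    simp [basisCoord]
  conv_lhs => rw [h, map_sum]
  rfl

/-- The principal part of the adjoint equation. -/
def adjointPrincipal [FiniteDimensional ℝ E] (P : ℝ × E → (E →L[ℝ] F) →L[ℝ] F)
    (b : Module.Basis ι ℝ E) (z : ℝ × E) : (E →L[ℝ] (F →L[ℝ] ℝ)) →L[ℝ] (F →L[ℝ] ℝ) :=
  ∑ i, ((ContinuousLinearMap.compL ℝ F F ℝ).flip (principalCoeff P (basisCoord b i) z)).comp
    (ContinuousLinearMap.apply ℝ (F →L[ℝ] ℝ) (b i))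

/-- The zeroth order part of the adjoint equation. -/
def adjointZeroth [FiniteDimensional ℝ E] (P : ℝ × E → (E →L[ℝ] F) →L[ℝ] F)
    (B : ℝ × E → F →L[ℝ] F) (b : Module.Basis ι ℝ E) (z : ℝ × E) :
    (F →L[ℝ] ℝ) →L[ℝ] (F →L[ℝ] ℝ) :=
  (ContinuousLinearMap.compL ℝ F F ℝ).flip
    (∑ i, fderiv ℝ (principalCoeff P (basisCoord b i)) z (0, b i) - B z)

theorem AnalyticAt.adjointPrincipal [FiniteDimensional ℝ E] {P : ℝ × E → (E →L[ℝ] F) →L[ℝ] F}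
    {z : ℝ × E} (hP : AnalyticAt ℝ P z) (b : Module.Basis ι ℝ E) :
    AnalyticAt ℝ (adjointPrincipal P b) z := by
  refine Finset.analyticAt_fun_sum _ fun i _ => AnalyticAt.clm_comp ?_ analyticAt_const
  exact analyticAt_const.clm_apply (hP.principalCoeff _)

theorem AnalyticAt.adjointZeroth [FiniteDimensional ℝ E] [CompleteSpace F]
    {P : ℝ × E → (E →L[ℝ] F) →L[ℝ] F} {B : ℝ × E → F →L[ℝ] F}
    {z : ℝ × E} (hP : AnalyticAt ℝ P z) (hB : AnalyticAt ℝ B z) (b : Module.Basis ι ℝ E) :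
    AnalyticAt ℝ (adjointZeroth P B b) z := by
  refine analyticAt_const.clm_apply (AnalyticAt.sub ?_ hB)
  exact Finset.analyticAt_fun_sum _ fun i _ =>
    (hP.principalCoeff _).fderiv.clm_apply analyticAt_const

/-- Solutions of the equation and of its adjoint have a constant pairing. -/
theorem integral_pairing_eq [FiniteDimensional ℝ E] [CompleteSpace F] [MeasurableSpace E]
    [BorelSpace E] {μ : Measure E} [μ.IsAddHaarMeasure]
    {P : ℝ × E → (E →L[ℝ] F) →L[ℝ] F} {B : ℝ × E → F →L[ℝ] F} (b : Module.Basis ι ℝ E)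
    {O K : Set E} {a c : ℝ} (hO : IsOpen O) (hK : IsCompact K) (hKO : K ⊆ O)
    (hP : AnalyticOnNhd ℝ P (Ioo a c ×ˢ O))
    {u : ℝ × E → (F →L[ℝ] ℝ)} (hu : AnalyticOnNhd ℝ u (Ioo a c ×ˢ O))
    (hue : ∀ z ∈ Ioo a c ×ˢ O,
      SolvesEvolutionAt (adjointPrincipal P b) (adjointZeroth P B b) u z)
    {W : ℝ × E → F} (hWd : ∀ z ∈ Ioo a c ×ˢ univ, DifferentiableAt ℝ W z)
    (hWc : ContinuousOn (fderiv ℝ W) (Ioo a c ×ˢ univ))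
    (hW0 : ∀ s ∈ Ioo a c, ∀ x ∉ K, W (s, x) = 0)
    (hWe : ∀ z ∈ Ioo a c ×ˢ O, SolvesEvolutionAt P B W z) {s t : ℝ} (hs : s ∈ Ioo a c)
    (ht : t ∈ Ioo a c) :
    ∫ x, u (s, x) (W (s, x)) ∂μ = ∫ x, u (t, x) (W (t, x)) ∂μ := by
  have hWcont : ContinuousOn W (Ioo a c ×ˢ univ) := fun z hz =>
    (hWd z hz).continuousAt.continuousWithinAt
  have hsub : Ioo a c ×ˢ O ⊆ Ioo a c ×ˢ univ := prod_mono le_rfl (subset_univ _)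
  have hW0' : ∀ s ∈ Ioo a c, ∀ x ∉ K, fderiv ℝ W (s, x) = 0 := by
    intro s hs x hx
    have : W =ᶠ[nhds (s, x)] fun _ => 0 := by
      filter_upwards [(isOpen_Ioo.prod hK.isClosed.isOpen_compl).mem_nhds
        (show (s, x) ∈ Ioo a c ×ˢ Kᶜ from ⟨hs, hx⟩)] with y hy using hW0 y.1 hy.1 y.2 hy.2
    rw [this.fderiv_eq]; simp
  have huc : ContinuousOn (fderiv ℝ u) (Ioo a c ×ˢ O) := hu.fderiv.continuousOn
  set h : ℝ × E → ℝ := fun z => u z (W z) with hh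
  set h' : ℝ × E → ℝ := fun z => fderiv ℝ u z (1, 0) (W z) + u z (fderiv ℝ W z (1, 0)) with hh'
  have hder : ∀ s ∈ Ioo a c,
      HasDerivAt (fun s => ∫ x, h (s, x) ∂μ) (∫ x, h' (s, x) ∂μ) s := by
    intro s hs
    refine hasDerivAt_integral_of_eq_zero_off hO hK hKO ?_ ?_ ?_ ?_ ?_ hs
    · exact hu.continuousOn.clm_apply (hWcont.mono hsub)
    · exact ((huc.clm_apply continuousOn_const).clm_apply (hWcont.mono hsub)).add
        (hu.continuousOn.clm_apply ((hWc.mono hsub).clm_apply continuousOn_const))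
    · intro s hs x hx; simp [hh, hW0 s hs x hx]
    · intro s hs x hx; simp [hh', hW0 s hs x hx, hW0' s hs x hx]
    · intro s hs x
      have hγ : HasDerivAt (fun s : ℝ => (s, x)) ((1, 0) : ℝ × E) s :=
        (hasDerivAt_id s).prodMk (hasDerivAt_const s x)
      by_cases hx : x ∈ O
      · have h1 := (hu (s, x) ⟨hs, hx⟩).differentiableAt.hasFDerivAt.comp_hasDerivAt s hγ
        have h2 := (hWd (s, x) ⟨hs, mem_univ x⟩).hasFDerivAt.comp_hasDerivAt s hγ
        exact h1.clm_apply h2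
      · have hxK : x ∉ K := fun h => hx (hKO h)
        have e : h' (s, x) = 0 := by simp [hh', hW0 s hs x hxK, hW0' s hs x hxK]
        rw [e]
        refine (hasDerivAt_const s (0 : ℝ)).congr_of_eventuallyEq ?_
        filter_upwards [isOpen_Ioo.mem_nhds hs] with s' hs'
        simp [hh, hW0 s' hs' x hxK]
  -- With `A i` the coefficient of `∂_i`, the adjoint equation reads `∂_t u = ∑ i, ∂_i(u ∘ A i) - u
  -- ∘ B`. Hence the time derivative of the pairing integrates the divergence `∑ i, ∂_i(u (A i W))`,
  -- whose integral vanishes because `W` has compact support in space.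
  have hzero : ∀ s ∈ Ioo a c, ∫ x, h' (s, x) ∂μ = 0 := by
    intro s hs
    set A : ι → ℝ × E → F →L[ℝ] F := fun i => principalCoeff P (basisCoord b i) with hA
    have hAa : ∀ i, ∀ z ∈ Ioo a c ×ˢ O, AnalyticAt ℝ (A i) z := fun i z hz =>
      (hP z hz).principalCoeff _
    set v : ι → E → F →L[ℝ] ℝ := fun i x => (u (s, x)).comp (A i (s, x)) with hv
    set v' : ι → E → E →L[ℝ] F →L[ℝ] ℝ := fun i x => fderiv ℝ (fun y => v i y) x with hv'
    have hιd : ∀ x : E, HasFDerivAt (fun x : E => (s, x)) (ContinuousLinearMap.inr ℝ ℝ E) x :=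
      fun x => hasFDerivAt_prodMk_right s x
    have hva : ∀ i, AnalyticOnNhd ℝ (v i) O := fun i x hx => by
      have h1 : AnalyticAt ℝ (fun x : E => (s, x)) x := analyticAt_const.prod analyticAt_id
      exact ((hu (s, x) ⟨hs, hx⟩).clm_comp (hAa i (s, x) ⟨hs, hx⟩)).comp_of_eq h1 rfl
    have hvd : ∀ i, ∀ x ∈ O, v' i x (b i) = (fderiv ℝ u (s, x) (0, b i)).comp (A i (s, x))
        + (u (s, x)).comp (fderiv ℝ (A i) (s, x) (0, b i)) := by
      intro i x hx
      have h1 := ((hu (s, x) ⟨hs, hx⟩).differentiableAt.hasFDerivAt.comp x (hιd x)).clm_comp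
        ((hAa i (s, x) ⟨hs, hx⟩).differentiableAt.hasFDerivAt.comp x (hιd x))
      have h2 : v' i x = _ := h1.fderiv
      rw [h2]
      ext f
      simp [add_comm]
    have hwd : ∀ x, HasFDerivAt (fun x => W (s, x))
        ((fderiv ℝ W (s, x)).comp (ContinuousLinearMap.inr ℝ ℝ E)) x := fun x =>
      (hWd (s, x) ⟨hs, mem_univ x⟩).hasFDerivAt.comp x (hιd x)
    have hwsupp : tsupport (fun x => W (s, x)) ⊆ K :=
      closure_minimal (fun x hx => by
        by_contra hxK
        exact hx (hW0 s hs x hxK)) hK.isClosed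
    have hWs : ContinuousOn (fun x => W (s, x)) O :=
      (hWcont.mono hsub).comp (by fun_prop) fun x hx => ⟨hs, hx⟩
    have hWs' : ContinuousOn (fun x => fderiv ℝ W (s, x)) O :=
      (hWc.mono hsub).comp (by fun_prop) fun x hx => ⟨hs, hx⟩
    have hi1 : ∀ i, Integrable (fun x => v' i x (b i) (W (s, x))) μ := fun i =>
      ContinuousOn.integrable_of_eq_zero_off hO hK hKO
        (((hva i).fderiv.continuousOn.clm_apply continuousOn_const).clm_apply hWs)
        fun x hx => by simp [hW0 s hs x hx]
    have hi2 : ∀ i, Integrable (fun x => v i x (fderiv ℝ W (s, x) (0, b i))) μ := fun i =>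
      ContinuousOn.integrable_of_eq_zero_off hO hK hKO
        ((hva i).continuousOn.clm_apply (hWs'.clm_apply continuousOn_const))
        fun x hx => by simp [hW0' s hs x hx]
    have hi3 : ∀ i, Integrable (fun x => v i x (W (s, x))) μ := fun i =>
      ContinuousOn.integrable_of_eq_zero_off hO hK hKO ((hva i).continuousOn.clm_apply hWs)
        fun x hx => by simp [hW0 s hs x hx]
    have hparts : ∀ i, ∫ x, v i x (fderiv ℝ W (s, x) (0, b i)) ∂μ
        = - ∫ x, v' i x (b i) (W (s, x)) ∂μ := fun i => by
      have := integral_bilinear_hasFDerivAt_right_eq_neg_left_of_integrable (μ := μ)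
        (f := v i) (f' := v' i) (g := fun x => W (s, x))
        (g' := fun x => (fderiv ℝ W (s, x)).comp (ContinuousLinearMap.inr ℝ ℝ E)) (v := b i)
        (B := ContinuousLinearMap.id ℝ (F →L[ℝ] ℝ)) (hi1 i) (by simpa using hi2 i) (hi3 i)
        (fun x hx => ((hva i) x (hKO (hwsupp hx))).differentiableAt.hasFDerivAt)
        (fun x _ => hwd x)
      simpa using this
    have hpt : ∀ x, h' (s, x)
        = ∑ i, (v i x (fderiv ℝ W (s, x) (0, b i)) + v' i x (b i) (W (s, x))) := by
      intro x
      by_cases hx : x ∈ O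
      · have e1 := hue (s, x) ⟨hs, hx⟩
        have e2 := hWe (s, x) ⟨hs, hx⟩
        rw [SolvesEvolutionAt] at e1 e2
        rw [apply_eq_sum_principalCoeff P b] at e2
        simp only [hh']
        rw [e1, e2]
        simp only [hvd _ x hx, adjointPrincipal, adjointZeroth, hv]
        simp only [sub_apply, sum_apply, ContinuousLinearMap.comp_apply,
          ContinuousLinearMap.apply_apply, ContinuousLinearMap.inr_apply, add_apply,
          ContinuousLinearMap.flip_apply, ContinuousLinearMap.compL_apply, map_add, map_sub,
          map_sum, Finset.sum_add_distrib]
        ring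
      · have hxK : x ∉ K := fun h => hx (hKO h)
        simp [hh', hW0 s hs x hxK, hW0' s hs x hxK]
    simp only [hpt]
    have hi12 : ∀ i, Integrable (fun x => v i x (fderiv ℝ W (s, x) (0, b i))
        + v' i x (b i) (W (s, x))) μ := fun i => (hi2 i).add (hi1 i)
    rw [integral_finsetSum _ fun i _ => hi12 i]
    refine Finset.sum_eq_zero fun i _ => ?_
    rw [integral_add (hi2 i) (hi1 i), hparts i, neg_add_cancel]
  have hdiff : DifferentiableOn ℝ (fun s => ∫ x, h (s, x) ∂μ) (Ioo a c) := fun s hs =>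
    (hder s hs).differentiableAt.differentiableWithinAt
  exact isOpen_Ioo.is_const_of_deriv_eq_zero isPreconnected_Ioo hdiff
    (fun s hs => by rw [(hder s hs).deriv, hzero s hs]; rfl) hs ht

/-- For entire `q` and a functional `l`, the adjoint equation is solved with value `q • l` at time
`s`. Constancy of the pairing gives `∫ q l(W(s, ·)) = 0`, since `W` vanishes at `t₀`, and density of
the `q` gives `W(s, ·) = 0`. Entire data are used because all of them are majorized with the same
ratio `R`, so a single `δ` serves them all. -/
theorem exists_forall_eq_zero_of_solvesEvolutionAt [FiniteDimensional ℝ E] [CompleteSpace F]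
    {P : ℝ × E → (E →L[ℝ] F) →L[ℝ] F} {B : ℝ × E → F →L[ℝ] F} {t₀ : ℝ} {x₀ : E}
    (hP : AnalyticAt ℝ P (t₀, x₀)) (hB : AnalyticAt ℝ B (t₀, x₀)) :
    ∃ r₀ > 0, ∀ r > 0, r ≤ r₀ → ∃ δ > 0, ∀ δ' > 0, δ' ≤ δ → ∀ W : ℝ × E → F,
      (∀ z ∈ Ioo (t₀ - δ') (t₀ + δ') ×ˢ univ, DifferentiableAt ℝ W z) →
      ContinuousOn (fderiv ℝ W) (Ioo (t₀ - δ') (t₀ + δ') ×ˢ univ) →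
      (∀ s ∈ Ioo (t₀ - δ') (t₀ + δ'), ∀ x ∉ Metric.closedBall x₀ (r / 2), W (s, x) = 0) →
      (∀ x, W (t₀, x) = 0) →
      (∀ z ∈ Ioo (t₀ - δ') (t₀ + δ') ×ˢ Metric.ball x₀ r, SolvesEvolutionAt P B W z) →
      ∀ s ∈ Ioo (t₀ - δ') (t₀ + δ'), ∀ x, W (s, x) = 0 := by
  let _ : MeasurableSpace E := borel E
  have : BorelSpace E := ⟨rfl⟩
  set b := Module.finBasis ℝ E
  obtain ⟨r₁, hr₁, R, hR, hCK⟩ := exists_solvesEvolutionAt (hP.adjointPrincipal b)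
    (hP.adjointZeroth hB b)
  obtain ⟨r₂, hr₂, hPa⟩ := Metric.eventually_nhds_iff_ball.1 hP.eventually_analyticAt
  refine ⟨min r₁ r₂, by positivity, fun r hr hr0 => ?_⟩
  obtain ⟨δ, hδ, hsol⟩ := hCK r hr (hr0.trans (min_le_left _ _)) R le_rfl
  refine ⟨min δ r₂, by positivity, fun δ' hδ' hδδ' W hWd hWc hW0 hWt hWe s hs x => ?_⟩
  have hδ1 : δ' ≤ δ := hδδ'.trans (min_le_left _ _)
  have hδ2 : δ' ≤ r₂ := hδδ'.trans (min_le_right _ _)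
  have ht₀ : t₀ ∈ Ioo (t₀ - δ') (t₀ + δ') := ⟨by linarith, by linarith⟩
  have hsub : Ioo (t₀ - δ') (t₀ + δ') ×ˢ Metric.ball x₀ r
      ⊆ Ioo (t₀ - δ) (t₀ + δ) ×ˢ Metric.ball x₀ r :=
    prod_mono (Ioo_subset_Ioo (by linarith) (by linarith)) le_rfl
  have hPan : AnalyticOnNhd ℝ P (Ioo (t₀ - δ') (t₀ + δ') ×ˢ Metric.ball x₀ r) := by
    refine fun z hz => hPa z ?_
    rw [← ball_prod_same, Real.ball_eq_Ioo]
    exact ⟨Ioo_subset_Ioo (by linarith) (by linarith) hz.1,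
      Metric.ball_subset_ball (hr0.trans (min_le_right _ _)) hz.2⟩
  have hKO : Metric.closedBall x₀ (r / 2) ⊆ Metric.ball x₀ r :=
    Metric.closedBall_subset_ball (by linarith)
  have hK : IsCompact (Metric.closedBall x₀ (r / 2)) := isCompact_closedBall _ _
  refine SeparatingDual.eq_zero_of_forall_dual_eq_zero (R := ℝ) fun l => ?_
  have hWcont : Continuous fun x => W (s, x) := by
    rw [continuous_iff_continuousAt]
    intro x
    exact (hWd (s, x) ⟨hs, mem_univ x⟩).continuousAt.comp (by fun_prop)
  refine congrFun (eq_zero_of_integral_mul_entire_eq_zero (μ := Measure.addHaar)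
    (g := fun x => l (W (s, x))) (l.continuous.comp hWcont) hK Metric.isOpen_ball hKO
    Metric.isBounded_ball (fun x hx => by simp [hW0 s hs x hx]) fun q hq => ?_) x
  obtain ⟨c, hc, hqm⟩ := hq R hR
  have hql : IsMajorizedOn (Metric.ball x₀ r) (fun x => q x • l)
      (PowerSeries.C (‖l‖ * c) * geomPowerSeries R) := by
    refine IsMajorizedOn.mono (hqm.clm_comp (ContinuousLinearMap.toSpanSingleton ℝ l)) fun m => ?_
    rw [ContinuousLinearMap.norm_toSpanSingleton, map_mul PowerSeries.C, mul_assoc]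
  obtain ⟨u, hua, hus, hue⟩ := hsol (fun x => q x • l) (‖l‖ * c) (by positivity) hql s
    (Ioo_subset_Ioo (by linarith) (by linarith) hs)
  have hpair := integral_pairing_eq (μ := Measure.addHaar) b Metric.isOpen_ball hK hKO hPan
    (hua.mono hsub) (fun z hz => hue z (hsub hz)) hWd hWc hW0 hWe hs ht₀
  simp only [hWt, map_zero, integral_zero] at hpair
  rw [← hpair]
  refine integral_congr_ae (Filter.Eventually.of_forall fun x => ?_)
  by_cases hx : x ∈ Metric.ball x₀ r
  · simp [hus x hx]
  · simp [hW0 s hs x fun h => hx (hKO h)]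

end Duality

/-! ### Holmgren's uniqueness theorem. -/

section Holmgren

set_option maxSynthPendingDepth 3

open Filter Topology

variable {E : Type*} [NormedAddCommGroup E] [NormedSpace ℝ E]
  {F : Type*} [NormedAddCommGroup F] [NormedSpace ℝ F]

/-- The squared Euclidean distance in linear coordinates; the given norm of `E` need not be
analytic. The function serves as the profile of the paraboloid that shears time. -/
theorem exists_analytic_bump_well [FiniteDimensional ℝ E] (x₀ : E) :
    ∃ ρ : E → ℝ, (∀ x, AnalyticAt ℝ ρ x) ∧ ρ x₀ = 0 ∧ (∀ x, 0 ≤ ρ x) ∧ fderiv ℝ ρ x₀ = 0 ∧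
      ∀ U ∈ 𝓝 x₀, ∃ ε > 0, ∀ x, ρ x < ε → x ∈ U := by
  have h0 : ‖toEuclidean (x₀ - x₀)‖ ^ 2 = 0 := by simp
  refine ⟨fun x => ‖toEuclidean (x - x₀)‖ ^ 2, fun x => ?_, h0, fun x => by positivity, ?_,
    fun U hU => ?_⟩
  · have h1 : ContDiff ℝ ω fun x : E => ‖toEuclidean (x - x₀)‖ ^ 2 :=
      ContDiff.norm_sq ℝ (toEuclidean.contDiff.comp (contDiff_id.sub contDiff_const))
    exact h1.contDiffAt.analyticAt
  · refine IsLocalMin.fderiv_eq_zero (Eventually.of_forall fun x => ?_)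
    simp only [h0]
    positivity
  · have h2 : toEuclidean.symm ⁻¹' ((fun v => x₀ + v) ⁻¹' U) ∈
        𝓝 (0 : EuclideanSpace ℝ (Fin (Module.finrank ℝ E))) := by
      refine toEuclidean.symm.continuous.continuousAt.preimage_mem_nhds ?_
      rw [map_zero]
      refine (continuous_const.add continuous_id).continuousAt.preimage_mem_nhds ?_
      simpa using hU
    obtain ⟨ε, hε, hεU⟩ := Metric.mem_nhds_iff.1 h2
    refine ⟨ε ^ 2, by positivity, fun x hx => ?_⟩
    have h3 := hεU (show toEuclidean (x - x₀) ∈ Metric.ball 0 ε by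
      rw [mem_ball_zero_iff]
      exact lt_of_pow_lt_pow_left₀ 2 hε.le hx)
    simpa using h3

/-- `w` is continuously differentiable on `[t₀, t₁] × U`, with derivative `w'`, solves the
evolution equation there, and vanishes at time `t₀`. -/
structure IsNullSolutionOn (P : ℝ × E → (E →L[ℝ] F) →L[ℝ] F) (B : ℝ × E → F →L[ℝ] F) (t₀ t₁ : ℝ)
    (U : Set E) (w : ℝ × E → F) (w' : ℝ × E → (ℝ × E) →L[ℝ] F) : Prop where
  hasFDerivWithinAt : ∀ z ∈ Icc t₀ t₁ ×ˢ U, HasFDerivWithinAt w (w' z) (Icc t₀ t₁ ×ˢ U) z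
  continuousOn : ContinuousOn w' (Icc t₀ t₁ ×ˢ U)
  initial : ∀ x ∈ U, w (t₀, x) = 0
  equation : ∀ z ∈ Icc t₀ t₁ ×ˢ U,
    w' z (1, 0) = P z ((w' z).comp (ContinuousLinearMap.inr ℝ ℝ E)) + B z (w z)

variable {P : ℝ × E → (E →L[ℝ] F) →L[ℝ] F} {B : ℝ × E → F →L[ℝ] F} {t₀ t₁ : ℝ} {U : Set E}
  {w : ℝ × E → F} {w' : ℝ × E → (ℝ × E) →L[ℝ] F}

/-- The space derivatives vanish with the initial value, and then the equation forces the time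
derivative to vanish. This is what makes the extension by zero to the past differentiable with
continuous derivative. -/
theorem IsNullSolutionOn.deriv_initial (h : IsNullSolutionOn P B t₀ t₁ U w w') (hU : IsOpen U)
    (ht : t₀ < t₁) {x : E} (hx : x ∈ U) : w' (t₀, x) = 0 := by
  have ht₀ : t₀ ∈ Icc t₀ t₁ := left_mem_Icc.2 ht.le
  have h1 : HasFDerivAt (fun x => w (t₀, x))
      ((w' (t₀, x)).comp (ContinuousLinearMap.inr ℝ ℝ E)) x := by
    have h2 : HasFDerivWithinAt (fun x => w (t₀, x)) _ U x :=
      (h.hasFDerivWithinAt (t₀, x) ⟨ht₀, hx⟩).comp x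
        (hasFDerivAt_prodMk_right t₀ x).hasFDerivWithinAt fun y hy => ⟨ht₀, hy⟩
    exact h2.hasFDerivAt (hU.mem_nhds hx)
  have h2 : HasFDerivAt (fun x => w (t₀, x)) (0 : E →L[ℝ] F) x :=
    (hasFDerivAt_const (0 : F) x).congr_of_eventuallyEq (by
      filter_upwards [hU.mem_nhds hx] with y hy using h.initial y hy)
  have h3 := h1.unique h2
  have h4 := h.equation (t₀, x) ⟨ht₀, hx⟩
  rw [h3, h.initial x hx, map_zero, map_zero, add_zero] at h4
  ext
  · simpa using h4
  · exact DFunLike.congr_fun h3 _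

/-- A null solution extends by zero to times before `t₀`. -/
theorem IsNullSolutionOn.hasFDerivAt_extension (h : IsNullSolutionOn P B t₀ t₁ U w w')
    (hU : IsOpen U) (ht : t₀ < t₁) {z : ℝ × E} (hz : z ∈ Iio t₁ ×ˢ U) :
    HasFDerivAt (fun z : ℝ × E => w (max z.1 t₀, z.2)) (w' (max z.1 t₀, z.2)) z := by
  obtain ⟨t, x⟩ := z
  have hx : x ∈ U := hz.2
  have ht1 : t < t₁ := hz.1
  rcases lt_or_ge t₀ t with h0 | h0
  · have hnhds : Ioo t₀ t₁ ×ˢ U ∈ 𝓝 (t, x) := (isOpen_Ioo.prod hU).mem_nhds ⟨⟨h0, ht1⟩, hx⟩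
    have h1 := (h.hasFDerivWithinAt (t, x) ⟨⟨h0.le, ht1.le⟩, hx⟩).hasFDerivAt
      (mem_of_superset hnhds (prod_mono Ioo_subset_Icc_self le_rfl))
    simp only [max_eq_left h0.le]
    refine h1.congr_of_eventuallyEq ?_
    filter_upwards [hnhds] with y hy
    rw [max_eq_left hy.1.1.le]
  · simp only [max_eq_right h0]
    rw [h.deriv_initial hU ht hx]
    have h1 := h.hasFDerivWithinAt (t₀, x) ⟨left_mem_Icc.2 ht.le, hx⟩
    rw [h.deriv_initial hU ht hx] at h1
    have h2 := h1.isLittleO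
    simp only [zero_apply, sub_zero] at h2
    set m : ℝ × E → ℝ × E := fun z => (max z.1 t₀, z.2) with hm
    have hmc : Continuous m := by fun_prop
    have hmz : m (t, x) = (t₀, x) := by simp [hm, h0]
    have htend : Tendsto m (𝓝 (t, x)) (𝓝[Icc t₀ t₁ ×ˢ U] (t₀, x)) := by
      refine tendsto_nhdsWithin_iff.2 ⟨hmz ▸ hmc.continuousAt.tendsto, ?_⟩
      filter_upwards [(isOpen_Iio.prod hU).mem_nhds hz] with y hy
      exact ⟨⟨le_max_right _ _, max_le hy.1.le ht.le⟩, hy.2⟩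
    have h3 := h2.comp_tendsto htend
    refine HasFDerivAt.of_isLittleO ?_
    simp only [zero_apply, sub_zero]
    -- Clamping the time at `t₀` does not increase distances, so the one-sided estimate at `(t₀, x)`
    -- transfers.
    have h4 : (fun z => w (m z) - w (t₀, x)) =o[𝓝 (t, x)] fun z => z - (t, x) := by
      refine h3.trans_isBigO (Asymptotics.isBigO_of_le _ fun y => ?_)
      simp only [Function.comp_apply]
      rw [← hmz, Prod.norm_def, Prod.norm_def]
      refine max_le_max ?_ le_rfl
      exact abs_max_sub_max_le_abs _ _ _
    simpa [hm, h0] using h4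

/-- **Holmgren's uniqueness theorem** for linear first order systems with analytic coefficients,
among continuously differentiable functions. -/
theorem exists_forall_eq_zero_of_isNullSolutionOn [FiniteDimensional ℝ E] [CompleteSpace F]
    {x₀ : E} (hP : AnalyticAt ℝ P (t₀, x₀)) (hB : AnalyticAt ℝ B (t₀, x₀))
    (hU : IsOpen U) (hx₀ : x₀ ∈ U) (ht : t₀ < t₁) :
    ∃ δ > 0, ∃ V : Set E, IsOpen V ∧ x₀ ∈ V ∧ V ⊆ U ∧
      ∀ w w', IsNullSolutionOn P B t₀ t₁ U w w' →
        ∀ t ∈ Icc t₀ (t₀ + δ), ∀ x ∈ V, w (t, x) = 0 := by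
  obtain ⟨ρ, hρa, hρ0, hρn, hρd, hρU⟩ := exists_analytic_bump_well x₀
  have hρc : Continuous ρ := continuous_iff_continuousAt.2 fun x => (hρa x).continuousAt
  -- In sheared time the extended solution vanishes where `t - t₀ < ρ x`, so at each time its
  -- support lies in a small sublevel set of `ρ`.
  set σ : ℝ × E → ℝ × E := fun z => (z.1 - ρ z.2, z.2) with hσ
  have hσ₀ : σ (t₀, x₀) = (t₀, x₀) := by simp [hσ, hρ0]
  have hσa : ∀ z, AnalyticAt ℝ σ z := fun z =>
    (analyticAt_fst.sub ((hρa z.2).comp_of_eq analyticAt_snd rfl)).prod analyticAt_snd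
  set σ' : ℝ × E → (ℝ × E) →L[ℝ] (ℝ × E) := fun z =>
    (ContinuousLinearMap.fst ℝ ℝ E - (fderiv ℝ ρ z.2).comp (ContinuousLinearMap.snd ℝ ℝ E)).prod
      (ContinuousLinearMap.snd ℝ ℝ E) with hσ'
  have hσd : ∀ z, HasFDerivAt σ (σ' z) z := fun z =>
    (((ContinuousLinearMap.fst ℝ ℝ E).hasFDerivAt).sub
      (((hρa z.2).differentiableAt.hasFDerivAt).comp z
        (ContinuousLinearMap.snd ℝ ℝ E).hasFDerivAt)).prodMk
      (ContinuousLinearMap.snd ℝ ℝ E).hasFDerivAt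
  have hσ'c : Continuous σ' := by
    have h1 : Continuous (fderiv ℝ ρ) :=
      continuous_iff_continuousAt.2 fun x => (hρa x).fderiv.continuousAt
    have h2 : Continuous fun z : ℝ × E => ContinuousLinearMap.fst ℝ ℝ E
        - (fderiv ℝ ρ z.2).comp (ContinuousLinearMap.snd ℝ ℝ E) :=
      continuous_const.sub ((h1.comp continuous_snd).clm_comp continuous_const)
    have h3 : σ' = fun z => (ContinuousLinearMap.inl ℝ ℝ E).comp (ContinuousLinearMap.fst ℝ ℝ E
        - (fderiv ℝ ρ z.2).comp (ContinuousLinearMap.snd ℝ ℝ E))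
        + (ContinuousLinearMap.inr ℝ ℝ E).comp (ContinuousLinearMap.snd ℝ ℝ E) := by
      funext z
      ext v <;> simp [hσ']
    rw [h3]
    exact (continuous_const.clm_comp h2).add continuous_const
  -- The shear adds a time derivative to the space derivatives, so the equation becomes `(1 - N) ∂_t
  -- W = P(∂_x W) + B W` with `P`, `B` taken at `σ z`. As `dρ` vanishes at `x₀`, the factor `1 - N`
  -- is invertible near `(t₀, x₀)`.
  set N : ℝ × E → F →L[ℝ] F := fun z =>
    (P (σ z)).comp (ContinuousLinearMap.smulRightL ℝ E F (fderiv ℝ ρ z.2)) with hN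
  have hPσ : AnalyticAt ℝ (fun z => P (σ z)) (t₀, x₀) := hP.comp_of_eq (hσa _) hσ₀
  have hBσ : AnalyticAt ℝ (fun z => B (σ z)) (t₀, x₀) := hB.comp_of_eq (hσa _) hσ₀
  have hNa : AnalyticAt ℝ N (t₀, x₀) :=
    hPσ.clm_comp (analyticAt_const.clm_apply ((hρa x₀).fderiv.comp_of_eq analyticAt_snd rfl))
  have hN0 : N (t₀, x₀) = 0 := by simp [hN, hρd]
  have h1N : AnalyticAt ℝ (fun z => 1 - N z) (t₀, x₀) := analyticAt_const.sub hNa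
  have hunit0 : IsUnit (1 - N (t₀, x₀)) := by simp [hN0]
  have hunit : ∀ᶠ z in 𝓝 (t₀, x₀), IsUnit (1 - N z) :=
    h1N.continuousAt.eventually (Units.isOpen.mem_nhds hunit0)
  set Q : ℝ × E → F →L[ℝ] F := fun z => Ring.inverse (1 - N z) with hQ
  have hQa : AnalyticAt ℝ Q (t₀, x₀) := by
    have h1 := analyticAt_inverse (𝕜 := ℝ) hunit0.unit
    rw [IsUnit.unit_spec] at h1
    exact AnalyticAt.comp_of_eq (f := fun z => 1 - N z) h1 h1N rfl
  obtain ⟨r₀, hr₀, hcore⟩ := exists_forall_eq_zero_of_solvesEvolutionAt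
    (hQa.clm_comp hPσ) (hQa.clm_comp hBσ)
  obtain ⟨r₁, hr₁, hunitr⟩ := Metric.eventually_nhds_iff_ball.1 hunit
  set r := min r₀ r₁ with hr
  have hrpos : 0 < r := by positivity
  obtain ⟨δ₀, hδ₀, hδcore⟩ := hcore r hrpos (min_le_left _ _)
  obtain ⟨ε₁, hε₁, hρε₁⟩ := hρU (U ∩ Metric.closedBall x₀ (r / 2))
    (inter_mem (hU.mem_nhds hx₀) (Metric.closedBall_mem_nhds x₀ (by positivity)))
  -- The bounds secure, in order: the uniqueness result for compact support, the invertibility of `1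
  -- - N`, the confinement of the support to `ρ < ε₁`, and sheared times below `t₁`.
  set δ := min (min δ₀ r₁) (min ε₁ (t₁ - t₀)) with hδ
  have hδpos : 0 < δ := by
    have : 0 < t₁ - t₀ := sub_pos.2 ht
    positivity
  have hδδ₀ : δ ≤ δ₀ := (min_le_left _ _).trans (min_le_left _ _)
  have hδr₁ : δ ≤ r₁ := (min_le_left _ _).trans (min_le_right _ _)
  have hδε₁ : δ ≤ ε₁ := (min_le_right _ _).trans (min_le_left _ _)
  have hδt₁ : δ ≤ t₁ - t₀ := (min_le_right _ _).trans (min_le_right _ _)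
  -- The value `w(t, x)` is `W(t + ρ x, x)`, and `t + ρ x < t₀ + δ/4 + δ/2 + δ/4` keeps the sheared
  -- time inside the interval.
  refine ⟨δ / 4, by positivity, {x | ρ x < δ / 2}, isOpen_lt hρc continuous_const,
    by simp [hρ0, hδpos], fun x hx => (hρε₁ x (by
      have : ρ x < δ / 2 := hx
      linarith)).1, fun w w' h => ?_⟩
  classical
  set m : ℝ × E → ℝ × E := fun z => (max z.1 t₀, z.2) with hm
  have hmc : Continuous m := by fun_prop
  set W : ℝ × E → F := fun z => if ρ z.2 < ε₁ then w (m (σ z)) else 0 with hW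
  have hWzero : ∀ z : ℝ × E, z.1 - t₀ < ρ z.2 → W z = 0 := by
    intro z hz
    by_cases hzε : ρ z.2 < ε₁
    · have h1 : z.1 - ρ z.2 ≤ t₀ := by linarith
      simp only [hW, hzε, if_true, hm, hσ, max_eq_right h1]
      exact h.initial _ (hρε₁ _ hzε).1
    · simp [hW, hzε]
  have hWder : ∀ z ∈ Ioo (t₀ - δ) (t₀ + δ) ×ˢ (univ : Set E), ρ z.2 < ε₁ →
      HasFDerivAt W ((w' (m (σ z))).comp (σ' z)) z := by
    intro z hz hzε
    have h1 : σ z ∈ Iio t₁ ×ˢ U := by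
      refine ⟨?_, (hρε₁ _ hzε).1⟩
      have := hz.1.2
      have := hρn z.2
      simp only [hσ, mem_Iio]
      linarith
    have h2 := (h.hasFDerivAt_extension hU ht h1).comp z (hσd z)
    refine h2.congr_of_eventuallyEq ?_
    filter_upwards [(isOpen_lt (hρc.comp continuous_snd) continuous_const).mem_nhds hzε] with y hy
    have hy' : ρ y.2 < ε₁ := hy
    simp only [hW, hy', if_true]
    rfl
  have hWev : ∀ z ∈ Ioo (t₀ - δ) (t₀ + δ) ×ˢ (univ : Set E), ¬ ρ z.2 < ε₁ →
      W =ᶠ[𝓝 z] fun _ => 0 := by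
    intro z hz hzε
    have h1 : z.1 - t₀ < ρ z.2 := by
      have := hz.1.2
      linarith
    filter_upwards [(isOpen_lt (f := fun z : ℝ × E => z.1 - t₀) (g := fun z : ℝ × E => ρ z.2)
      (by fun_prop) (by fun_prop)).mem_nhds h1] with y hy using hWzero y hy
  have hmS : ∀ z ∈ Ioo (t₀ - δ) (t₀ + δ) ×ˢ (univ : Set E), ρ z.2 < ε₁ →
      m (σ z) ∈ Icc t₀ t₁ ×ˢ U := by
    intro z hz hzε
    refine ⟨⟨le_max_right _ _, max_le ?_ ht.le⟩, (hρε₁ _ hzε).1⟩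
    have := hz.1.2
    have := hρn z.2
    simp only [hσ]
    linarith
  have hopen : IsOpen (Ioo (t₀ - δ) (t₀ + δ) ×ˢ (univ : Set E)) := isOpen_Ioo.prod isOpen_univ
  have hWall := hδcore δ hδpos hδδ₀ W ?_ ?_ ?_ ?_ ?_
  · intro t htt x hx
    have hxδ : ρ x < δ / 2 := hx
    have h1 := hWall (t + ρ x) ⟨by linarith [htt.1, hρn x], by linarith [htt.2]⟩ x
    have h2 : ρ x < ε₁ := by linarith
    simp only [hW, h2, if_true, hm, hσ, add_sub_cancel_right, max_eq_left htt.1] at h1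
    exact h1
  · intro z hz
    by_cases hzε : ρ z.2 < ε₁
    · exact (hWder z hz hzε).differentiableAt
    · exact (differentiableAt_const (0 : F)).congr_of_eventuallyEq (hWev z hz hzε)
  · intro z hz
    refine ContinuousAt.continuousWithinAt ?_
    by_cases hzε : ρ z.2 < ε₁
    · have hnear : ∀ᶠ y in 𝓝 z, y ∈ Ioo (t₀ - δ) (t₀ + δ) ×ˢ (univ : Set E) ∧ ρ y.2 < ε₁ :=
        Filter.Eventually.and (hopen.mem_nhds hz)
          ((isOpen_lt (hρc.comp continuous_snd) continuous_const).mem_nhds hzε)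
      have h1 : fderiv ℝ W =ᶠ[𝓝 z] fun y => (w' (m (σ y))).comp (σ' y) := by
        filter_upwards [hnear] with y hy using (hWder y hy.1 hy.2).fderiv
      refine ContinuousAt.congr ?_ h1.symm
      refine ContinuousAt.clm_comp ?_ hσ'c.continuousAt
      have hσc : Continuous σ := continuous_iff_continuousAt.2 fun z => (hσa z).continuousAt
      have h2 : Tendsto (fun y => m (σ y)) (𝓝 z) (𝓝[Icc t₀ t₁ ×ˢ U] (m (σ z))) := by
        refine tendsto_nhdsWithin_iff.2 ⟨(hmc.comp hσc).continuousAt, ?_⟩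
        filter_upwards [hnear] with y hy using hmS y hy.1 hy.2
      exact (h.continuousOn _ (hmS z hz hzε)).tendsto.comp h2
    · have h1 : fderiv ℝ W =ᶠ[𝓝 z] fun _ => 0 := by
        filter_upwards [(hWev z hz hzε).eventuallyEq_nhds] with y hy
        rw [hy.fderiv_eq]; simp
      exact continuousAt_const.congr h1.symm
  · intro s hs x hx
    refine hWzero (s, x) ?_
    have h1 : ¬ ρ x < ε₁ := fun h1 => hx (hρε₁ x h1).2
    have := hs.2
    simp only
    linarith
  · intro x
    by_cases hx : ρ x = 0
    · by_cases hxε : ρ x < ε₁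
      · simp only [hW, hm, hσ, hx, sub_zero, max_self]
        rw [if_pos hε₁]
        exact h.initial _ (hρε₁ _ hxε).1
      · simp [hW, hxε]
    · refine hWzero (t₀, x) ?_
      have := lt_of_le_of_ne (hρn x) (Ne.symm hx)
      simpa using this
  · intro z hz
    have hz' : z ∈ Ioo (t₀ - δ) (t₀ + δ) ×ˢ (univ : Set E) := ⟨hz.1, mem_univ _⟩
    rw [SolvesEvolutionAt]
    by_cases hzε : ρ z.2 < ε₁
    · rw [(hWder z hz' hzε).fderiv]
      have hu : IsUnit (1 - N z) := by
        refine hunitr z ?_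
        rw [← ball_prod_same, Real.ball_eq_Ioo]
        exact ⟨Ioo_subset_Ioo (by linarith) (by linarith) hz.1,
          Metric.ball_subset_ball (min_le_right _ _) hz.2⟩
      have hWz : W z = w (m (σ z)) := by simp [hW, hzε]
      set D := w' (m (σ z)) with hD
      -- For sheared times before `t₀` the coefficients at `σ z` and at the clamped point differ,
      -- but there the solution and its derivative both vanish.
      have heq : D (1, 0) = P (σ z) (D.comp (ContinuousLinearMap.inr ℝ ℝ E))
          + B (σ z) (w (m (σ z))) := by
        rcases le_total t₀ (σ z).1 with h0 | h0
        · have h1 : m (σ z) = σ z := by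
            ext1
            · exact max_eq_left h0
            · rfl
          have h2 := h.equation _ (hmS z hz' hzε)
          rw [← hD] at h2
          rw [h2, h1]
        · have h1 : m (σ z) = (t₀, z.2) := by
            ext1
            · exact max_eq_right h0
            · rfl
          have h2 : D = 0 := by rw [hD, h1]; exact h.deriv_initial hU ht (hρε₁ _ hzε).1
          have h3 : w (m (σ z)) = 0 := by rw [h1]; exact h.initial _ (hρε₁ _ hzε).1
          rw [h2, h3]; simp
      have e1 : D.comp (σ' z) (1, 0) = D (1, 0) := by simp [hσ']
      have e2 : (D.comp (σ' z)).comp (ContinuousLinearMap.inr ℝ ℝ E)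
          = D.comp (ContinuousLinearMap.inr ℝ ℝ E)
            - ContinuousLinearMap.smulRightL ℝ E F (fderiv ℝ ρ z.2) (D (1, 0)) := by
        ext v
        have : ((-(fderiv ℝ ρ z.2 v), v) : ℝ × E)
            = (0, v) - (fderiv ℝ ρ z.2 v) • ((1, 0) : ℝ × E) := by simp
        simp only [hσ', ContinuousLinearMap.comp_apply, ContinuousLinearMap.inr_apply,
          ContinuousLinearMap.prod_apply, sub_apply, ContinuousLinearMap.coe_fst',
          ContinuousLinearMap.coe_snd', zero_sub, this, map_sub, map_smul]
        rfl
      have e3 : (1 - N z) (D (1, 0)) = P (σ z) ((D.comp (σ' z)).comp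
          (ContinuousLinearMap.inr ℝ ℝ E)) + B (σ z) (W z) := by
        rw [e2, map_sub, hWz, sub_apply]
        change D (1, 0) - N z (D (1, 0)) = _
        rw [sub_add_eq_add_sub, ← heq]
        rfl
      rw [e1]
      change _ = Q z (P (σ z) _) + Q z (B (σ z) (W z))
      rw [← map_add, ← e3]
      have e4 : Q z * (1 - N z) = 1 := Ring.inverse_mul_cancel _ hu
      exact (congrArg (fun L : F →L[ℝ] F => L (D (1, 0))) e4).symm
    · have h1 := hWev z hz' hzε
      rw [h1.fderiv_eq, h1.eq_of_nhds]
      simp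

end Holmgren

/-! ### Pull-backs of tensors and naturality of the Lie derivative. -/

section TensorCalculus

set_option maxSynthPendingDepth 3

namespace CTensor

variable {p q : ℕ} {E : Type*} [NormedAddCommGroup E] [NormedSpace ℝ E]

/-- The operators `α ↦ ((ω, v) ↦ α(ω₁ ∘ k₁, …, ω_p ∘ k_p, v))`, multilinear in `k`. -/
def covMap (p q : ℕ) (E : Type*) [NormedAddCommGroup E] [NormedSpace ℝ E] :
    ContinuousMultilinearMap ℝ (fun _ : Fin p => E →L[ℝ] E) (CTensor p q E →L[ℝ] CTensor p q E) :=
  (ContinuousMultilinearMap.compContinuousLinearMapContinuousMultilinear ℝ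
    (fun _ : Fin p => E →L[ℝ] ℝ) (fun _ : Fin p => E →L[ℝ] ℝ)
    (ContinuousMultilinearMap ℝ (fun _ : Fin q => E) ℂ)).compContinuousLinearMap
    fun _ => (ContinuousLinearMap.compL ℝ E E ℝ).flip

/-- The operators `α ↦ ((ω, v) ↦ α(ω, j₁ v₁, …, j_q v_q))`, multilinear in `j`. -/
def vecMap (p q : ℕ) (E : Type*) [NormedAddCommGroup E] [NormedSpace ℝ E] :
    ContinuousMultilinearMap ℝ (fun _ : Fin q => E →L[ℝ] E) (CTensor p q E →L[ℝ] CTensor p q E) :=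
  (ContinuousLinearMap.compContinuousMultilinearMapL ℝ (fun _ : Fin p => E →L[ℝ] ℝ)
    (ContinuousMultilinearMap ℝ (fun _ : Fin q => E) ℂ)
    (ContinuousMultilinearMap ℝ (fun _ : Fin q => E) ℂ)).compContinuousMultilinearMap
    (ContinuousMultilinearMap.compContinuousLinearMapContinuousMultilinear ℝ
      (fun _ : Fin q => E) (fun _ : Fin q => E) ℂ)

theorem covMap_apply (k : Fin p → E →L[ℝ] E) (α : CTensor p q E) (η : Fin p → E →L[ℝ] ℝ)
    (v : Fin q → E) : covMap p q E k α η v = α (fun i => (η i).comp (k i)) v := rfl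

theorem ext' {α β : CTensor p q E} (h : ∀ η v, α η v = β η v) : α = β :=
  ContinuousMultilinearMap.ext fun η => ContinuousMultilinearMap.ext fun v => h η v

theorem pullback_eq (J : E →L[ℝ] E) (α : CTensor p q E) :
    pullback J α = covMap p q E (fun _ => J.inverse) (vecMap p q E (fun _ => J) α) := rfl

theorem covMap_comp (k k' : Fin p → E →L[ℝ] E) (α : CTensor p q E) :
    covMap p q E k (covMap p q E k' α) = covMap p q E (fun i => (k i).comp (k' i)) α := rfl

theorem vecMap_comp (j j' : Fin q → E →L[ℝ] E) (α : CTensor p q E) :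
    vecMap p q E j (vecMap p q E j' α) = vecMap p q E (fun i => (j' i).comp (j i)) α := rfl

theorem covMap_vecMap (k : Fin p → E →L[ℝ] E) (j : Fin q → E →L[ℝ] E) (α : CTensor p q E) :
    covMap p q E k (vecMap p q E j α) = vecMap p q E j (covMap p q E k α) := rfl

theorem actCovector_eq (L : E →L[ℝ] E) (i : Fin p) (α : CTensor p q E) :
    actCovector L i α
      = covMap p q E (Function.update (fun _ => ContinuousLinearMap.id ℝ E) i L) α := by
  refine ext' fun η v => ?_
  rw [covMap_apply]
  change α _ v = _
  congr 2
  funext l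
  rcases eq_or_ne l i with rfl | h
  · simp
  · simp [h]

theorem actVector_eq (L : E →L[ℝ] E) (i : Fin q) (α : CTensor p q E) :
    actVector L i α
      = vecMap p q E (Function.update (fun _ => ContinuousLinearMap.id ℝ E) i L) α := rfl

/-- The zeroth order part of the Lie derivative along a vector field with differential `D`. -/
def lieZeroth (p q : ℕ) (D : E →L[ℝ] E) : CTensor p q E →L[ℝ] CTensor p q E :=
  ∑ j, vecMap p q E (Function.update (fun _ => ContinuousLinearMap.id ℝ E) j D)
    - ∑ i, covMap p q E (Function.update (fun _ => ContinuousLinearMap.id ℝ E) i D)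

theorem lieFlat_eq (X : E → E) (A : E → CTensor p q E) (y : E) :
    lieFlat X A y = fderiv ℝ A y (X y) + lieZeroth p q (fderiv ℝ X y) (A y) := by
  simp only [lieFlat, lieZeroth, actCovector_eq, actVector_eq, sub_apply, sum_apply]
  abel

variable {H : Type*} [NormedAddCommGroup H] [NormedSpace ℝ H]

theorem _root_.AnalyticAt.lieZeroth {D : H → E →L[ℝ] E} {z : H} (hD : AnalyticAt ℝ D z) :
    AnalyticAt ℝ (fun z => lieZeroth p q (D z)) z := by
  refine AnalyticAt.sub ?_ ?_
  · exact Finset.analyticAt_fun_sum _ fun j _ => analyticAt_const.clm_apply hD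
      (f := fun _ => (vecMap p q E).toContinuousLinearMap
        (fun _ => ContinuousLinearMap.id ℝ E) j)
  · exact Finset.analyticAt_fun_sum _ fun j _ => analyticAt_const.clm_apply hD
      (f := fun _ => (covMap p q E).toContinuousLinearMap
        (fun _ => ContinuousLinearMap.id ℝ E) j)

theorem _root_.AnalyticAt.clm_inverse [CompleteSpace E] {J : H → E →L[ℝ] E} {z : H}
    (hJ : AnalyticAt ℝ J z) (hi : (J z).IsInvertible) :
    AnalyticAt ℝ (fun z => (J z).inverse) z := by
  rw [← ContinuousLinearMap.ringInverse_eq_inverse]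
  have hu : IsUnit (J z) := by
    obtain ⟨e, he⟩ := hi
    exact ⟨ContinuousLinearEquiv.toUnit e, he⟩
  have h1 := analyticAt_inverse (𝕜 := ℝ) hu.unit
  rw [IsUnit.unit_spec] at h1
  exact AnalyticAt.comp_of_eq h1 hJ rfl

theorem _root_.AnalyticAt.pullback [CompleteSpace E] {J : H → E →L[ℝ] E} {A : H → CTensor p q E}
    {z : H} (hJ : AnalyticAt ℝ J z) (hi : (J z).IsInvertible) (hA : AnalyticAt ℝ A z) :
    AnalyticAt ℝ (fun z => pullback (J z) (A z)) z := by
  simp only [pullback_eq]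
  have h1 : AnalyticAt ℝ (fun z => covMap p q E fun _ => (J z).inverse) z :=
    (covMap p q E).analyticAt.comp_of_eq (AnalyticAt.pi fun _ => hJ.clm_inverse hi) rfl
  have h2 : AnalyticAt ℝ (fun z => vecMap p q E fun _ => J z) z :=
    (vecMap p q E).analyticAt.comp_of_eq (AnalyticAt.pi fun _ => hJ) rfl
  exact h1.clm_apply (h2.clm_apply hA)

theorem covMap_update_comp (D : E →L[ℝ] E) (i : Fin p) (k : E →L[ℝ] E) (α : CTensor p q E) :
    covMap p q E (Function.update (fun _ => ContinuousLinearMap.id ℝ E) i D)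
        (covMap p q E (fun _ => k) α)
      = covMap p q E (Function.update (fun _ => k) i (D.comp k)) α := by
  rw [covMap_comp]
  congr 2
  funext l
  rcases eq_or_ne l i with rfl | h
  · simp
  · simp [h]

theorem covMap_comp_update (D : E →L[ℝ] E) (i : Fin p) (k : E →L[ℝ] E) (α : CTensor p q E) :
    covMap p q E (fun _ => k)
        (covMap p q E (Function.update (fun _ => ContinuousLinearMap.id ℝ E) i D) α)
      = covMap p q E (Function.update (fun _ => k) i (k.comp D)) α := by
  rw [covMap_comp]
  congr 2
  funext l
  rcases eq_or_ne l i with rfl | h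
  · simp
  · simp [h]

theorem vecMap_update_comp (D : E →L[ℝ] E) (i : Fin q) (k : E →L[ℝ] E) (α : CTensor p q E) :
    vecMap p q E (Function.update (fun _ => ContinuousLinearMap.id ℝ E) i D)
        (vecMap p q E (fun _ => k) α)
      = vecMap p q E (Function.update (fun _ => k) i (k.comp D)) α := by
  rw [vecMap_comp]
  congr 2
  funext l
  rcases eq_or_ne l i with rfl | h
  · simp
  · simp [h]

theorem vecMap_comp_update (D : E →L[ℝ] E) (i : Fin q) (k : E →L[ℝ] E) (α : CTensor p q E) :
    vecMap p q E (fun _ => k)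
        (vecMap p q E (Function.update (fun _ => ContinuousLinearMap.id ℝ E) i D) α)
      = vecMap p q E (Function.update (fun _ => k) i (D.comp k)) α := by
  rw [vecMap_comp]
  congr 2
  funext l
  rcases eq_or_ne l i with rfl | h
  · simp
  · simp [h]

theorem _root_.HasFDerivAt.clm_inverse [CompleteSpace E] {J : H → E →L[ℝ] E} {z : H}
    {J' : H →L[ℝ] E →L[ℝ] E} (hJ : HasFDerivAt J J' z) (hi : (J z).IsInvertible) :
    HasFDerivAt (fun z => (J z).inverse)
      ((-ContinuousLinearMap.mulLeftRight ℝ (E →L[ℝ] E) (J z).inverse (J z).inverse).comp J') z := by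
  rw [← ContinuousLinearMap.ringInverse_eq_inverse]
  have hu : IsUnit (J z) := by
    obtain ⟨e, he⟩ := hi
    exact ⟨ContinuousLinearEquiv.toUnit e, he⟩
  have h1 := hasFDerivAt_ringInverse (𝕜 := ℝ) hu.unit
  rw [IsUnit.unit_spec, ← Ring.inverse_unit, IsUnit.unit_spec] at h1
  exact h1.comp z hJ

/-- The derivative of a pulled-back tensor. -/
theorem hasFDerivAt_pullback [CompleteSpace E] {J : H → E →L[ℝ] E} {A : H → CTensor p q E} {z : H}
    {J' : H →L[ℝ] E →L[ℝ] E} {A' : H →L[ℝ] CTensor p q E}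
    (hJ : HasFDerivAt J J' z) (hi : (J z).IsInvertible) (hA : HasFDerivAt A A' z) :
    ∃ G : H →L[ℝ] CTensor p q E, HasFDerivAt (fun z => pullback (J z) (A z)) G z ∧
      ∀ v, G v = pullback (J z) (A' v)
        + covMap p q E (fun _ => (J z).inverse)
          (∑ j, vecMap p q E (Function.update (fun _ => J z) j (J' v)) (A z))
        - ∑ i, covMap p q E (Function.update (fun _ => (J z).inverse) i
          ((J z).inverse.comp ((J' v).comp (J z).inverse)))
          (vecMap p q E (fun _ => J z) (A z)) := by
  have hK := hJ.clm_inverse hi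
  have hC := ((covMap p q E).hasFDerivAt fun _ => (J z).inverse).comp z
    (hasFDerivAt_pi.2 fun _ : Fin p => hK)
  have hV := ((vecMap p q E).hasFDerivAt fun _ => J z).comp z
    (hasFDerivAt_pi.2 fun _ : Fin q => hJ)
  refine ⟨_, hC.clm_apply (hV.clm_apply hA), fun v => ?_⟩
  have hneg : ∀ i, (covMap p q E) (Function.update (fun _ => (J z).inverse) i
      (-((J z).inverse * J' v * (J z).inverse)))
      = -(covMap p q E) (Function.update (fun _ => (J z).inverse) i
        ((J z).inverse.comp ((J' v).comp (J z).inverse))) := fun i => by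
    exact (covMap p q E).toMultilinearMap.map_update_neg _ _ _
  have e1 : ((covMap p q E).linearDeriv (fun _ => (J z).inverse)
      (ContinuousLinearMap.pi (fun _ : Fin p =>
        (-ContinuousLinearMap.mulLeftRight ℝ (E →L[ℝ] E) (J z).inverse (J z).inverse).comp J') v))
      = -∑ i, (covMap p q E) (Function.update (fun _ => (J z).inverse) i
        ((J z).inverse.comp ((J' v).comp (J z).inverse))) := by
    rw [ContinuousMultilinearMap.linearDeriv_apply, ← Finset.sum_neg_distrib]
    exact Finset.sum_congr rfl fun i _ => hneg i
  have e2 : ((vecMap p q E).linearDeriv (fun _ => J z)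
      (ContinuousLinearMap.pi (fun _ : Fin q => J') v))
      = ∑ j, (vecMap p q E) (Function.update (fun _ => J z) j (J' v)) := by
    rw [ContinuousMultilinearMap.linearDeriv_apply]
    rfl
  change (covMap p q E fun _ => (J z).inverse) ((vecMap p q E fun _ => J z) (A' v)
    + ((vecMap p q E).linearDeriv (fun _ => J z)
      (ContinuousLinearMap.pi (fun _ : Fin q => J') v)) (A z))
    + ((covMap p q E).linearDeriv (fun _ => (J z).inverse)
      (ContinuousLinearMap.pi (fun _ : Fin p =>
        (-ContinuousLinearMap.mulLeftRight ℝ (E →L[ℝ] E) (J z).inverse (J z).inverse).comp J') v))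
      ((vecMap p q E fun _ => J z) (A z)) = _
  rw [e1, e2, pullback_eq, map_add, neg_apply, sum_apply, sum_apply, ← sub_eq_add_neg]

/-- The Lie derivative commutes with changes of coordinates. -/
theorem lieFlat_pullback [CompleteSpace E] {τ : E → E} {X : E → E} {A : E → CTensor p q E} {y : E}
    (hτ : AnalyticAt ℝ τ y) (hi : (fderiv ℝ τ y).IsInvertible)
    (hX : DifferentiableAt ℝ X (τ y)) (hA : DifferentiableAt ℝ A (τ y)) :
    lieFlat (fun z => (fderiv ℝ τ z).inverse (X (τ z)))
        (fun z => pullback (fderiv ℝ τ z) (A (τ z))) y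
      = pullback (fderiv ℝ τ y) (lieFlat X A (τ y)) := by
  have hJ : HasFDerivAt (fderiv ℝ τ) (fderiv ℝ (fderiv ℝ τ) y) y :=
    hτ.fderiv.differentiableAt.hasFDerivAt
  have hτ' : HasFDerivAt τ (fderiv ℝ τ y) y := hτ.differentiableAt.hasFDerivAt
  -- Second derivatives of `τ` arise both from differentiating the pulled-back tensor and from
  -- differentiating the pulled-back vector field. Symmetry identifies the two as the same operator
  -- `N`.
  have hsym : IsSymmSndFDerivAt ℝ τ y := hτ.contDiffAt.isSymmSndFDerivAt_of_omega
  set J := fderiv ℝ τ y with hJdef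
  set J₂ := fderiv ℝ (fderiv ℝ τ) y with hJ₂
  have hXτ : HasFDerivAt (fun z => X (τ z)) ((fderiv ℝ X (τ y)).comp J) y :=
    hX.hasFDerivAt.comp y hτ'
  have hAτ : HasFDerivAt (fun z => A (τ z)) ((fderiv ℝ A (τ y)).comp J) y :=
    hA.hasFDerivAt.comp y hτ'
  set D := fderiv ℝ X (τ y) with hD
  obtain ⟨G, hG, hGv⟩ := hasFDerivAt_pullback hJ hi hAτ
  have hK := hJ.clm_inverse hi
  rw [← hJdef] at hK
  have hX' := hK.clm_apply hXτ
  set Y := J.inverse (X (τ y)) with hY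
  have hJY : J Y = X (τ y) := hi.self_apply_inverse _
  set N := J₂ Y with hN
  have hD' : fderiv ℝ (fun z => (fderiv ℝ τ z).inverse (X (τ z))) y
      = J.inverse.comp (D.comp J) - J.inverse.comp N := by
    rw [hX'.fderiv]
    ext v
    have : J₂ v Y = N v := hsym v Y
    simp [ContinuousLinearMap.mulLeftRight_apply, ← hJdef, ← hY, this]
    abel
  have hJD : J.comp (J.inverse.comp (D.comp J) - J.inverse.comp N) = D.comp J - N := by
    ext v
    simp [hi.self_apply_inverse]
  have hDJ : (J.inverse.comp (D.comp J) - J.inverse.comp N).comp J.inverse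
      = J.inverse.comp D - J.inverse.comp (N.comp J.inverse) := by
    ext v
    simp [hi.self_apply_inverse]
  rw [lieFlat_eq, lieFlat_eq, hG.fderiv, hD', hGv, ← hJdef, ← hY, ← hN]
  simp only [pullback_eq, lieZeroth, map_add, map_sub, map_sum, sub_apply, sum_apply,
    ContinuousLinearMap.comp_apply, hJY, ← hD]
  simp only [covMap_update_comp, ← covMap_vecMap, vecMap_update_comp, vecMap_comp_update,
    hJD, hDJ]
  simp only [covMap_vecMap, covMap_comp_update]
  -- Each vector slot now carries `N` and each covector slot carries `J⁻¹ N J⁻¹`, once with either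
  -- sign, so these terms cancel.
  simp only [ContinuousMultilinearMap.map_update_sub, sub_apply, Finset.sum_sub_distrib, map_sub]
  abel

end CTensor

end TensorCalculus

/-! ### Change of charts for tensors, vector fields and Lie derivatives. -/

section Charts

set_option maxSynthPendingDepth 3

open Filter Topology

namespace CTensor

variable {p q : ℕ} {E : Type*} [NormedAddCommGroup E] [NormedSpace ℝ E]

theorem pullback_add (J : E →L[ℝ] E) (α β : CTensor p q E) :
    pullback J (α + β) = pullback J α + pullback J β := by
  simp only [pullback_eq, map_add]

theorem pullback_I_smul (J : E →L[ℝ] E) (α : CTensor p q E) :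
    pullback J (Complex.I • α) = Complex.I • pullback J α := rfl

theorem pullback_comp {A B : E →L[ℝ] E} (hA : A.IsInvertible) (α : CTensor p q E) :
    pullback (B.comp A) α = pullback A (pullback B α) := by
  have h : (B.comp A).inverse = A.inverse.comp B.inverse := by
    obtain ⟨A, rfl⟩ := hA
    simp
  simp only [pullback_eq, covMap_vecMap, covMap_comp, vecMap_comp, h]

theorem pullback_id (α : CTensor p q E) : pullback (ContinuousLinearMap.id ℝ E) α = α := by
  rw [pullback_eq, ContinuousLinearMap.inverse_id]
  rfl

/-- The pull-back as a continuous linear map. -/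
def pullbackL (p q : ℕ) (J : E →L[ℝ] E) : CTensor p q E →L[ℝ] CTensor p q E :=
  (covMap p q E fun _ => J.inverse).comp (vecMap p q E fun _ => J)

theorem pullbackL_apply (J : E →L[ℝ] E) (α : CTensor p q E) :
    pullbackL p q J α = pullback J α := rfl

theorem lieFlat_congr {X X' : E → E} {A A' : E → CTensor p q E} {y : E} (hX : X =ᶠ[𝓝 y] X')
    (hA : A =ᶠ[𝓝 y] A') : lieFlat X A y = lieFlat X' A' y := by
  simp only [lieFlat_eq, hX.fderiv_eq, hA.fderiv_eq, hX.eq_of_nhds, hA.eq_of_nhds]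

end CTensor

variable {p q : ℕ} {E : Type*} [NormedAddCommGroup E] [NormedSpace ℝ E]
  {M : Type*} [TopologicalSpace M] [ChartedSpace E M]

/-- The differential at `x` of the chart at `c`. -/
def chartDeriv (c x : M) : E →L[ℝ] E :=
  mfderiv 𝓘(ℝ, E) 𝓘(ℝ, E) (extChartAt 𝓘(ℝ, E) c) x

/-- The differential at `y` of the inverse of the chart at `c`. -/
def chartSymmDeriv (c : M) (y : E) : E →L[ℝ] E :=
  mfderiv 𝓘(ℝ, E) 𝓘(ℝ, E) (extChartAt 𝓘(ℝ, E) c).symm y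

theorem tensorInChart_eq (c : M) (α : M → CTensor p q E) (y : E) :
    tensorInChart (M := M) c α y
      = CTensor.pullback (chartSymmDeriv c y) (α ((extChartAt 𝓘(ℝ, E) c).symm y)) := rfl

theorem vectorInChart_eq (c : M) (X : M → E) (y : E) :
    vectorInChart (M := M) c X y
      = (chartSymmDeriv c y).inverse (X ((extChartAt 𝓘(ℝ, E) c).symm y)) := rfl

theorem realLieDerivative_eq (X : M → E) (α : M → CTensor p q E) (x : M) :
    realLieDerivative (M := M) X α x = CTensor.pullback (chartDeriv x x)
      (CTensor.lieFlat (E := E) (vectorInChart x X) (tensorInChart x α)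
        (extChartAt 𝓘(ℝ, E) x x)) := rfl

theorem isOpen_chartPart (c : M) {U : Set M} (hU : IsOpen U) : IsOpen (chartPart E c U) :=
  (continuousOn_extChartAt_symm c).isOpen_inter_preimage (isOpen_extChartAt_target c) hU

theorem chartPart_mono (c : M) {U V : Set M} (h : U ⊆ V) : chartPart E c U ⊆ chartPart E c V :=
  inter_subset_inter_right _ (preimage_mono h)

theorem mem_chartPart {c x : M} {U : Set M} (hx : x ∈ (extChartAt 𝓘(ℝ, E) c).source) (hU : x ∈ U) :
    extChartAt 𝓘(ℝ, E) c x ∈ chartPart E c U :=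
  ⟨(extChartAt 𝓘(ℝ, E) c).map_source hx, by
    simpa only [mem_preimage, (extChartAt 𝓘(ℝ, E) c).left_inv hx] using hU⟩

variable [IsManifold 𝓘(ℝ, E) ω M]

theorem chartSymmDeriv_comp_chartDeriv {c x : M} (hx : x ∈ (extChartAt 𝓘(ℝ, E) c).source) :
    (chartSymmDeriv c (extChartAt 𝓘(ℝ, E) c x)).comp (chartDeriv c x)
      = ContinuousLinearMap.id ℝ E := by
  have : IsManifold 𝓘(ℝ, E) 1 M := IsManifold.of_le (n := ω) le_top
  have h := mfderivWithin_extChartAt_symm_comp_mfderiv_extChartAt' hx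
  rw [ModelWithCorners.range_eq_univ, mfderivWithin_univ] at h
  exact h

theorem chartDeriv_comp_chartSymmDeriv {c x : M} (hx : x ∈ (extChartAt 𝓘(ℝ, E) c).source) :
    (chartDeriv c x).comp (chartSymmDeriv c (extChartAt 𝓘(ℝ, E) c x))
      = ContinuousLinearMap.id ℝ E := by
  have : IsManifold 𝓘(ℝ, E) 1 M := IsManifold.of_le (n := ω) le_top
  have h := mfderiv_extChartAt_comp_mfderivWithin_extChartAt_symm' hx
  rw [ModelWithCorners.range_eq_univ, mfderivWithin_univ] at h
  exact h

theorem isInvertible_chartDeriv {c x : M} (hx : x ∈ (extChartAt 𝓘(ℝ, E) c).source) :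
    (chartDeriv (E := E) c x).IsInvertible :=
  .of_inverse (chartDeriv_comp_chartSymmDeriv hx) (chartSymmDeriv_comp_chartDeriv hx)

theorem isInvertible_chartSymmDeriv {c x : M} (hx : x ∈ (extChartAt 𝓘(ℝ, E) c).source) :
    (chartSymmDeriv c (extChartAt 𝓘(ℝ, E) c x)).IsInvertible :=
  .of_inverse (chartSymmDeriv_comp_chartDeriv hx) (chartDeriv_comp_chartSymmDeriv hx)

/-- The value of a tensor field is recovered from its expression in a chart. -/
theorem pullback_tensorInChart {c x : M} (hx : x ∈ (extChartAt 𝓘(ℝ, E) c).source)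
    (α : M → CTensor p q E) :
    CTensor.pullback (chartDeriv c x) (tensorInChart (M := M) c α (extChartAt 𝓘(ℝ, E) c x)) = α x := by
  rw [tensorInChart_eq, ← CTensor.pullback_comp (isInvertible_chartDeriv hx),
    chartSymmDeriv_comp_chartDeriv hx, CTensor.pullback_id,
    (extChartAt 𝓘(ℝ, E) c).left_inv hx]

/-- The coordinate change from the chart at `c` to the chart at `c'`. -/
def transition (E : Type*) [NormedAddCommGroup E] [NormedSpace ℝ E]
    {M : Type*} [TopologicalSpace M] [ChartedSpace E M] (c c' : M) (y : E) : E :=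
  extChartAt 𝓘(ℝ, E) c' ((extChartAt 𝓘(ℝ, E) c).symm y)

theorem analyticAt_transition [CompleteSpace E] {c c' : M} {y : E}
    (hy : y ∈ chartPart E c (extChartAt 𝓘(ℝ, E) c').source) :
    AnalyticAt ℝ (transition E c c') y := by
  have h1 : ContMDiffAt 𝓘(ℝ, E) 𝓘(ℝ, E) ω (extChartAt 𝓘(ℝ, E) c).symm y :=
    (contMDiffOn_extChartAt_symm c).contMDiffAt ((isOpen_extChartAt_target c).mem_nhds hy.1)
  have h2 : ContMDiffAt 𝓘(ℝ, E) 𝓘(ℝ, E) ω (extChartAt 𝓘(ℝ, E) c')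
      ((extChartAt 𝓘(ℝ, E) c).symm y) :=
    contMDiffAt_extChartAt' (by simpa using hy.2)
  exact ((h2.comp y h1).contDiffAt).analyticAt

theorem fderiv_transition {c c' : M} {y : E}
    (hy : y ∈ chartPart E c (extChartAt 𝓘(ℝ, E) c').source) :
    fderiv ℝ (transition E c c') y
      = (chartDeriv c' ((extChartAt 𝓘(ℝ, E) c).symm y)).comp (chartSymmDeriv c y) := by
  have : IsManifold 𝓘(ℝ, E) 1 M := IsManifold.of_le (n := ω) le_top
  have h1 : MDifferentiableAt 𝓘(ℝ, E) 𝓘(ℝ, E) (extChartAt 𝓘(ℝ, E) c).symm y :=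
    (mdifferentiableOn_extChartAt_symm.mdifferentiableAt
      ((isOpen_extChartAt_target c).mem_nhds hy.1))
  have h2 : MDifferentiableAt 𝓘(ℝ, E) 𝓘(ℝ, E) (extChartAt 𝓘(ℝ, E) c')
      ((extChartAt 𝓘(ℝ, E) c).symm y) := mdifferentiableAt_extChartAt (by simpa using hy.2)
  have h3 := mfderiv_comp y h2 h1
  rw [mfderiv_eq_fderiv] at h3
  exact h3

theorem isInvertible_fderiv_transition {c c' : M} {y : E}
    (hy : y ∈ chartPart E c (extChartAt 𝓘(ℝ, E) c').source) :
    (fderiv ℝ (transition E c c') y).IsInvertible := by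
  rw [fderiv_transition hy]
  have h := isInvertible_chartSymmDeriv ((extChartAt 𝓘(ℝ, E) c).map_target hy.1)
  rw [(extChartAt 𝓘(ℝ, E) c).right_inv hy.1] at h
  exact (isInvertible_chartDeriv hy.2).comp h

theorem tensorInChart_transition {c c' : M} {y : E}
    (hy : y ∈ chartPart E c (extChartAt 𝓘(ℝ, E) c').source) (α : M → CTensor p q E) :
    tensorInChart (M := M) c α y = CTensor.pullback (fderiv ℝ (transition E c c') y)
      (tensorInChart (M := M) c' α (transition E c c' y)) := by
  have h := isInvertible_chartSymmDeriv ((extChartAt 𝓘(ℝ, E) c).map_target hy.1)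
  rw [(extChartAt 𝓘(ℝ, E) c).right_inv hy.1] at h
  rw [fderiv_transition hy, CTensor.pullback_comp h, transition, pullback_tensorInChart hy.2]
  rfl

theorem vectorInChart_transition {c c' : M} {y : E}
    (hy : y ∈ chartPart E c (extChartAt 𝓘(ℝ, E) c').source) (X : M → E) :
    vectorInChart (M := M) c X y = (fderiv ℝ (transition E c c') y).inverse
      (vectorInChart (M := M) c' X (transition E c c' y)) := by
  have h := isInvertible_chartSymmDeriv ((extChartAt 𝓘(ℝ, E) c).map_target hy.1)
  rw [(extChartAt 𝓘(ℝ, E) c).right_inv hy.1] at h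
  have h2 : ((chartDeriv c' ((extChartAt 𝓘(ℝ, E) c).symm y)).comp (chartSymmDeriv c y)).inverse
      = (chartSymmDeriv c y).inverse.comp
        (chartSymmDeriv c' (transition E c c' y)) := by
    have h3 : (chartDeriv c' ((extChartAt 𝓘(ℝ, E) c).symm y)).inverse
        = chartSymmDeriv c' (transition E c c' y) :=
      ContinuousLinearMap.inverse_eq (chartDeriv_comp_chartSymmDeriv hy.2)
        (chartSymmDeriv_comp_chartDeriv hy.2)
    rw [← h3]
    obtain ⟨A, hA⟩ := h
    rw [← hA]
    simp
  rw [fderiv_transition hy, h2, vectorInChart_eq, vectorInChart_eq]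
  have h4 := isInvertible_chartSymmDeriv hy.2
  rw [ContinuousLinearMap.comp_apply, transition, h4.self_apply_inverse,
    (extChartAt 𝓘(ℝ, E) c').left_inv hy.2]

/-- The Lie derivative can be computed in any chart. -/
theorem realLieDerivative_eq_chart [CompleteSpace E] {c x : M}
    (hx : x ∈ (extChartAt 𝓘(ℝ, E) c).source) {X : M → E} {α : M → CTensor p q E}
    (hX : DifferentiableAt ℝ (vectorInChart (M := M) c X) (extChartAt 𝓘(ℝ, E) c x))
    (hα : DifferentiableAt ℝ (tensorInChart (M := M) c α) (extChartAt 𝓘(ℝ, E) c x)) :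
    realLieDerivative (M := M) X α x = CTensor.pullback (chartDeriv c x)
      (CTensor.lieFlat (vectorInChart (M := M) c X) (tensorInChart (M := M) c α)
        (extChartAt 𝓘(ℝ, E) c x)) := by
  have hxx : x ∈ (extChartAt 𝓘(ℝ, E) x).source := mem_extChartAt_source x
  have hy : extChartAt 𝓘(ℝ, E) x x ∈ chartPart E x (extChartAt 𝓘(ℝ, E) c).source :=
    mem_chartPart hxx hx
  have hτ : transition E x c (extChartAt 𝓘(ℝ, E) x x) = extChartAt 𝓘(ℝ, E) c x := by
    rw [transition, (extChartAt 𝓘(ℝ, E) x).left_inv hxx]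
  have hev : ∀ᶠ z in 𝓝 (extChartAt 𝓘(ℝ, E) x x),
      z ∈ chartPart E x (extChartAt 𝓘(ℝ, E) c).source :=
    (isOpen_chartPart x (isOpen_extChartAt_source c)).mem_nhds hy
  rw [← hτ] at hX hα
  rw [realLieDerivative_eq, CTensor.lieFlat_congr
    (hev.mono fun z hz => vectorInChart_transition hz X)
    (hev.mono fun z hz => tensorInChart_transition hz α),
    CTensor.lieFlat_pullback (analyticAt_transition hy) (isInvertible_fderiv_transition hy) hX hα,
    hτ, ← CTensor.pullback_comp (isInvertible_chartDeriv hxx), fderiv_transition hy,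
    ContinuousLinearMap.comp_assoc, chartSymmDeriv_comp_chartDeriv hxx,
    ContinuousLinearMap.comp_id, (extChartAt 𝓘(ℝ, E) x).left_inv hxx]

end Charts

/-! ### The transport equation as a first order system in a chart. -/

section LieEvolution

set_option maxSynthPendingDepth 3

open Filter Topology

variable {p q : ℕ} {E : Type*} [NormedAddCommGroup E] [NormedSpace ℝ E]

/-- Multiplication of a complex tensor by the imaginary unit. -/
def mulIL (p q : ℕ) (E : Type*) [NormedAddCommGroup E] [NormedSpace ℝ E] :
    CTensor p q E →L[ℝ] CTensor p q E :=
  Complex.I • ContinuousLinearMap.id ℝ (CTensor p q E)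

theorem mulIL_apply (α : CTensor p q E) : mulIL p q E α = Complex.I • α := rfl

/-- The first order part of the complex Lie derivative along `h = (Re Z, Im Z)`. -/
def lieFirstOrder (p q : ℕ) (h : ℝ × E → E × E) (z : ℝ × E) :
    (E →L[ℝ] CTensor p q E) →L[ℝ] CTensor p q E :=
  ContinuousLinearMap.apply ℝ (CTensor p q E) (h z).1
    + (mulIL p q E).comp (ContinuousLinearMap.apply ℝ (CTensor p q E) (h z).2)

/-- The zeroth order part of the complex Lie derivative along `h = (Re Z, Im Z)`. -/
def lieZerothOrder (p q : ℕ) (h : ℝ × E → E × E) (z : ℝ × E) :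
    CTensor p q E →L[ℝ] CTensor p q E :=
  CTensor.lieZeroth p q (fderiv ℝ (fun y => (h (z.1, y)).1) z.2)
    + (mulIL p q E).comp (CTensor.lieZeroth p q (fderiv ℝ (fun y => (h (z.1, y)).2) z.2))

theorem analyticAt_lieFirstOrder {h : ℝ × E → E × E} {z : ℝ × E} (hh : AnalyticAt ℝ h z) :
    AnalyticAt ℝ (lieFirstOrder p q h) z := by
  have h1 : AnalyticAt ℝ (fun z => (h z).1) z := analyticAt_fst.comp_of_eq hh rfl
  have h2 : AnalyticAt ℝ (fun z => (h z).2) z := analyticAt_snd.comp_of_eq hh rfl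
  have h3 : AnalyticAt ℝ (fun z => ContinuousLinearMap.apply ℝ (CTensor p q E) (h z).1) z :=
    analyticAt_const.clm_apply h1
  have h4 : AnalyticAt ℝ (fun z => ContinuousLinearMap.apply ℝ (CTensor p q E) (h z).2) z :=
    analyticAt_const.clm_apply h2
  exact h3.add (analyticAt_const.clm_comp h4)

theorem analyticAt_fderiv_slice [CompleteSpace E] {f : ℝ × E → E} {z : ℝ × E}
    (hf : AnalyticAt ℝ f z) :
    AnalyticAt ℝ (fun z : ℝ × E => fderiv ℝ (fun y => f (z.1, y)) z.2) z := by
  have h1 : AnalyticAt ℝ (fun z => (fderiv ℝ f z).comp (ContinuousLinearMap.inr ℝ ℝ E)) z :=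
    hf.fderiv.clm_comp analyticAt_const
  refine h1.congr ?_
  filter_upwards [hf.eventually_analyticAt] with z hz
  have h2 : HasFDerivAt (fun y : E => (z.1, y)) (ContinuousLinearMap.inr ℝ ℝ E) z.2 :=
    hasFDerivAt_prodMk_right z.1 z.2
  exact (hz.differentiableAt.hasFDerivAt.comp z.2 h2).fderiv.symm

theorem analyticAt_lieZerothOrder [CompleteSpace E] {h : ℝ × E → E × E} {z : ℝ × E}
    (hh : AnalyticAt ℝ h z) : AnalyticAt ℝ (lieZerothOrder p q h) z := by
  have h1 : AnalyticAt ℝ (fun z => (h z).1) z := analyticAt_fst.comp_of_eq hh rfl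
  have h2 : AnalyticAt ℝ (fun z => (h z).2) z := analyticAt_snd.comp_of_eq hh rfl
  have h3 : AnalyticAt ℝ (fun z : ℝ × E =>
      CTensor.lieZeroth p q (fderiv ℝ (fun y => (h (z.1, y)).1) z.2)) z :=
    (analyticAt_fderiv_slice h1).lieZeroth
  have h4 : AnalyticAt ℝ (fun z : ℝ × E =>
      CTensor.lieZeroth p q (fderiv ℝ (fun y => (h (z.1, y)).2) z.2)) z :=
    (analyticAt_fderiv_slice h2).lieZeroth
  have h5 : AnalyticAt ℝ (fun z : ℝ × E => (mulIL p q E).comp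
      (CTensor.lieZeroth p q (fderiv ℝ (fun y => (h (z.1, y)).2) z.2))) z :=
    analyticAt_const.clm_comp h4
  exact h3.add h5

theorem lieFlat_add_I_smul_lieFlat {X Y : E → E} {h : ℝ × E → E × E} {t : ℝ} {y : E}
    (hXY : ∀ᶠ z in 𝓝 y, (X z, Y z) = h (t, z)) (A : E → CTensor p q E) :
    CTensor.lieFlat X A y + Complex.I • CTensor.lieFlat Y A y
      = lieFirstOrder p q h (t, y) (fderiv ℝ A y) + lieZerothOrder p q h (t, y) (A y) := by
  have h1 : X =ᶠ[𝓝 y] fun z => (h (t, z)).1 := hXY.mono fun z hz => congrArg Prod.fst hz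
  have h2 : Y =ᶠ[𝓝 y] fun z => (h (t, z)).2 := hXY.mono fun z hz => congrArg Prod.snd hz
  simp only [CTensor.lieFlat_eq, h1.fderiv_eq, h2.fderiv_eq, h1.eq_of_nhds, h2.eq_of_nhds,
    lieFirstOrder, lieZerothOrder, add_apply, ContinuousLinearMap.comp_apply, mulIL_apply,
    ContinuousLinearMap.apply_apply, smul_add]
  abel

variable {M : Type*} [TopologicalSpace M] [ChartedSpace E M]

/-- The path `Z` of complex vector fields on `[0, T) × W` extends to one that is jointly real
analytic on `[0, T] × W`. -/
def IsAnalyticVectorPathOn (Z : ℝ → M → ℂ ⊗[ℝ] E) (T : ℝ) (W : Set M) : Prop :=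
  ∀ c : M, ∃ g : ℝ × E → E × E, AnalyticOn ℝ g (Icc 0 T ×ˢ chartPart E c W) ∧
    ∀ t ∈ Ico 0 T, ∀ y ∈ chartPart E c W, complexVectorInChart (M := M) c (Z t) y = g (t, y)

/-- Analyticity on a closed time interval is one-sided at its end points. The system needs
coefficients analytic on a full neighbourhood, in particular at time `0`, so the path is replaced by
a local analytic extension. -/
theorem IsAnalyticVectorPathOn.exists_analyticAt [CompleteSpace E] {Z : ℝ → M → ℂ ⊗[ℝ] E} {T : ℝ}
    {W : Set M}
    (hZ : IsAnalyticVectorPathOn Z T W) {c : M} {t : ℝ} {y : E} (ht : t ∈ Ico 0 T)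
    (hy : y ∈ chartPart E c W) : ∃ h : ℝ × E → E × E, AnalyticAt ℝ h (t, y) ∧
      ∀ s ∈ Ico 0 T, ∀ z ∈ chartPart E c W, complexVectorInChart (M := M) c (Z s) z = h (s, z) := by
  obtain ⟨g, hg, hgZ⟩ := hZ c
  obtain ⟨h, -, hgh, hh⟩ := (hg (t, y) ⟨Ico_subset_Icc_self ht, hy⟩).exists_analyticAt
  refine ⟨h, hh, fun s hs z hz => ?_⟩
  rw [hgZ s hs z hz]
  exact hgh (mem_insert_of_mem _ ⟨Ico_subset_Icc_self hs, hz⟩)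

/-- A `C¹` path of tensor fields on `[0, T] × U` that solves the transport equation. -/
structure IsLieEvolutionOn (Z : ℝ → M → ℂ ⊗[ℝ] E) (U : Set M) (T : ℝ)
    (β : ℝ → M → CTensor p q E) : Prop where
  contDiffOn : ∀ c : M, ContDiffOn ℝ 1 (fun z : ℝ × E => tensorInChart (M := M) c (β z.1) z.2)
    (Icc 0 T ×ˢ chartPart E c U)
  equation : ∀ t ∈ Icc 0 T, ∀ x ∈ U,
    HasDerivWithinAt (fun s => β s x) (complexLieDerivative (M := M) (Z t) (β t) x) (Icc 0 T) t

theorem IsLieEvolutionOn.mono {Z : ℝ → M → ℂ ⊗[ℝ] E} {U U' : Set M} {T T' : ℝ}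
    {β : ℝ → M → CTensor p q E} (h : IsLieEvolutionOn Z U T β) (hU : U' ⊆ U) (hT : T' ≤ T) :
    IsLieEvolutionOn Z U' T' β where
  contDiffOn c := (h.contDiffOn c).mono
    (prod_mono (Icc_subset_Icc_right hT) (chartPart_mono c hU))
  equation t ht x hx := (h.equation t ⟨ht.1, ht.2.trans hT⟩ x (hU hx)).mono
    (Icc_subset_Icc_right hT)

theorem IsAnalyticVectorPathOn.differentiableAt [CompleteSpace E] {Z : ℝ → M → ℂ ⊗[ℝ] E} {T : ℝ}
    {W : Set M} (hZ : IsAnalyticVectorPathOn Z T W) (hW : IsOpen W) {c : M} {t : ℝ} {y : E}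
    (ht : t ∈ Ico 0 T) (hy : y ∈ chartPart E c W) :
    DifferentiableAt ℝ (complexVectorInChart (M := M) c (Z t)) y := by
  obtain ⟨h, hh, hhZ⟩ := hZ.exists_analyticAt ht hy
  refine DifferentiableAt.congr_of_eventuallyEq (f := fun z => h (t, z))
    (hh.differentiableAt.comp y (hasFDerivAt_prodMk_right t y).differentiableAt) ?_
  filter_upwards [(isOpen_chartPart c hW).mem_nhds hy] with z hz
  exact hhZ t ht z hz

variable [IsManifold 𝓘(ℝ, E) ω M]

/-- The complex Lie derivative in a chart. -/
theorem complexLieDerivative_eq_chart [CompleteSpace E] {Z : M → ℂ ⊗[ℝ] E}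
    {α : M → CTensor p q E} {c x : M} {h : ℝ × E → E × E} {t : ℝ}
    (hx : x ∈ (extChartAt 𝓘(ℝ, E) c).source)
    (hd : DifferentiableAt ℝ (complexVectorInChart (M := M) c Z) (extChartAt 𝓘(ℝ, E) c x))
    (hZ : ∀ᶠ z in 𝓝 (extChartAt 𝓘(ℝ, E) c x),
      complexVectorInChart (M := M) c Z z = h (t, z))
    (hα : DifferentiableAt ℝ (tensorInChart (M := M) c α) (extChartAt 𝓘(ℝ, E) c x)) :
    complexLieDerivative (M := M) Z α x = CTensor.pullback (chartDeriv c x)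
      (lieFirstOrder p q h (t, extChartAt 𝓘(ℝ, E) c x)
          (fderiv ℝ (tensorInChart (M := M) c α) (extChartAt 𝓘(ℝ, E) c x))
        + lieZerothOrder p q h (t, extChartAt 𝓘(ℝ, E) c x)
          (tensorInChart (M := M) c α (extChartAt 𝓘(ℝ, E) c x))) := by
  rw [← lieFlat_add_I_smul_lieFlat hZ, CTensor.pullback_add, CTensor.pullback_I_smul]
  have h1 := realLieDerivative_eq_chart (X := fun x => complexifiedRe (Z x)) hx hd.fst hα
  have h2 := realLieDerivative_eq_chart (X := fun x => complexifiedIm (Z x)) hx hd.snd hα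
  exact congrArg₂ (fun a b : CTensor p q E => a + Complex.I • b) h1 h2

/-- The transport equation at a point is equivalent to the one in a chart. -/
theorem hasDerivWithinAt_tensor_iff {β : ℝ → M → CTensor p q E} {c x : M} {b : CTensor p q E}
    {S : Set ℝ} {t : ℝ} (hx : x ∈ (extChartAt 𝓘(ℝ, E) c).source) :
    HasDerivWithinAt (fun s => β s x) (CTensor.pullback (chartDeriv c x) b) S t ↔
      HasDerivWithinAt (fun s => tensorInChart (M := M) c (β s) (extChartAt 𝓘(ℝ, E) c x)) b S t := by
  constructor
  · intro h
    have h1 := (CTensor.pullbackL p q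
      (chartSymmDeriv c (extChartAt 𝓘(ℝ, E) c x))).hasFDerivAt.comp_hasDerivWithinAt t h
    rw [CTensor.pullbackL_apply, ← CTensor.pullback_comp (isInvertible_chartSymmDeriv hx),
      chartDeriv_comp_chartSymmDeriv hx, CTensor.pullback_id] at h1
    refine h1.congr_deriv rfl |>.congr_of_eventuallyEq (.of_forall fun s => ?_) ?_ <;>
    · simp only [Function.comp_apply]
      rw [tensorInChart_eq, (extChartAt 𝓘(ℝ, E) c).left_inv hx]
      rfl
  · intro h
    have h1 := (CTensor.pullbackL p q (chartDeriv c x)).hasFDerivAt.comp_hasDerivWithinAt t h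
    rw [CTensor.pullbackL_apply] at h1
    refine h1.congr_of_eventuallyEq (.of_forall fun s => ?_) ?_ <;>
    · rw [Function.comp_apply, CTensor.pullbackL_apply, pullback_tensorInChart hx]

end LieEvolution

/-! ### Local existence and local `C¹` uniqueness on the manifold. -/

section LocalTheory

set_option maxSynthPendingDepth 3

open Filter Topology Metric

variable {p q : ℕ} {E : Type*} [NormedAddCommGroup E] [NormedSpace ℝ E]
  {M : Type*} [TopologicalSpace M] [ChartedSpace E M] [IsManifold 𝓘(ℝ, E) ω M]

theorem HasFDerivWithinAt.hasDerivWithinAt_slice {F : Type*} [NormedAddCommGroup F]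
    [NormedSpace ℝ F] {w : ℝ × E → F} {w' : ℝ × E →L[ℝ] F} {I : Set ℝ} {S : Set E} {t : ℝ} {y : E}
    (hw : HasFDerivWithinAt w w' (I ×ˢ S) (t, y)) (hy : y ∈ S) :
    HasDerivWithinAt (fun s => w (s, y)) (w' (1, 0)) I t := by
  have h : HasDerivWithinAt (fun s : ℝ => (s, y)) ((1 : ℝ), (0 : E)) I t :=
    ((hasDerivAt_id t).prodMk (hasDerivAt_const t y)).hasDerivWithinAt
  exact HasFDerivWithinAt.comp_hasDerivWithinAt t hw h fun s hs => ⟨hs, hy⟩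

/-- A solution of the transport equation solves a linear first order system in each chart. -/
theorem IsLieEvolutionOn.exists_hasFDerivWithinAt [CompleteSpace E] {Z : ℝ → M → ℂ ⊗[ℝ] E}
    {T T' : ℝ} {W U : Set M} (hZ : IsAnalyticVectorPathOn Z T W) (hW : IsOpen W) (hU : IsOpen U)
    (hUW : U ⊆ W) {β : ℝ → M → CTensor p q E} (hβ : IsLieEvolutionOn Z U T' β) {c : M}
    {h : ℝ × E → E × E}
    (hh : ∀ s ∈ Ico 0 T, ∀ z ∈ chartPart E c W, complexVectorInChart (M := M) c (Z s) z = h (s, z))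
    {t₀ t₁ : ℝ} (ht₀ : 0 ≤ t₀) (ht : t₀ < t₁) (ht₁ : t₁ < T) (htT' : t₁ ≤ T') :
    ∃ w' : ℝ × E → ℝ × E →L[ℝ] CTensor p q E,
      (∀ z ∈ Icc t₀ t₁ ×ˢ chartPart E c U,
        HasFDerivWithinAt (fun z : ℝ × E => tensorInChart (M := M) c (β z.1) z.2) (w' z)
          (Icc t₀ t₁ ×ˢ chartPart E c U) z) ∧
      ContinuousOn w' (Icc t₀ t₁ ×ˢ chartPart E c U) ∧
      ∀ z ∈ Icc t₀ t₁ ×ˢ chartPart E c U, w' z (1, 0)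
        = lieFirstOrder p q h z ((w' z).comp (ContinuousLinearMap.inr ℝ ℝ E))
          + lieZerothOrder p q h z (tensorInChart (M := M) c (β z.1) z.2) := by
  have hUo : IsOpen (chartPart E c U) := isOpen_chartPart c hU
  have hsub : Icc t₀ t₁ ⊆ Icc 0 T' := Icc_subset_Icc ht₀ htT'
  have hS : UniqueDiffOn ℝ (Icc t₀ t₁ ×ˢ chartPart E c U) :=
    (uniqueDiffOn_Icc ht).prod hUo.uniqueDiffOn
  have hC : ContDiffOn ℝ 1 (fun z : ℝ × E => tensorInChart (M := M) c (β z.1) z.2)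
      (Icc t₀ t₁ ×ˢ chartPart E c U) := (hβ.contDiffOn c).mono (prod_mono hsub subset_rfl)
  have hD : ∀ z ∈ Icc t₀ t₁ ×ˢ chartPart E c U,
      HasFDerivWithinAt (fun z : ℝ × E => tensorInChart (M := M) c (β z.1) z.2)
        (fderivWithin ℝ (fun z : ℝ × E => tensorInChart (M := M) c (β z.1) z.2)
          (Icc t₀ t₁ ×ˢ chartPart E c U) z) (Icc t₀ t₁ ×ˢ chartPart E c U) z := fun z hz =>
    (hC.differentiableOn one_ne_zero z hz).hasFDerivWithinAt
  refine ⟨_, hD, hC.continuousOn_fderivWithin hS le_rfl, ?_⟩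
  rintro ⟨t, y⟩ ⟨ht', hy⟩
  have hD' := hD (t, y) ⟨ht', hy⟩
  set w' := fderivWithin ℝ (fun z : ℝ × E => tensorInChart (M := M) c (β z.1) z.2)
    (Icc t₀ t₁ ×ˢ chartPart E c U) (t, y)
  have hx : (extChartAt 𝓘(ℝ, E) c).symm y ∈ (extChartAt 𝓘(ℝ, E) c).source :=
    (extChartAt 𝓘(ℝ, E) c).map_target hy.1
  have hxy : extChartAt 𝓘(ℝ, E) c ((extChartAt 𝓘(ℝ, E) c).symm y) = y :=
    (extChartAt 𝓘(ℝ, E) c).right_inv hy.1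
  have hyW : y ∈ chartPart E c W := chartPart_mono c hUW hy
  have htT : t ∈ Ico 0 T := ⟨ht₀.trans ht'.1, ht'.2.trans_lt ht₁⟩
  have hspace : HasFDerivAt (tensorInChart (M := M) c (β t))
      (w'.comp (ContinuousLinearMap.inr ℝ ℝ E)) y := by
    have h1 := HasFDerivWithinAt.comp y hD' (hasFDerivAt_prodMk_right t y).hasFDerivWithinAt
      (s := chartPart E c U) fun z hz => ⟨ht', hz⟩
    exact h1.hasFDerivAt (hUo.mem_nhds hy)
  have htime : HasDerivWithinAt (fun s => tensorInChart (M := M) c (β s) y) (w' (1, 0))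
      (Icc t₀ t₁) t := hD'.hasDerivWithinAt_slice hy
  have hev : ∀ᶠ z in 𝓝 y, complexVectorInChart (M := M) c (Z t) z = h (t, z) := by
    filter_upwards [(isOpen_chartPart c hW).mem_nhds hyW] with z hz
    exact hh t htT z hz
  have heq' := complexLieDerivative_eq_chart hx (α := β t) (t := t)
    (by rw [hxy]; exact hZ.differentiableAt hW htT hyW)
    (by rw [hxy]; exact hev) (by rw [hxy]; exact hspace.differentiableAt)
  rw [hxy, hspace.fderiv] at heq'
  have heq'' := (hasDerivWithinAt_tensor_iff (β := β) (t := t) hx).1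
    (((hβ.equation t (hsub ht') _ hy.2).mono hsub).congr_deriv heq')
  rw [hxy] at heq''
  -- The curve at a fixed point has two expressions for its time derivative, one from joint
  -- differentiability and one from the transport equation; uniqueness of derivatives on the
  -- interval equates them.
  exact (uniqueDiffOn_Icc ht t ht').eq_deriv _ htime heq''

/-- Local uniqueness of the solutions of the transport equation of class `C¹`. -/
theorem exists_eqOn_of_isLieEvolutionOn [FiniteDimensional ℝ E] {Z : ℝ → M → ℂ ⊗[ℝ] E}
    {T T' t₀ : ℝ} {W U : Set M} (hZ : IsAnalyticVectorPathOn Z T W) (hW : IsOpen W) (hU : IsOpen U)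
    (hUW : U ⊆ W) {x₀ : M} (hx₀ : x₀ ∈ U) (ht₀ : 0 ≤ t₀) (ht₀T : t₀ < T) (ht₀T' : t₀ < T') :
    ∃ δ > 0, ∃ V, IsOpen V ∧ x₀ ∈ V ∧ V ⊆ U ∧ t₀ + δ ≤ T' ∧
      ∀ β γ : ℝ → M → CTensor p q E, IsLieEvolutionOn Z U T' β → IsLieEvolutionOn Z U T' γ →
        (∀ x ∈ U, β t₀ x = γ t₀ x) → ∀ t ∈ Icc t₀ (t₀ + δ), ∀ x ∈ V, β t x = γ t x := by
  have : CompleteSpace E := FiniteDimensional.complete ℝ E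
  have hx₀s : x₀ ∈ (extChartAt 𝓘(ℝ, E) x₀).source := mem_extChartAt_source x₀
  have hy₀ : extChartAt 𝓘(ℝ, E) x₀ x₀ ∈ chartPart E x₀ U := mem_chartPart hx₀s hx₀
  obtain ⟨h, hh, hhZ⟩ := hZ.exists_analyticAt (t := t₀) ⟨ht₀, ht₀T⟩ (chartPart_mono x₀ hUW hy₀)
  -- Strictly below `T`, since the analytic extension is only known to agree with `Z` before `T`.
  obtain ⟨t₁, ht₁, ht₁'⟩ := exists_between (lt_min ht₀T ht₀T')
  obtain ⟨δ, hδ, V, hV, hyV, hVU, hVβ⟩ := exists_forall_eq_zero_of_isNullSolutionOn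
    (analyticAt_lieFirstOrder (p := p) (q := q) hh) (analyticAt_lieZerothOrder hh)
    (isOpen_chartPart x₀ hU) hy₀ ht₁
  refine ⟨min δ (T' - t₀), lt_min hδ (sub_pos.2 ht₀T'),
    (extChartAt 𝓘(ℝ, E) x₀).source ∩ extChartAt 𝓘(ℝ, E) x₀ ⁻¹' V,
    (continuousOn_extChartAt x₀).isOpen_inter_preimage (isOpen_extChartAt_source x₀) hV,
    ⟨hx₀s, hyV⟩, ?_, by linarith [min_le_right δ (T' - t₀)], ?_⟩
  · rintro x ⟨hx, hxV⟩
    have := (hVU hxV).2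
    rwa [mem_preimage, (extChartAt 𝓘(ℝ, E) x₀).left_inv hx] at this
  · rintro β γ hβ hγ h0 t ht x ⟨hx, hxV⟩
    obtain ⟨b', hb, hbc, hbe⟩ := hβ.exists_hasFDerivWithinAt hZ hW hU hUW hhZ ht₀ ht₁
      (ht₁'.trans_le (min_le_left _ _)) (ht₁'.trans_le (min_le_right _ _)).le
    obtain ⟨c', hc, hcc, hce⟩ := hγ.exists_hasFDerivWithinAt hZ hW hU hUW hhZ ht₀ ht₁
      (ht₁'.trans_le (min_le_left _ _)) (ht₁'.trans_le (min_le_right _ _)).le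
    -- By linearity the difference of the two solutions is a null solution.
    have key := hVβ (fun z => tensorInChart (M := M) x₀ (β z.1) z.2
        - tensorInChart (M := M) x₀ (γ z.1) z.2) (fun z => b' z - c' z)
      { hasFDerivWithinAt := fun z hz => (hb z hz).sub (hc z hz)
        continuousOn := hbc.sub hcc
        initial := fun y hy => by
          simp only [tensorInChart_eq]
          rw [h0 _ hy.2, sub_self]
        equation := fun z hz => by
          rw [sub_apply, hbe z hz, hce z hz, ContinuousLinearMap.sub_comp, map_sub, map_sub]
          abel } t ⟨ht.1, ht.2.trans (by linarith [min_le_left δ (T' - t₀)])⟩ _ hxV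
    rw [← pullback_tensorInChart hx (β t), ← pullback_tensorInChart hx (γ t), sub_eq_zero.1 key]

/-- The path `β` of tensor fields is jointly real analytic on `[0, T] × U`. -/
def IsAnalyticTensorPathOn (β : ℝ → M → CTensor p q E) (U : Set M) (T : ℝ) : Prop :=
  ∀ c : M, AnalyticOn ℝ (fun z : ℝ × E => tensorInChart (M := M) c (β z.1) z.2)
    (Icc 0 T ×ˢ chartPart E c U)

/-- The tensor field on the domain of the chart at `c` whose expression in that chart is `b`. -/
def tensorOfChart (c : M) (b : E → CTensor p q E) (x : M) : CTensor p q E :=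
  CTensor.pullback (chartDeriv c x) (b (extChartAt 𝓘(ℝ, E) c x))

theorem tensorInChart_tensorOfChart {c : M} {y : E} (hy : y ∈ (extChartAt 𝓘(ℝ, E) c).target)
    (b : E → CTensor p q E) : tensorInChart (M := M) c (tensorOfChart c b) y = b y := by
  have h := (extChartAt 𝓘(ℝ, E) c).map_target hy
  have h1 := isInvertible_chartSymmDeriv h
  have h2 := chartDeriv_comp_chartSymmDeriv h
  rw [(extChartAt 𝓘(ℝ, E) c).right_inv hy] at h1 h2
  rw [tensorInChart_eq, tensorOfChart, ← CTensor.pullback_comp h1, h2, CTensor.pullback_id,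
    (extChartAt 𝓘(ℝ, E) c).right_inv hy]

/-- Local existence of analytic solutions of the transport equation. -/
theorem exists_isLieEvolutionOn [FiniteDimensional ℝ E] {Z : ℝ → M → ℂ ⊗[ℝ] E}
    {T : ℝ} {W : Set M} (hZ : IsAnalyticVectorPathOn Z T W) (hT : 0 < T) (hW : IsOpen W)
    {α : M → CTensor p q E} (hα : IsAnalyticTensorOn (M := M) α W) {x₀ : M} (hx₀ : x₀ ∈ W) :
    ∃ U, IsOpen U ∧ x₀ ∈ U ∧ U ⊆ W ∧ ∃ T₀ > 0, T₀ < T ∧ ∃ β : ℝ → M → CTensor p q E,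
      IsLieEvolutionOn Z U T₀ β ∧ (∀ x ∈ U, β 0 x = α x) ∧ IsAnalyticTensorPathOn β U T₀ := by
  have : CompleteSpace E := FiniteDimensional.complete ℝ E
  have hx₀s : x₀ ∈ (extChartAt 𝓘(ℝ, E) x₀).source := mem_extChartAt_source x₀
  have hy₀ : extChartAt 𝓘(ℝ, E) x₀ x₀ ∈ chartPart E x₀ W := mem_chartPart hx₀s hx₀
  have hWo := isOpen_chartPart (E := E) x₀ hW
  obtain ⟨h, hh, hhZ⟩ := hZ.exists_analyticAt (t := 0) ⟨le_rfl, hT⟩ hy₀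
  set y₀ := extChartAt 𝓘(ℝ, E) x₀ x₀ with hy₀def
  obtain ⟨r₀, hr₀, R₀, hR₀, hmain⟩ := exists_solvesEvolutionAt
    (analyticAt_lieFirstOrder (p := p) (q := q) hh) (analyticAt_lieZerothOrder hh)
  have hαy : AnalyticAt ℝ (tensorInChart (M := M) x₀ α) y₀ :=
    (hWo.analyticOn_iff_analyticOnNhd.1 (hα x₀)) y₀ hy₀
  obtain ⟨r₁, hr₁, R₁, hR₁, K, hK, hmaj⟩ := hαy.exists_isMajorizedOn
  obtain ⟨r₂, hr₂, hr₂W⟩ := Metric.isOpen_iff.1 hWo y₀ hy₀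
  set r := min r₀ (min r₁ r₂) with hrdef
  have hr : 0 < r := lt_min hr₀ (lt_min hr₁ hr₂)
  obtain ⟨δ, hδ, hsolve⟩ := hmain r hr (min_le_left _ _) (max R₀ R₁) (le_max_left _ _)
  obtain ⟨u, hu, hu0, huP⟩ := hsolve _ K hK.le
    ((hmaj.mono_set (ball_subset_ball ((min_le_right _ _).trans (min_le_left _ _)))).mono_geom
      hR₁.le hK.le le_rfl (le_max_right _ _)) 0 (by simpa using hδ)
  simp only [zero_sub, zero_add] at hu hu0 huP
  have hBW : ball y₀ r ⊆ chartPart E x₀ W :=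
    (ball_subset_ball ((min_le_right _ _).trans (min_le_right _ _))).trans hr₂W
  set β : ℝ → M → CTensor p q E := fun t => tensorOfChart x₀ fun y => u (t, y) with hβ
  set U : Set M := (extChartAt 𝓘(ℝ, E) x₀).source ∩ extChartAt 𝓘(ℝ, E) x₀ ⁻¹' ball y₀ r with hUdef
  have hUo : IsOpen U := (continuousOn_extChartAt x₀).isOpen_inter_preimage
    (isOpen_extChartAt_source x₀) isOpen_ball
  have hβx : ∀ t, ∀ y ∈ ball y₀ r, tensorInChart (M := M) x₀ (β t) y = u (t, y) := fun t y hy =>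
    tensorInChart_tensorOfChart (hBW hy).1 _
  obtain ⟨T₀, hT₀, hT₀'⟩ := exists_between (lt_min hδ hT)
  have hT₀δ : T₀ < δ := hT₀'.trans_le (min_le_left _ _)
  have hT₀T : T₀ < T := hT₀'.trans_le (min_le_right _ _)
  -- The solution is built in the chart at `x₀`; in every other chart it is its pull-back by an
  -- analytic transition map.
  have han : ∀ c : M, ∀ z ∈ Icc 0 T₀ ×ˢ chartPart E c U,
      AnalyticAt ℝ (fun z : ℝ × E => tensorInChart (M := M) c (β z.1) z.2) z := by
    rintro c ⟨t, y⟩ ⟨ht, hy⟩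
    have hyc : y ∈ chartPart E c (extChartAt 𝓘(ℝ, E) x₀).source :=
      chartPart_mono c inter_subset_left hy
    have hτ := analyticAt_transition hyc
    have hτ2 : AnalyticAt ℝ (fun z : ℝ × E => transition E c x₀ z.2) (t, y) :=
      hτ.comp_of_eq analyticAt_snd rfl
    have hu' : AnalyticAt ℝ u (t, transition E c x₀ y) :=
      hu _ ⟨⟨by linarith [ht.1], by linarith [ht.2]⟩, hy.2.2⟩
    have h1 : AnalyticAt ℝ (fun z : ℝ × E => u (z.1, transition E c x₀ z.2)) (t, y) :=
      hu'.comp_of_eq (analyticAt_fst.prod hτ2) rfl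
    have h2 : AnalyticAt ℝ (fun z : ℝ × E => fderiv ℝ (transition E c x₀) z.2) (t, y) :=
      hτ.fderiv.comp_of_eq analyticAt_snd rfl
    refine (h2.pullback (isInvertible_fderiv_transition hyc) h1).congr ?_
    have hopen : IsOpen (chartPart E c U) := isOpen_chartPart c hUo
    filter_upwards [(hopen.preimage continuous_snd).mem_nhds hy] with z hz
    rw [tensorInChart_transition (chartPart_mono c inter_subset_left hz), hβx _ (transition E c x₀ z.2) hz.2.2]
  refine ⟨U, hUo, ⟨hx₀s, mem_ball_self hr⟩, ?_, T₀, hT₀, hT₀T, β, ⟨?_, ?_⟩, ?_, ?_⟩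
  · rintro x ⟨hx, hxB⟩
    have := (hBW hxB).2
    rwa [mem_preimage, (extChartAt 𝓘(ℝ, E) x₀).left_inv hx] at this
  · exact fun c z hz => (han c z hz).contDiffAt.contDiffWithinAt
  · rintro t ht x ⟨hx, hxB⟩
    have hz : (t, extChartAt 𝓘(ℝ, E) x₀ x) ∈ Ioo (-δ) δ ×ˢ ball y₀ r :=
      ⟨⟨by linarith [ht.1], by linarith [ht.2]⟩, hxB⟩
    have htT : t ∈ Ico 0 T := ⟨ht.1, ht.2.trans_lt hT₀T⟩
    have huz := (hu _ hz).differentiableAt.hasFDerivAt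
    have hβt : tensorInChart (M := M) x₀ (β t) =ᶠ[𝓝 (extChartAt 𝓘(ℝ, E) x₀ x)]
        fun y => u (t, y) := by
      filter_upwards [isOpen_ball.mem_nhds hxB] with y hy using hβx t y hy
    have hspace : HasFDerivAt (tensorInChart (M := M) x₀ (β t))
        ((fderiv ℝ u (t, extChartAt 𝓘(ℝ, E) x₀ x)).comp (ContinuousLinearMap.inr ℝ ℝ E))
        (extChartAt 𝓘(ℝ, E) x₀ x) :=
      (huz.comp _ (hasFDerivAt_prodMk_right t _)).congr_of_eventuallyEq hβt
    have hev : ∀ᶠ z in 𝓝 (extChartAt 𝓘(ℝ, E) x₀ x),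
        complexVectorInChart (M := M) x₀ (Z t) z = h (t, z) := by
      filter_upwards [hWo.mem_nhds (hBW hxB)] with z hz
      exact hhZ t htT z hz
    have heq := complexLieDerivative_eq_chart hx (α := β t) (t := t)
      (hZ.differentiableAt hW htT (hBW hxB)) hev hspace.differentiableAt
    have htime : HasDerivWithinAt (fun s => u (s, extChartAt 𝓘(ℝ, E) x₀ x))
        (fderiv ℝ u (t, extChartAt 𝓘(ℝ, E) x₀ x) (1, 0)) (Icc 0 T₀) t :=
      (huz.comp_hasDerivAt t ((hasDerivAt_id t).prodMk (hasDerivAt_const t _))).hasDerivWithinAt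
    rw [huP _ hz] at htime
    refine HasDerivWithinAt.congr_deriv ?_ heq.symm
    rw [hasDerivWithinAt_tensor_iff hx, hspace.fderiv, hβx t _ hxB]
    refine htime.congr_of_eventuallyEq (.of_forall fun s => ?_) ?_ <;> exact hβx _ _ hxB
  · rintro x ⟨hx, hxB⟩
    rw [← pullback_tensorInChart hx (β 0), hβx 0 _ hxB, hu0 _ hxB, pullback_tensorInChart hx]
  · exact fun c z hz => (han c z hz).analyticWithinAt

end LocalTheory

/-! ### Continuation in time, gluing, and the compact case. -/

section GlobalTheory

set_option maxSynthPendingDepth 3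

open Filter Topology Metric

variable {p q : ℕ} {E : Type*} [NormedAddCommGroup E] [NormedSpace ℝ E]
  {M : Type*} [TopologicalSpace M] [ChartedSpace E M]

theorem AnalyticOn.slice_left {F : Type*} [NormedAddCommGroup F] [NormedSpace ℝ F]
    {f : ℝ × E → F} {I : Set ℝ} {S : Set E} {y : E} (hf : AnalyticOn ℝ f (I ×ˢ S)) (hy : y ∈ S) :
    AnalyticOn ℝ (fun t => f (t, y)) I :=
  show AnalyticOn ℝ (f ∘ fun t => (t, y)) I from
    hf.comp (analyticOn_id.prod analyticOn_const) fun _ ht => mk_mem_prod ht hy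

theorem AnalyticOn.slice_right {F : Type*} [NormedAddCommGroup F] [NormedSpace ℝ F]
    {f : ℝ × E → F} {I : Set ℝ} {S : Set E} {t : ℝ} (hf : AnalyticOn ℝ f (I ×ˢ S)) (ht : t ∈ I) :
    AnalyticOn ℝ (fun y => f (t, y)) S :=
  show AnalyticOn ℝ (f ∘ fun y => (t, y)) S from
    hf.comp (analyticOn_const.prod analyticOn_id) fun _ hy => mk_mem_prod ht hy

theorem IsLieEvolutionOn.continuousOn {Z : ℝ → M → ℂ ⊗[ℝ] E} {U : Set M} {T : ℝ}
    {β : ℝ → M → CTensor p q E} (h : IsLieEvolutionOn Z U T β) {x : M} (hx : x ∈ U) :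
    ContinuousOn (fun t => β t x) (Icc 0 T) :=
  fun t ht => (h.equation t ht x hx).continuousWithinAt

/-- A continuation principle: two solutions agree if their agreement propagates. -/
theorem IsLieEvolutionOn.eqOn_of_forall_exists_gt {Z : ℝ → M → ℂ ⊗[ℝ] E} {U : Set M} {T : ℝ}
    {β γ : ℝ → M → CTensor p q E} (hβ : IsLieEvolutionOn Z U T β) (hγ : IsLieEvolutionOn Z U T γ)
    (h0 : ∀ x ∈ U, β 0 x = γ 0 x)
    (hstep : ∀ t ∈ Ico 0 T, (∀ x ∈ U, β t x = γ t x) →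
      ∃ t' > t, ∀ s ∈ Ioo t t', ∀ x ∈ U, β s x = γ s x) :
    ∀ t ∈ Icc 0 T, ∀ x ∈ U, β t x = γ t x := by
  -- Continuity in time at each fixed point suffices, since the set is an intersection over the
  -- points of `U`.
  have hclosed : IsClosed ({t | ∀ x ∈ U, β t x = γ t x} ∩ Icc 0 T) := by
    have h1 : {t | ∀ x ∈ U, β t x = γ t x} ∩ Icc 0 T
        = Icc 0 T ∩ ⋂ x ∈ U, (Icc 0 T ∩ (fun t => β t x - γ t x) ⁻¹' {0}) := by
      ext t
      simp only [mem_inter_iff, mem_ofPred_eq, mem_iInter, mem_preimage, mem_singleton_iff,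
        sub_eq_zero]
      exact ⟨fun h => ⟨h.2, fun x hx => ⟨h.2, h.1 x hx⟩⟩, fun h => ⟨fun x hx => (h.2 x hx).2, h.1⟩⟩
    rw [h1]
    refine isClosed_Icc.inter (isClosed_biInter fun x hx => ?_)
    exact ((hβ.continuousOn hx).sub (hγ.continuousOn hx)).preimage_isClosed_of_isClosed
      isClosed_Icc isClosed_singleton
  refine fun t ht => hclosed.Icc_subset_of_forall_mem_nhdsWithin h0 (fun t ht => ?_) ht
  obtain ⟨t', ht', h⟩ := hstep t ht.2 ht.1
  exact mem_of_superset (Ioo_mem_nhdsGT ht') h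

/-- The least index `j` with `t < s j` is not `0`, and the interval that ends at `s j` contains `t`.
-/
theorem StrictMono.exists_mem_Ico_castSucc_succ {N : ℕ} {s : Fin (N + 1) → ℝ} {t : ℝ}
    (ht : t ∈ Ico (s 0) (s (Fin.last N))) :
    ∃ i : Fin N, t ∈ Ico (s i.castSucc) (s i.succ) := by
  obtain ⟨j, hj, hmin⟩ := (wellFounded_lt (α := Fin (N + 1))).has_min {j | t < s j} ⟨_, ht.2⟩
  obtain ⟨i, rfl⟩ := Fin.exists_succ_eq.2 (show j ≠ 0 by rintro rfl; exact ht.1.not_gt hj)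
  exact ⟨i, not_lt.1 fun h => hmin _ h (Fin.castSucc_lt_succ), hj⟩

theorem IsAnalyticTensorPathOn.mono {β : ℝ → M → CTensor p q E} {U U' : Set M} {T T' : ℝ}
    (h : IsAnalyticTensorPathOn β U T) (hU : U' ⊆ U) (hT : T' ≤ T) :
    IsAnalyticTensorPathOn β U' T' := fun c =>
  (h c).mono (prod_mono (Icc_subset_Icc_right hT) (chartPart_mono c hU))

theorem IsAnalyticTensorPathOn.isPiecewiseAnalyticOn {β : ℝ → M → CTensor p q E} {U : Set M}
    {T : ℝ} (h : IsAnalyticTensorPathOn β U T) (hT : 0 < T) :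
    IsPiecewiseAnalyticOn (fun c t => tensorInChart (M := M) c (β t)) T U := by
  refine ⟨1, ![0, T], ?_, rfl, rfl, fun i c =>
    ⟨fun z => tensorInChart (M := M) c (β z.1) z.2, ?_, fun t _ y _ => rfl⟩⟩
  · rw [Fin.strictMono_iff_lt_succ]
    intro i
    fin_cases i
    simpa using hT
  · fin_cases i
    exact h c

theorem IsAnalyticTensorPathOn.isAnalyticTensorOn {β : ℝ → M → CTensor p q E} {U : Set M}
    {T t : ℝ} (h : IsAnalyticTensorPathOn β U T) (ht : t ∈ Icc 0 T) :
    IsAnalyticTensorOn (M := M) (β t) U := fun c =>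
  (h c).slice_right ht

theorem tensorInChart_eventuallyEq {α α' : M → CTensor p q E} {U : Set M} (hU : IsOpen U)
    (h : ∀ x ∈ U, α x = α' x) {c : M} {y : E} (hy : y ∈ chartPart E c U) :
    tensorInChart (M := M) c α =ᶠ[𝓝 y] tensorInChart (M := M) c α' := by
  filter_upwards [(isOpen_chartPart c hU).mem_nhds hy] with z hz
  rw [tensorInChart_eq, tensorInChart_eq, h _ hz.2]

/-- Joint analyticity is a local property. -/
theorem IsAnalyticTensorPathOn.of_locally {U : Set M} {T : ℝ} {β : ℝ → M → CTensor p q E}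
    (h : ∀ x ∈ U, ∃ V, IsOpen V ∧ x ∈ V ∧ ∃ γ, IsAnalyticTensorPathOn γ V T ∧
      ∀ t ∈ Icc 0 T, ∀ x ∈ V, β t x = γ t x) : IsAnalyticTensorPathOn β U T := by
  rintro c ⟨t, y⟩ ⟨ht, hy⟩
  obtain ⟨V, hV, hxV, γ, hγ, hβγ⟩ := h _ hy.2
  have hyV : y ∈ chartPart E c V := ⟨hy.1, hxV⟩
  have hmem : Icc 0 T ×ˢ chartPart E c V ∈ 𝓝[Icc 0 T ×ˢ chartPart E c U] (t, y) := by
    rw [nhdsWithin_prod_eq]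
    exact prod_mem_prod self_mem_nhdsWithin
      (mem_nhdsWithin_of_mem_nhds ((isOpen_chartPart c hV).mem_nhds hyV))
  refine ((hγ c).congr ?_ (t, y) ⟨ht, hyV⟩).mono_of_mem_nhdsWithin hmem
  rintro ⟨s, z⟩ ⟨hs, hz⟩
  exact congrArg _ (hβγ s hs _ hz.2)

theorem complexLieDerivative_congr {Z : M → ℂ ⊗[ℝ] E} {α α' : M → CTensor p q E} {U : Set M}
    (hU : IsOpen U) (h : ∀ x ∈ U, α x = α' x) {x : M} (hx : x ∈ U) :
    (complexLieDerivative (M := M) Z α x : CTensor p q E)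
      = complexLieDerivative (M := M) Z α' x := by
  have h1 : ∀ X : M → E, (realLieDerivative (M := M) X α x : CTensor p q E)
      = realLieDerivative (M := M) X α' x := fun X => by
    have h2 := CTensor.lieFlat_congr (.refl _ (vectorInChart (M := M) x X))
      (tensorInChart_eventuallyEq hU h (mem_chartPart (mem_extChartAt_source x) hx))
    exact congrArg _ h2
  exact congrArg₂ (fun a b : CTensor p q E => a + Complex.I • b) (h1 _) (h1 _)

/-- Being a solution of the transport equation is a local property. -/
theorem IsLieEvolutionOn.of_locally {Z : ℝ → M → ℂ ⊗[ℝ] E} {U : Set M} {T : ℝ}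
    {β : ℝ → M → CTensor p q E}
    (h : ∀ x ∈ U, ∃ V, IsOpen V ∧ x ∈ V ∧ ∃ γ, IsLieEvolutionOn Z V T γ ∧
      ∀ t ∈ Icc 0 T, ∀ x ∈ V, β t x = γ t x) : IsLieEvolutionOn Z U T β where
  contDiffOn c := by
    rintro ⟨t, y⟩ ⟨ht, hy⟩
    obtain ⟨V, hV, hxV, γ, hγ, hβγ⟩ := h _ hy.2
    have hyV : y ∈ chartPart E c V := ⟨hy.1, hxV⟩
    have hmem : Icc 0 T ×ˢ chartPart E c V ∈ 𝓝[Icc 0 T ×ˢ chartPart E c U] (t, y) := by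
      rw [nhdsWithin_prod_eq]
      exact prod_mem_prod self_mem_nhdsWithin
        (mem_nhdsWithin_of_mem_nhds ((isOpen_chartPart c hV).mem_nhds hyV))
    refine ((hγ.contDiffOn c).congr ?_ (t, y) ⟨ht, hyV⟩).mono_of_mem_nhdsWithin hmem
    rintro ⟨s, z⟩ ⟨hs, hz⟩
    exact congrArg _ (hβγ s hs _ hz.2)
  equation t ht x hx := by
    obtain ⟨V, hV, hxV, γ, hγ, hβγ⟩ := h x hx
    exact ((hγ.equation t ht x hxV).congr_deriv
      (complexLieDerivative_congr hV (fun z hz => (hβγ t ht z hz).symm) hxV)).congr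
      (fun s hs => hβγ s hs x hxV) (hβγ t ht x hxV)

variable [IsManifold 𝓘(ℝ, E) ω M]

/-- Uniqueness of the solutions of the transport equation that are piecewise analytic in time. -/
theorem IsLieEvolutionOn.eqOn_of_isPiecewiseAnalyticOn [FiniteDimensional ℝ E]
    {Z : ℝ → M → ℂ ⊗[ℝ] E} {T T₀ : ℝ} {W U : Set M} (hZ : IsAnalyticVectorPathOn Z T W)
    (hW : IsOpen W) (hU : IsOpen U) (hUW : U ⊆ W) (hT₀ : T₀ < T) {β γ : ℝ → M → CTensor p q E}
    (hβ : IsLieEvolutionOn Z U T₀ β) (hβa : IsAnalyticTensorPathOn β U T₀)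
    (hγ : IsLieEvolutionOn Z U T₀ γ)
    (hγa : IsPiecewiseAnalyticOn (fun c t => tensorInChart (M := M) c (γ t)) T₀ U)
    (h0 : ∀ x ∈ U, β 0 x = γ 0 x) : ∀ t ∈ Icc 0 T₀, ∀ x ∈ U, β t x = γ t x := by
  refine hβ.eqOn_of_forall_exists_gt hγ h0 fun t ht hβγ => ?_
  obtain ⟨N, s, hs, hs0, hsT, hg⟩ := hγa
  obtain ⟨i, hi⟩ := StrictMono.exists_mem_Ico_castSucc_succ (s := s) (t := t)
    (by rw [hs0, hsT]; exact ht)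
  have hiT : s i.succ ≤ T₀ := hsT ▸ hs.monotone (Fin.le_last _)
  -- The end of the current piece of `γ` is independent of `x`, unlike the time given by local
  -- uniqueness. The identity theorem in time, at fixed `x`, reaches it from any short interval of
  -- agreement.
  refine ⟨s i.succ, hi.2, fun σ hσ x hx => ?_⟩
  have hxs : x ∈ (extChartAt 𝓘(ℝ, E) x).source := mem_extChartAt_source x
  have hy := mem_chartPart hxs hx
  obtain ⟨g, hga, hgγ⟩ := hg i x
  set y := extChartAt 𝓘(ℝ, E) x x with hydef
  obtain ⟨δ, hδ, V, -, hxV, -, -, hV⟩ := exists_eqOn_of_isLieEvolutionOn (p := p) (q := q)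
    hZ hW hU hUW hx ht.1 (ht.2.trans hT₀) ht.2
  have hf₁ : AnalyticOnNhd ℝ (fun σ => tensorInChart (M := M) x (β σ) y) (Ioo t (s i.succ)) := by
    rw [← isOpen_Ioo.analyticOn_iff_analyticOnNhd]
    exact ((hβa x).slice_left hy).mono fun σ hσ => ⟨ht.1.trans hσ.1.le, hσ.2.le.trans hiT⟩
  have hf₂ : AnalyticOnNhd ℝ (fun σ => g (σ, y)) (Ioo t (s i.succ)) := by
    rw [← isOpen_Ioo.analyticOn_iff_analyticOnNhd]
    exact (hga.slice_left hy).mono fun σ hσ => ⟨hi.1.trans hσ.1.le, hσ.2.le⟩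
  have hg' : ∀ σ ∈ Ioo t (s i.succ), tensorInChart (M := M) x (γ σ) y = g (σ, y) := fun σ hσ =>
    hgγ σ ⟨hi.1.trans hσ.1.le, hσ.2⟩ y hy
  obtain ⟨σ₀, hσ₀, hσ₀'⟩ := exists_between (lt_min hi.2 (lt_add_of_pos_right t hδ))
  have hev : (fun σ => tensorInChart (M := M) x (β σ) y) =ᶠ[𝓝 σ₀] fun σ => g (σ, y) := by
    filter_upwards [Ioo_mem_nhds hσ₀ hσ₀'] with σ hσ
    rw [← hg' σ ⟨hσ.1, hσ.2.trans_le (min_le_left _ _)⟩, tensorInChart_eq, tensorInChart_eq,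
      (extChartAt 𝓘(ℝ, E) x).left_inv hxs]
    exact congrArg _ (hV β γ hβ hγ hβγ σ ⟨hσ.1.le, (hσ.2.trans_le (min_le_right _ _)).le⟩ x hxV)
  have hEq := hf₁.eqOn_of_preconnected_of_eventuallyEq hf₂ isPreconnected_Ioo
    ⟨hσ₀, hσ₀'.trans_le (min_le_left _ _)⟩ hev hσ
  rw [← pullback_tensorInChart hxs (β σ), ← pullback_tensorInChart hxs (γ σ), ← hydef, hg' σ hσ]
  exact congrArg _ hEq

/-- Uniqueness of the `C¹` solutions of the transport equation on a compact manifold. -/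
theorem IsLieEvolutionOn.eqOn_of_compactSpace [FiniteDimensional ℝ E] [CompactSpace M]
    {Z : ℝ → M → ℂ ⊗[ℝ] E} {T T₀ : ℝ} (hZ : IsAnalyticVectorPathOn Z T (univ : Set M))
    (hT₀ : T₀ < T) {β γ : ℝ → M → CTensor p q E} (hβ : IsLieEvolutionOn Z univ T₀ β)
    (hγ : IsLieEvolutionOn Z univ T₀ γ) (h0 : ∀ x, β 0 x = γ 0 x) :
    ∀ t ∈ Icc 0 T₀, ∀ x, β t x = γ t x := by
  suffices h : ∀ t ∈ Icc 0 T₀, ∀ x ∈ univ, β t x = γ t x from fun t ht x => h t ht x (mem_univ x)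
  refine hβ.eqOn_of_forall_exists_gt hγ (fun x _ => h0 x) fun t ht hβγ => ?_
  choose δ hδ V hVo hxV hVU hδT hV using fun x : M => exists_eqOn_of_isLieEvolutionOn (p := p)
    (q := q) hZ isOpen_univ isOpen_univ subset_rfl (mem_univ x) ht.1 (ht.2.trans hT₀) ht.2
  obtain ⟨F, hF⟩ := isCompact_univ.elim_finite_subcover V hVo
    fun x _ => mem_iUnion.2 ⟨x, hxV x⟩
  have hev : ∀ᶠ ε in 𝓝[>] (0 : ℝ), ∀ x ∈ F, ε ≤ δ x :=
    (eventually_all_finset F).2 fun x _ => mem_of_superset (Ioc_mem_nhdsGT (hδ x)) fun _ h => h.2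
  obtain ⟨ε, hε, hε0⟩ := (hev.and self_mem_nhdsWithin).exists
  refine ⟨t + ε, lt_add_of_pos_right t hε0, fun s hs x _ => ?_⟩
  obtain ⟨z, hz, hxz⟩ := mem_iUnion₂.1 (hF (mem_univ x))
  exact hV z β γ hβ hγ hβγ s ⟨hs.1.le, hs.2.le.trans (by linarith [hε z hz])⟩ x hxz

/-- On a compact manifold the transport equation has an analytic solution for a short time. -/
theorem exists_isLieEvolutionOn_univ [FiniteDimensional ℝ E] [CompactSpace M]
    {Z : ℝ → M → ℂ ⊗[ℝ] E} {T : ℝ} (hZ : IsAnalyticVectorPathOn Z T (univ : Set M)) (hT : 0 < T)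
    {α : M → CTensor p q E} (hα : IsAnalyticTensorOn (M := M) α univ) :
    ∃ T₀ > 0, T₀ < T ∧ ∃ β : ℝ → M → CTensor p q E, IsLieEvolutionOn Z univ T₀ β ∧
      (∀ x, β 0 x = α x) ∧ IsAnalyticTensorPathOn β univ T₀ := by
  choose U hUo hxU _ τ hτ hτT b hb hb0 hba using fun x : M =>
    exists_isLieEvolutionOn hZ hT isOpen_univ hα (mem_univ x)
  obtain ⟨F, hF⟩ := isCompact_univ.elim_finite_subcover U hUo
    fun x _ => mem_iUnion.2 ⟨x, hxU x⟩
  have hev : ∀ᶠ ε in 𝓝[>] (0 : ℝ), ∀ x ∈ F, ε ≤ τ x :=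
    (eventually_all_finset F).2 fun x _ => mem_of_superset (Ioc_mem_nhdsGT (hτ x)) fun _ h => h.2
  obtain ⟨T₀, ⟨hT₀τ, hT₀T⟩, hT₀⟩ := ((hev.and (Iio_mem_nhds hT |> mem_nhdsWithin_of_mem_nhds)).and
    self_mem_nhdsWithin).exists
  choose idx hidx hxidx using fun x : M => mem_iUnion₂.1 (hF (mem_univ x))
  -- Local solutions coincide on the whole overlap of their domains, being analytic with the same
  -- initial value; hence choosing an index at each point yields a well-behaved global solution.
  have hagree : ∀ i ∈ F, ∀ t ∈ Icc 0 T₀, ∀ x ∈ U i, b (idx x) t x = b i t x := by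
    intro i hi t ht x hx
    have hj := hidx x
    refine IsLieEvolutionOn.eqOn_of_isPiecewiseAnalyticOn hZ isOpen_univ
      ((hUo (idx x)).inter (hUo i)) (subset_univ _) hT₀T
      ((hb _).mono inter_subset_left (hT₀τ _ hj)) ((hba _).mono inter_subset_left (hT₀τ _ hj))
      ((hb _).mono inter_subset_right (hT₀τ _ hi))
      (((hba _).mono inter_subset_right (hT₀τ _ hi)).isPiecewiseAnalyticOn hT₀)
      (fun z hz => (hb0 _ z hz.1).trans (hb0 _ z hz.2).symm) t ht x ⟨hxidx x, hx⟩
  refine ⟨T₀, hT₀, hT₀T, fun t x => b (idx x) t x, .of_locally fun x _ => ?_,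
    fun x => hb0 _ x (hxidx x), .of_locally fun x _ => ?_⟩
  · exact ⟨U (idx x), hUo _, hxidx x, b (idx x), (hb _).mono subset_rfl (hT₀τ _ (hidx x)),
      hagree _ (hidx x)⟩
  · exact ⟨U (idx x), hUo _, hxidx x, b (idx x), (hba _).mono subset_rfl (hT₀τ _ (hidx x)),
      hagree _ (hidx x)⟩

end GlobalTheory

end

/-! ### Assembly of the local and compact statements. -/

theorem mainTheorem8
    {E : Type*} [NormedAddCommGroup E] [NormedSpace ℝ E] [FiniteDimensional ℝ E]
    {M : Type*} [TopologicalSpace M] [T2Space M] [SecondCountableTopology M]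
    [ChartedSpace E M] [IsManifold 𝓘(ℝ, E) ω M]
    (p q : ℕ) (T : ℝ) (hT : 0 < T) (W : Set M) (hW : IsOpen W)
    (Z : ℝ → (x : M) → ℂ ⊗[ℝ] TangentSpace 𝓘(ℝ, E) x)
    (hZ : IsPiecewiseAnalyticOn (fun c t => complexVectorInChart c (Z t)) T W)
    (α : (x : M) → CTensor p q (TangentSpace 𝓘(ℝ, E) x))
    (hα : IsAnalyticTensorOn α W) :
    -- local existence and uniqueness
    (∀ x₀ ∈ W, ∃ (U : Set M) (T₀ : ℝ)
        (β : ℝ → (x : M) → CTensor p q (TangentSpace 𝓘(ℝ, E) x)),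
      IsOpen U ∧ x₀ ∈ U ∧ U ⊆ W ∧ 0 < T₀ ∧ T₀ ≤ T ∧
      IsTransportOn Z α U T₀ β ∧
      IsPiecewiseAnalyticOn (fun c t => tensorInChart c (β t)) T₀ U ∧
      (∀ t ∈ Icc 0 T₀, IsAnalyticTensorOn (β t) U) ∧
      -- uniqueness on `[0, T₀] × U` among piecewise analytic solutions
      (∀ γ : ℝ → (x : M) → CTensor p q (TangentSpace 𝓘(ℝ, E) x),
        IsTransportOn Z α U T₀ γ →
        IsPiecewiseAnalyticOn (fun c t => tensorInChart c (γ t)) T₀ U →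
        ∀ t ∈ Icc 0 T₀, ∀ x ∈ U, γ t x = β t x) ∧
      -- uniqueness near `(0, x₀)` among all `C¹` solutions
      (∀ (U' : Set M) (T' : ℝ), IsOpen U' → x₀ ∈ U' → U' ⊆ W → 0 < T' → T' ≤ T →
        ∃ (V : Set M) (T'' : ℝ), IsOpen V ∧ x₀ ∈ V ∧ V ⊆ U ∩ U' ∧
          0 < T'' ∧ T'' ≤ T₀ ∧ T'' ≤ T' ∧
          ∀ γ : ℝ → (x : M) → CTensor p q (TangentSpace 𝓘(ℝ, E) x),
            IsTransportOn Z α U' T' γ →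
            ∀ t ∈ Icc 0 T'', ∀ x ∈ V, γ t x = β t x)) ∧
    -- on a compact manifold the solution is defined, and unique, on the whole manifold
    (CompactSpace M → W = univ →
      ∃ (T₀ : ℝ) (β : ℝ → (x : M) → CTensor p q (TangentSpace 𝓘(ℝ, E) x)),
        0 < T₀ ∧ T₀ ≤ T ∧
        IsTransportOn Z α univ T₀ β ∧
        IsPiecewiseAnalyticOn (fun c t => tensorInChart c (β t)) T₀ univ ∧
        (∀ t ∈ Icc 0 T₀, IsAnalyticTensorOn (β t) univ) ∧
        ∀ T' : ℝ, 0 < T' → T' ≤ T₀ →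
          ∀ γ : ℝ → (x : M) → CTensor p q (TangentSpace 𝓘(ℝ, E) x),
            IsTransportOn Z α univ T' γ →
            ∀ t ∈ Icc 0 T', ∀ x, γ t x = β t x) := by
  -- Only the first interval of the partition matters: there `Z` is analytic, and all constructed
  -- times lie strictly inside it. The case `N = 0` would force `T = 0`.
  obtain ⟨N, s, hs, hs0, hsT, hg⟩ := hZ
  obtain ⟨n, rfl⟩ : ∃ n, N = n + 1 := Nat.exists_eq_succ_of_ne_zero fun hN => by
    subst hN
    exact hT.ne (hs0.symm.trans hsT)
  set T₁ := s (Fin.succ 0) with hT₁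
  have hT₁0 : 0 < T₁ := hs0 ▸ hs (Fin.succ_pos 0)
  have hT₁T : T₁ ≤ T := hsT ▸ hs.monotone (Fin.le_last _)
  have hZ' : IsAnalyticVectorPathOn (E := E) Z T₁ W := fun c => by
    have h := hg 0 c
    rwa [Fin.castSucc_zero, hs0] at h
  have htransport : ∀ (U : Set M) (T' : ℝ) (γ : ℝ → M → CTensor p q E),
      IsTransportOn (M := M) Z α U T' γ → IsLieEvolutionOn (E := E) Z U T' γ :=
    fun U T' γ h => ⟨h.contDiffOn, h.equation⟩
  refine ⟨fun x₀ hx₀ => ?_, fun hcpt hWu => ?_⟩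
  · obtain ⟨U, hU, hxU, hUW, T₀, hT₀, hT₀T, β, hβ, hβ0, hβa⟩ :=
      exists_isLieEvolutionOn hZ' hT₁0 hW hα hx₀
    refine ⟨U, T₀, β, hU, hxU, hUW, hT₀, hT₀T.le.trans hT₁T, ⟨hβ.contDiffOn, hβ0, hβ.equation⟩,
      hβa.isPiecewiseAnalyticOn hT₀, fun t ht => hβa.isAnalyticTensorOn ht,
      fun γ hγ hγa t ht x hx => ?_, fun U' T' hU' hxU' hU'W hT' hT'T => ?_⟩
    · exact (hβ.eqOn_of_isPiecewiseAnalyticOn hZ' hW hU hUW hT₀T hβa (htransport _ _ _ hγ) hγa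
        (fun z hz => (hβ0 z hz).trans (hγ.initial z hz).symm) t ht x hx).symm
    -- Local uniqueness is applied on `U ∩ U'` up to time `min T₀ T'`; its `V` and `δ` are produced
    -- before the competing solution is chosen, as the order of quantifiers requires.
    · obtain ⟨δ, hδ, V, hV, hxV, hVU, hδT, hVβ⟩ := exists_eqOn_of_isLieEvolutionOn (p := p)
        (q := q) hZ' hW (hU.inter hU') (inter_subset_left.trans hUW) ⟨hxU, hxU'⟩ le_rfl hT₁0
        (lt_min hT₀ hT')
      rw [zero_add] at hδT hVβ
      refine ⟨V, δ, hV, hxV, hVU, hδ, hδT.trans (min_le_left _ _), hδT.trans (min_le_right _ _),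
        fun γ hγ t ht x hx => ?_⟩
      exact (hVβ β γ (hβ.mono inter_subset_left (min_le_left _ _))
        ((htransport _ _ _ hγ).mono inter_subset_right (min_le_right _ _))
        (fun z hz => (hβ0 z hz.1).trans (hγ.initial z hz.2).symm) t ht x hx).symm
  · subst hWu
    obtain ⟨T₀, hT₀, hT₀T, β, hβ, hβ0, hβa⟩ := exists_isLieEvolutionOn_univ hZ' hT₁0 hα
    refine ⟨T₀, β, hT₀, hT₀T.le.trans hT₁T, ⟨hβ.contDiffOn, fun x _ => hβ0 x, hβ.equation⟩,
      hβa.isPiecewiseAnalyticOn hT₀, fun t ht => hβa.isAnalyticTensorOn ht,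
      fun T' hT' hT'T γ hγ t ht x => ?_⟩
    exact ((hβ.mono subset_rfl hT'T).eqOn_of_compactSpace hZ' (hT'T.trans_lt hT₀T)
      (htransport _ _ _ hγ) (fun z => (hβ0 z).trans (hγ.initial z (mem_univ z)).symm) t ht x).symm
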